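/- **Setting.** Let $n,\ell,b,m,r$ be natural numbers with $\ell,b\ge 1$ and $n\ge rm+1$, put $\sigma=\sqrt{m/b}$, and let $0<a<c$ and $\delta\ge 0$ be real. *Sketch.* The randomness $\rho$ of CountSketch consists of independent, fully random hash functions $h_j:[n]\to[b]$ and sign functions $s_j:[n]\to\{-1,1\}$, $j\in[\ell]$. The measurement vectors are $\mu^{(j,k)}_i=\mathbf 1_{\{h_j(i)=k\}}s_j(i)$, and $\mathrm{Sketch}_\rho(v)=(\langle\mu^{(j,k)},v\rangle)_{j\in[\ell],k\in[b]}$. For a key $h$ write $\mu^{(j)}(\rho)=\mu^{(j,h_j(h))}$. *Attack.* Independently of $\rho$, choose a key $h\in[n]$ uniformly, then successively tails $z^{(1)},\dots,z^{(r)}\in\{-1,0,1\}^n$, where the support of $z^{(t)}$ is a uniformly random $m$-subset of the keys different from $h$ and not used by earlier tails, with i.i.d. uniform $\pm1$ values on it. Choose $v^{(t)}_h$ i.i.d. uniform on $[a\sigma,(c+2a)\sigma]$. The queries are $v^{(t)}=v^{(t)}_he_h+z^{(t)}$. At step $t$ a query-response algorithm applies an estimator to $\mathrm{Sketch}_\rho(v^{(t)})$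 and reports a set $K^{(t)}\subseteq[n]$; the estimator may be randomized, and its choice may depend on $\rho$, on $h$, on a maintained (random) state, and on the values $v^{(t')}_h$, the sketches and the reports $K^{(t')}$ of all earlier steps $t'<t$. Put $s^{(t)}=1$ if $h\in K^{(t)}$ and $s^{(t)}=-1$ otherwise. The attack outputs $z^{(A)}=\sum_{t\in[r]}s^{(t)}z^{(t)}$. *Correctness.* The algorithm is $(a,c,\delta)$-correct if for every $t\in[r]$ and every real $y$: $\Pr[h\in K^{(t)}\mid v^{(t)}_h=y]\ge 1-\delta$ when $y\ge c\sigma$, and $\Pr[h\in K^{(t)}\mid v^{(t)}_h=y]\le\delta$ when $|y|\le a\sigma$ (probabilities over all the randomness of the interaction; for $y$ outside the range of the queries, over the interaction in which the $t$-th value is replaced by $y$). **Statement.** Let $$X=\frac1\ell\sum_{j\in[\ell]}\langle z^{(A)},\mu^{(j)}(\rho)\rangle\,\mu^{(j)}_h(\rho),$$ where $\rho$ is the same randomness that was used in the attack. For every $\varepsilon>0$ there is $\kappa>0$, depending only on $\varepsilon$, such that for all $\ell,b\ge1$, $r\ge 0$, $0<a<c$ and $0\le\delta\le\kappa$ there is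 $m_0$ such that for all $m\ge m_0$, all $n\ge rm+1$ and every $(a,c,\delta)$-correct query-response algorithm, $X$ is square integrable, $$\left|\mathsf E[X]-\frac r\ell\cdot\frac{2\sigma}{c+a}\right|\le\varepsilon\cdot\frac r\ell\cdot\frac{2\sigma}{c+a},$$ and, if moreover $1+r\delta\le\kappa\,\ell\,(c+a)^2$, $$\left|\mathsf{Var}[X]-\frac r\ell\,\sigma^2\right|\le\varepsilon\cdot\frac r\ell\,\sigma^2 .$$ Here the expectation and variance are over $\rho$, $h$, the tails, the values $v^{(t)}_h$ and the random choices of the query-response algorithm. -/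

import Mathlib

open MeasureTheory ProbabilityTheory

noncomputable section

namespace CountSketch

/-- The internal randomness of `CountSketch` with parameters `(n, ℓ, b)`: for each row `j` a hash
function `[n] → [b]` and a sign function `[n] → {-1, 1}` (`true` stands for `1`). -/
abbrev Randomness (n ℓ b : ℕ) : Type :=
  (Fin ℓ → Fin n → Fin b) × (Fin ℓ → Fin n → Bool)

/-- The distribution of the internal randomness: fully random hash and sign functions. -/
def randomnessLaw (n ℓ b : ℕ) : Measure (Randomness n ℓ b) :=
  uniformOn Set.univ

/-- The measurement vector with index `(j, k)`: its `i`-th entry is the sign of `i` in row `j` if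
`i` is hashed to `k` in row `j`, and `0` otherwise. -/
def measVec {n ℓ b : ℕ} (ρ : Randomness n ℓ b) (j : Fin ℓ) (k : Fin b) : Fin n → ℝ :=
  fun i => if ρ.1 j i = k then (if ρ.2 j i then 1 else -1) else 0

/-- The measurement vector of row `j` in which the key `h` has a nonzero entry. -/
def keyVec {n ℓ b : ℕ} (ρ : Randomness n ℓ b) (h : Fin n) (j : Fin ℓ) : Fin n → ℝ :=
  measVec ρ j (ρ.1 j h)

/-- The sketch of a vector: the matrix of all its `ℓ * b` linear measurements. -/
def sketch {n ℓ b : ℕ} (ρ : Randomness n ℓ b) (v : Fin n → ℝ) : Fin ℓ → Fin b → ℝ :=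
  fun j k => measVec ρ j k ⬝ᵥ v

/-- The average adjusted measurement of key `h` from the sketch of `v`. -/
def avgAdjusted {n ℓ b : ℕ} (ρ : Randomness n ℓ b) (h : Fin n) (v : Fin n → ℝ) : ℝ :=
  (1 / (ℓ : ℝ)) * ∑ j : Fin ℓ, (v ⬝ᵥ keyVec ρ h j) * keyVec ρ h j h

/-- The possible outcomes `(h, z)` of the generation of the heavy key and the tails: `r` vectors
with entries in `{-1, 0, 1}`, with supports of size `m` that are pairwise disjoint and do not
contain `h`. -/
def tailOutcomes (n m r : ℕ) : Set (Fin n × (Fin r → Fin n → ℝ)) :=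
  {x | (∀ t i, x.2 t i = -1 ∨ x.2 t i = 0 ∨ x.2 t i = 1) ∧
    (∀ t, {i | x.2 t i ≠ 0}.ncard = m) ∧
    (∀ t, x.2 t x.1 = 0) ∧
    (∀ t₁ t₂, t₁ ≠ t₂ → Disjoint {i | x.2 t₁ i ≠ 0} {i | x.2 t₂ i ≠ 0})}

/-- The law of the heavy key and the tails.  Choosing `h` uniformly, then successively for each
tail a uniformly random `m`-subset of the unused keys, then i.i.d. Rademacher values on it, gives
every possible outcome the same probability. -/
def tailLaw (n m r : ℕ) : Measure (Fin n × (Fin r → Fin n → ℝ)) :=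
  uniformOn (tailOutcomes n m r)

/-- `σ = √(m / b)`. -/
def sigma (m b : ℕ) : ℝ := Real.sqrt ((m : ℝ) / (b : ℝ))

/-- The law of the values of the heavy key in the `r` queries: i.i.d. uniform on
`[a σ, (c + 2 a) σ]`. -/
def valueLaw (b m r : ℕ) (a c : ℝ) : Measure (Fin r → ℝ) :=
  Measure.pi fun _ => cond volume (Set.Icc (a * sigma m b) ((c + 2 * a) * sigma m b))

/-- The `r` query vectors `v_h e_h + z`. -/
def query {n r : ℕ} (h : Fin n) (z : Fin r → Fin n → ℝ) (v : Fin r → ℝ) : Fin r → Fin n → ℝ :=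
  fun t => v t • Pi.single h 1 + z t

/-- A query-response algorithm.  At step `t` it applies an estimator to the sketch of the current
query and reports a set of keys.  The choice of the estimator may depend on the sketch randomness,
on the heavy key, on the values of the heavy key, the sketches and the reported sets of all
earlier queries, and on a seed in `Ω`, from which the algorithm takes all its own random
choices (so that estimators may be randomized and a state may be maintained). -/
structure QueryResponse (n ℓ b r : ℕ) (Ω : Type*) [MeasurableSpace Ω] where
  /-- The set reported at step `t`, as a function of seed, sketch randomness, heavy key, history
  and current sketch. -/
  estimator : (t : Fin r) →
    Ω × Randomness n ℓ b × Fin n ×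
      (Fin t → ℝ × (Fin ℓ → Fin b → ℝ) × Set (Fin n)) × (Fin ℓ → Fin b → ℝ) → Set (Fin n)
  measurable_estimator : ∀ t, Measurable (estimator t)

namespace QueryResponse

variable {n ℓ b r : ℕ} {Ω : Type*} [MeasurableSpace Ω]

/-- The set of keys reported at step `t` when the algorithm is run on the query vectors `q`. -/
def response (Q : QueryResponse n ℓ b r Ω) (ω : Ω) (ρ : Randomness n ℓ b) (h : Fin n)
    (q : Fin r → Fin n → ℝ) (t : Fin r) : Set (Fin n) :=
  Q.estimator t (ω, ρ, h,
    (fun i : Fin t =>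
      (q ⟨i, i.isLt.trans t.isLt⟩ h, sketch ρ (q ⟨i, i.isLt.trans t.isLt⟩),
        response Q ω ρ h q ⟨i, i.isLt.trans t.isLt⟩)),
    sketch ρ (q t))
termination_by t.val
decreasing_by exact i.isLt

open Classical in
/-- The sign `s`: `1` if the heavy key is reported at step `t`, and `-1` otherwise. -/
def reportSign (Q : QueryResponse n ℓ b r Ω) (ω : Ω) (ρ : Randomness n ℓ b) (h : Fin n)
    (q : Fin r → Fin n → ℝ) (t : Fin r) : ℝ :=
  if h ∈ Q.response ω ρ h q t then 1 else -1

/-- The adversarial input: the sum of the tails with the signs read off from the reports. -/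
def adversarialInput (Q : QueryResponse n ℓ b r Ω) (ω : Ω) (ρ : Randomness n ℓ b) (h : Fin n)
    (z : Fin r → Fin n → ℝ) (v : Fin r → ℝ) : Fin n → ℝ :=
  ∑ t, Q.reportSign ω ρ h (query h z v) t • z t

end QueryResponse

/-- All the randomness of the attack: seed of the responder, sketch randomness, heavy key and
tails, values of the heavy key. -/
abbrev AttackSpace (n ℓ b r : ℕ) (Ω : Type*) : Type _ :=
  Ω × Randomness n ℓ b × (Fin n × (Fin r → Fin n → ℝ)) × (Fin r → ℝ)

/-- The law of the randomness of the attack; the four components are independent. -/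
def attackLaw (n ℓ b m r : ℕ) (a c : ℝ) {Ω : Type*} [MeasurableSpace Ω] (P : Measure Ω) :
    Measure (AttackSpace n ℓ b r Ω) :=
  P.prod ((randomnessLaw n ℓ b).prod ((tailLaw n m r).prod (valueLaw b m r a c)))

namespace QueryResponse

variable {n ℓ b r : ℕ} {Ω : Type*} [MeasurableSpace Ω]

/-- The average adjusted measurement of the heavy key from the sketch of the adversarial input,
taken with the same sketch randomness that was used in the attack. -/
def attackBias (Q : QueryResponse n ℓ b r Ω) (x : AttackSpace n ℓ b r Ω) : ℝ :=
  avgAdjusted x.2.1 x.2.2.1.1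
    (Q.adversarialInput x.1 x.2.1 x.2.2.1.1 x.2.2.1.2 x.2.2.2)

/-- The probability that the heavy key is reported at step `t` given that its value in the
query of step `t` is `y`.  The value is independent of everything else that enters, so
conditioning on it is substitution. -/
def reportProb (Q : QueryResponse n ℓ b r Ω) (m : ℕ) (a c : ℝ) (P : Measure Ω)
    (t : Fin r) (y : ℝ) : ℝ :=
  (attackLaw n ℓ b m r a c P).real
    {x | x.2.2.1.1 ∈ Q.response x.1 x.2.1 x.2.2.1.1
      (query x.2.2.1.1 x.2.2.1.2 (Function.update x.2.2.2 t y)) t}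

/-- At each step the output is correct with probability at least `1 - δ`: the heavy key is
reported when its value is at least `c σ`, and not reported when its absolute value is at
most `a σ`. -/
def IsCorrect (Q : QueryResponse n ℓ b r Ω) (m : ℕ) (a c δ : ℝ) (P : Measure Ω) : Prop :=
  ∀ t : Fin r, ∀ y : ℝ,
    (c * sigma m b ≤ y → 1 - δ ≤ Q.reportProb m a c P t y) ∧
    (|y| ≤ a * sigma m b → Q.reportProb m a c P t y ≤ δ)

end QueryResponse

end CountSketch

end

/-! By linearity the bias is a sum over the steps of `s_t * W_t`, where `W_t` is the average
adjusted measurement of the `t`-th tail. Multiplying the signs of that tail by fair signs `θ` and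
redrawing the `t`-th value `y` of the heavy key does not change the law of the attack. The report of
step `t` depends on the redrawn data only through the sketch `y • k + U`, where `k` is the sketch of
the heavy basis vector and `U` is a signed sum of the columns of the tail keys. So the task is to
estimate the mean of `φ (y • k + U) * W` for an arbitrary function `φ` with values `±1`, with no
smoothness at hand.

This is done by a discrete integration by parts. `W` is a linear form in the signs that build `U`;
correlating `φ` with the sign of one key produces a difference of `φ` under a shift by twice the
column of that key. The types (buckets and signs in all rows) of the tail keys are almost
equidistributed, so after weighting by the agreement with the heavy key only the direction `k`
survives. The mean is `m / (4 * b * ℓ) * (S y - S (y - 4))` up to an error that on average stays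
bounded as `m` grows, where `S` is the conditional mean sign as a function of the value
(`abs_avg_mul_avgAdjusted_sub_le`). Averaging over `y` telescopes: only windows of length 4 at the
two ends of the range remain (`abs_meanStep_sub_le`). Correctness makes the expected gap between the
windows nearly 2, while the gap never exceeds 2, so a step contributes about `2 * σ / (ℓ * (c +
a))`. Since `σ` tends to infinity with `m`, bounded errors are negligible.

The errors are controlled for all `φ` at once by working in the group algebra of the sketch space
with the `ℓ¹` norm. There the law of `U` is a product of symmetric two-point averages. If each
column occurs about `M` times, a single difference against such a product has norm of order `1 /
√M`, because a Rademacher sum of `M` terms has mean absolute value at most `√M`. Second-order terms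
therefore have order `1 / M`, and there are `m` of them with `m / M` bounded.

For the variance, `s_t ^ 2 = 1` gives each step the second moment `m / (b * ℓ) = σ ^ 2 / ℓ` to
leading order. The conditional mean of a step is nearly constant, so its correlation with the past
is small, and its squared mean is negligible when `ℓ * (c + a) ^ 2` is large. An induction over the
steps adds these estimates up (`abs_variance_partialBias_sub_le`). -/

noncomputable section

namespace CountSketch

section

/-! ### Sums over functions on a finite type -/

/-- Resampling one coordinate of a uniformly random function does not change averages. -/
lemma sum_sum_update {ι α M : Type*} [Fintype ι] [DecidableEq ι] [Fintype α] [AddCommMonoid M]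
    (i : ι) (G : (ι → α) → M) :
    ∑ f : ι → α, ∑ c : α, G (Function.update f i c) = Fintype.card α • ∑ f : ι → α, G f := by
  have h : ∑ p : (ι → α) × α, G (Function.update p.1 i p.2) = ∑ p : (ι → α) × α, G p.1 := by
    -- Exchanging the `i`-th value with the spare one is an involution of the pairs.
    refine Finset.sum_nbij' (fun p => (Function.update p.1 i p.2, p.1 i))
      (fun p => (Function.update p.1 i p.2, p.1 i)) ?_ ?_ ?_ ?_ ?_ <;> simp
  rw [Fintype.sum_prod_type, Fintype.sum_prod_type] at h
  rw [h, Finset.smul_sum]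
  simp

/-- The sign encoded by a Boolean. -/
def sgn (s : Bool) : ℝ := if s then 1 else -1

@[simp] lemma sgn_true : sgn true = 1 := rfl
@[simp] lemma sgn_false : sgn false = -1 := rfl
@[simp] lemma sgn_not (s : Bool) : sgn (!s) = -sgn s := by cases s <;> simp
@[simp] lemma abs_sgn (s : Bool) : |sgn s| = 1 := by cases s <;> simp
@[simp] lemma sgn_mul_self (s : Bool) : sgn s * sgn s = 1 := by cases s <;> simp

/-- The average over all functions to a finite type. -/
def avg {ι α E : Type*} [Fintype ι] [DecidableEq ι] [Fintype α] [AddCommGroup E] [Module ℝ E]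
    (G : (ι → α) → E) : E :=
  ((Fintype.card α : ℝ) ^ Fintype.card ι)⁻¹ • ∑ f : ι → α, G f

section Avg

variable {ι α E : Type*} [Fintype ι] [DecidableEq ι] [Fintype α] [AddCommGroup E] [Module ℝ E]

lemma avg_add (G G' : (ι → α) → E) : avg (fun f => G f + G' f) = avg G + avg G' := by
  simp [avg, Finset.sum_add_distrib]

lemma avg_sub (G G' : (ι → α) → E) : avg (fun f => G f - G' f) = avg G - avg G' := by
  simp [avg, Finset.sum_sub_distrib, smul_sub]

lemma avg_smul (c : ℝ) (G : (ι → α) → E) : avg (fun f => c • G f) = c • avg G := by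
  simp only [avg, ← Finset.smul_sum]
  rw [smul_comm]

lemma avg_mul_left (c : ℝ) (G : (ι → α) → ℝ) : avg (fun f => c * G f) = c * avg G :=
  avg_smul c G

lemma avg_sum {κ : Type*} (s : Finset κ) (G : κ → (ι → α) → E) :
    avg (fun f => ∑ k ∈ s, G k f) = ∑ k ∈ s, avg (G k) := by
  simp only [avg, ← Finset.smul_sum]
  rw [Finset.sum_comm]

lemma map_avg {F : Type*} [AddCommGroup F] [Module ℝ F] (L : E →ₗ[ℝ] F) (G : (ι → α) → E) :
    L (avg G) = avg fun f => L (G f) := by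
  simp [avg]

lemma avg_mono {G G' : (ι → α) → ℝ} (h : ∀ f, G f ≤ G' f) : avg G ≤ avg G' := by
  simp only [avg, smul_eq_mul]
  have := Finset.sum_le_sum fun f (_ : f ∈ Finset.univ) => h f
  gcongr

lemma avg_const [Nonempty α] (c : E) : avg (fun _ : ι → α => c) = c := by
  have : (Fintype.card α : ℝ) ≠ 0 := by simp
  simp only [avg, Finset.sum_const, Finset.card_univ, Fintype.card_fun]
  rw [← Nat.cast_smul_eq_nsmul ℝ, smul_smul, Nat.cast_pow, inv_mul_cancel₀ (by positivity),
    one_smul]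

lemma avg_nonneg {G : (ι → α) → ℝ} (h : ∀ f, 0 ≤ G f) : 0 ≤ avg G := by
  simp only [avg, smul_eq_mul]
  have := Finset.sum_nonneg fun f (_ : f ∈ Finset.univ) => h f
  positivity

lemma abs_avg_le (G : (ι → α) → ℝ) : |avg G| ≤ avg fun f => |G f| := by
  simp only [avg, smul_eq_mul]
  rw [abs_mul, abs_of_nonneg (by positivity)]
  gcongr
  exact Finset.abs_sum_le_sum_abs _ _

lemma norm_avg_le {E : Type*} [SeminormedAddCommGroup E] [NormedSpace ℝ E] (G : (ι → α) → E) :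
    ‖avg G‖ ≤ avg fun f => ‖G f‖ := by
  simp only [avg, smul_eq_mul]
  rw [norm_smul, Real.norm_of_nonneg (by positivity)]
  gcongr
  exact norm_sum_le _ _

lemma sq_avg_le [Nonempty α] (G : (ι → α) → ℝ) : avg G ^ 2 ≤ avg fun f => G f ^ 2 := by
  have h : 0 ≤ avg fun f => (G f - avg G) ^ 2 := avg_nonneg fun f => sq_nonneg _
  have e : (fun f => (G f - avg G) ^ 2)
      = fun f => G f ^ 2 - (2 * avg G) * G f + avg G ^ 2 := by ext f; ring
  rw [e, avg_add, avg_sub, avg_mul_left, avg_const] at h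
  nlinarith

/-- Averages are unchanged by resampling one coordinate. -/
lemma avg_update [Nonempty α] (i : ι) (G : (ι → α) → E) :
    avg (fun f => (Fintype.card α : ℝ)⁻¹ • ∑ c, G (Function.update f i c)) = avg G := by
  have : (Fintype.card α : ℝ) ≠ 0 := by simp
  rw [avg_smul]
  simp only [avg]
  rw [sum_sum_update, ← Nat.cast_smul_eq_nsmul ℝ, smul_comm, smul_smul (Fintype.card α : ℝ)⁻¹,
    inv_mul_cancel₀ this, one_smul]

/-- A function of one coordinate with mean zero is orthogonal to functions of the others. -/
lemma avg_mul_eq_zero [Nonempty α] {i i' : ι} (hi : i ≠ i') (g g' : α → ℝ) (hg : ∑ c, g c = 0) :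
    avg (fun f : ι → α => g (f i) * g' (f i')) = 0 := by
  rw [← avg_update i]
  simp [Function.update_of_ne hi.symm, ← Finset.sum_mul, hg, avg]

lemma avg_apply [Nonempty α] (i : ι) (g : α → ℝ) :
    avg (fun f : ι → α => g (f i)) = (Fintype.card α : ℝ)⁻¹ * ∑ c, g c := by
  rw [← avg_update i]
  simp [avg_const]

/-- The second moment of a sum of independent centred variables. -/
lemma avg_sum_sq [Nonempty α] (s : Finset ι) (g : ι → α → ℝ) (hg : ∀ i, ∑ c, g i c = 0) :
    avg (fun f : ι → α => (∑ i ∈ s, g i (f i)) ^ 2)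
      = ∑ i ∈ s, (Fintype.card α : ℝ)⁻¹ * ∑ c, g i c ^ 2 := by
  have e : (fun f : ι → α => (∑ i ∈ s, g i (f i)) ^ 2)
      = fun f => ∑ i ∈ s, ∑ i' ∈ s, g i (f i) * g i' (f i') := by
    ext f; rw [sq, Finset.sum_mul_sum]
  rw [e, avg_sum]
  refine Finset.sum_congr rfl fun i hi => ?_
  rw [avg_sum, Finset.sum_eq_single_of_mem i hi fun i' _ h => avg_mul_eq_zero h.symm _ _ (hg i)]
  rw [← avg_apply i]
  simp [sq]

end Avg

/-- The second moment of a Rademacher sum. -/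
lemma avg_sgn_sum_sq {ι : Type*} [Fintype ι] [DecidableEq ι] (q : ι → ℝ) :
    avg (fun θ : ι → Bool => (∑ i, sgn (θ i) * q i) ^ 2) = ∑ i, q i ^ 2 := by
  rw [avg_sum_sq Finset.univ (fun i s => sgn s * q i) (by simp)]
  refine Finset.sum_congr rfl fun i _ => ?_
  simp
  ring

lemma avg_abs_sgn_sum_le {ι : Type*} [Fintype ι] [DecidableEq ι] (q : ι → ℝ) :
    avg (fun θ : ι → Bool => |∑ i, sgn (θ i) * q i|) ≤ √(∑ i, q i ^ 2) := by
  rw [← avg_sgn_sum_sq]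
  refine Real.le_sqrt_of_sq_le ?_
  simpa using sq_avg_le fun θ : ι → Bool => |∑ i, sgn (θ i) * q i|

/-! ### Translations in a commutative normed ring -/

/-- A representation of an additive group by elements of norm at most one. -/
structure IsShift {V A : Type*} [AddCommGroup V] [SeminormedCommRing A] (T : V → A) : Prop where
  zero : T 0 = 1
  add : ∀ x y, T (x + y) = T x * T y
  norm_le : ∀ x, ‖T x‖ ≤ 1

section Shift

variable {V A : Type*} [AddCommGroup V] [SeminormedCommRing A] {T : V → A}

/-- The backward difference with step `2 x`. -/
def shiftD (T : V → A) (x : V) : A := 1 - T (-(x + x))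

lemma IsShift.mul_neg (hT : IsShift T) (x : V) : T x * T (-x) = 1 := by
  rw [← hT.add, add_neg_cancel, hT.zero]

lemma IsShift.sum (hT : IsShift T) {ι : Type*} (s : Finset ι) (x : ι → V) :
    T (∑ i ∈ s, x i) = ∏ i ∈ s, T (x i) := by
  classical
  induction s using Finset.induction_on with
  | empty => simp [hT.zero]
  | insert i s hi ih => rw [Finset.sum_insert hi, Finset.prod_insert hi, hT.add, ih]

lemma IsShift.norm_one_le (hT : IsShift T) : ‖(1 : A)‖ ≤ 1 := hT.zero ▸ hT.norm_le 0

lemma norm_mul_le_one {a b : A} (ha : ‖a‖ ≤ 1) (hb : ‖b‖ ≤ 1) : ‖a * b‖ ≤ 1 :=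
  (norm_mul_le a b).trans (mul_le_one₀ ha (norm_nonneg b) hb)

lemma IsShift.norm_prod_le_one (hT : IsShift T) {ι : Type*} (s : Finset ι) (a : ι → A) (h : ∀ i ∈ s, ‖a i‖ ≤ 1) :
    ‖∏ i ∈ s, a i‖ ≤ 1 :=
  Finset.prod_induction a (fun a => ‖a‖ ≤ 1) (fun _ _ => norm_mul_le_one) hT.norm_one_le h

lemma IsShift.norm_pow_le_one (hT : IsShift T) {a : A} (h : ‖a‖ ≤ 1) (k : ℕ) : ‖a ^ k‖ ≤ 1 := by
  simpa using hT.norm_prod_le_one (Finset.range k) (fun _ => a) fun _ _ => h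

/-- `1 - shiftD` is multiplicative. Thus differences are additive up to a product of two of them,
which is of second order. -/
lemma IsShift.shiftD_add (hT : IsShift T) (x y : V) :
    shiftD T (x + y) = shiftD T x + shiftD T y - shiftD T x * shiftD T y := by
  have : T (-(x + y + (x + y))) = T (-(x + x)) * T (-(y + y)) := by
    rw [← hT.add]; congr 1; abel
  rw [shiftD, shiftD, shiftD, this]
  ring

lemma IsShift.shiftD_sub (hT : IsShift T) (x y : V) :
    shiftD T (x - y) = T (y + y) * (shiftD T x - shiftD T y) := by
  have h1 : T (-(x - y + (x - y))) = T (y + y) * T (-(x + x)) := by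
    rw [← hT.add]; congr 1; abel
  rw [shiftD, shiftD, shiftD, h1]
  linear_combination (-1 : A) * hT.mul_neg (y + y)

variable [NormedAlgebra ℝ A]


/-- The average of the translations by `x` and by `-x`. -/
def shiftC (T : V → A) (x : V) : A := (1 / 2 : ℝ) • (T x + T (-x))

/-- Half of the difference of the translations by `x` and by `-x`. -/
def shiftS (T : V → A) (x : V) : A := (1 / 2 : ℝ) • (T x - T (-x))

lemma IsShift.norm_shiftC_le (hT : IsShift T) (x : V) : ‖shiftC T x‖ ≤ 1 := by
  have h1 := hT.norm_le x
  have h2 := hT.norm_le (-x)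
  have := norm_add_le (T x) (T (-x))
  rw [shiftC, norm_smul, Real.norm_of_nonneg (by norm_num)]
  linarith

lemma IsShift.shiftC_zero (hT : IsShift T) : shiftC T 0 = 1 := by
  rw [shiftC, neg_zero, ← two_smul ℝ, smul_smul, hT.zero]; norm_num

lemma shiftC_neg (x : V) : shiftC T (-x) = shiftC T x := by
  rw [shiftC, shiftC, neg_neg, add_comm]

lemma shiftS_neg (x : V) : shiftS T (-x) = -shiftS T x := by
  rw [shiftS, shiftS, neg_neg, ← smul_neg, neg_sub]

lemma IsShift.shiftD_eq (hT : IsShift T) (x : V) : shiftD T x = T (-x) * ((2 : ℝ) • shiftS T x) := by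
  have h2 : T (-(x + x)) = T (-x) * T (-x) := by rw [← hT.add]; congr 1; abel
  rw [shiftD, shiftS, smul_smul, h2]
  norm_num
  linear_combination (-1 : A) * hT.mul_neg x

/-- Integration by parts produces `shiftS` at one key and `shiftC` at the others. Trading `shiftS`
for half of `shiftD * shiftC` restores the full product of the `shiftC`, at the price of a
second-order term. -/
lemma IsShift.shiftS_sub (hT : IsShift T) (x : V) :
    shiftS T x - (1 / 2 : ℝ) • (shiftD T x * shiftC T x)
      = (1 / 4 : ℝ) • (T x * shiftD T x ^ 2) := by
  have h2 : T (-(x + x)) = T (-x) * T (-x) := by rw [← hT.add]; congr 1; abel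
  have h : T x * T (-x) = 1 := hT.mul_neg x
  rw [shiftS, shiftD, shiftC, h2]
  simp only [mul_smul_comm, smul_smul]
  rw [show (1 / 2 * (1 / 2) : ℝ) = 1 / 4 by norm_num, show (1 / 2 : ℝ) = 1 / 4 * 2 by norm_num,
    mul_smul, ← smul_sub]
  congr 1
  rw [two_smul]
  linear_combination (3 * T (-x) - T (-x) ^ 3) * h

end Shift

end

/-! ### Rademacher averages of translations and the decay of differences -/

section

section Expand

variable {V A : Type*} [AddCommGroup V] [Module ℝ V] [SeminormedCommRing A] [NormedAlgebra ℝ A]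
  {T : V → A} {ι : Type*} [Fintype ι] [DecidableEq ι]

lemma avg_prod (g : ι → Bool → A) :
    avg (fun θ : ι → Bool => ∏ i, g i (θ i)) = ∏ i, (1 / 2 : ℝ) • ∑ s, g i s := by
  rw [Finset.prod_smul, Finset.prod_univ_sum, Fintype.piFinset_univ, Finset.prod_const, avg]
  simp

lemma IsShift.avg_eq_prod (hT : IsShift T) (x : ι → V) :
    avg (fun θ : ι → Bool => T (∑ i, sgn (θ i) • x i)) = ∏ i, shiftC T (x i) := by
  simp only [hT.sum]
  rw [avg_prod fun i s => T (sgn s • x i)]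
  simp [shiftC]

lemma IsShift.avg_sgn_smul (hT : IsShift T) (x : ι → V) (i : ι) :
    avg (fun θ : ι → Bool => sgn (θ i) • T (∑ i, sgn (θ i) • x i))
      = shiftS T (x i) * ∏ i' ∈ Finset.univ.erase i, shiftC T (x i') := by
  have h : (fun θ : ι → Bool => sgn (θ i) • T (∑ i, sgn (θ i) • x i))
      = fun θ => ∏ i', (if i' = i then sgn (θ i') else 1) • T (sgn (θ i') • x i') := by
    ext θ
    rw [hT.sum, Finset.prod_smul]
    simp
  rw [h, avg_prod fun i' s => (if i' = i then sgn s else 1) • T (sgn s • x i'),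
    ← Finset.mul_prod_erase _ _ (Finset.mem_univ i)]
  congr 1
  · simp [shiftS, sub_eq_add_neg]
  · refine Finset.prod_congr rfl fun i' hi' => ?_
    simp [Finset.ne_of_mem_erase hi', shiftC]

lemma IsShift.avg_sum_smul (hT : IsShift T) (x : ι → V) (q : ι → ℝ) :
    avg (fun θ : ι → Bool => (∑ i, sgn (θ i) * q i) • T (∑ i, sgn (θ i) • x i))
      = ∑ i, q i • (shiftS T (x i) * ∏ i' ∈ Finset.univ.erase i, shiftC T (x i')) := by
  simp only [← hT.avg_sgn_smul, ← avg_smul]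
  rw [← avg_sum]
  congr 1
  ext θ
  rw [Finset.sum_smul]
  exact Finset.sum_congr rfl fun i _ => by rw [mul_comm, mul_smul]

/-- Read backwards, the sum is an average of translations weighted by a Rademacher sum, so its norm
is at most the mean absolute value of that sum. This gains a square root over the triangle
inequality. -/
lemma IsShift.norm_sum_smul_le (hT : IsShift T) (x : ι → V) (q : ι → ℝ) :
    ‖∑ i, q i • (shiftS T (x i) * ∏ i' ∈ Finset.univ.erase i, shiftC T (x i'))‖
      ≤ √(∑ i, q i ^ 2) := by
  rw [← hT.avg_sum_smul]
  refine (norm_avg_le _).trans ((avg_mono fun θ => ?_).trans (avg_abs_sgn_sum_le q))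
  rw [norm_smul, Real.norm_eq_abs]
  exact mul_le_of_le_one_right (abs_nonneg _) (hT.norm_le _)

/-- The case of `k + 1` equal columns with weights 1: the `k + 1` equal summands together have norm
at most `√(k + 1)`. -/
lemma IsShift.norm_shiftS_mul_pow_le (hT : IsShift T) (x : V) (k : ℕ) :
    ‖shiftS T x * shiftC T x ^ k‖ ≤ 1 / √(k + 1) := by
  have h := hT.norm_sum_smul_le (fun _ : Fin (k + 1) => x) fun _ => 1
  simp only [one_smul, Finset.prod_const, Finset.card_erase_of_mem (Finset.mem_univ _),
    Finset.card_univ, Fintype.card_fin, Finset.sum_const, add_tsub_cancel_right, one_pow,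
    nsmul_eq_mul, mul_one] at h
  rw [← nsmul_eq_mul, ← Nat.cast_smul_eq_nsmul ℝ, norm_smul] at h
  push_cast at h
  rw [Real.norm_of_nonneg (by positivity)] at h
  rw [le_div_iff₀ (by positivity)]
  have hk : 0 < √((k : ℝ) + 1) := by positivity
  have hs : √((k : ℝ) + 1) * √((k : ℝ) + 1) = k + 1 := Real.mul_self_sqrt (by positivity)
  nlinarith

lemma IsShift.norm_shiftD_mul_pow_le (hT : IsShift T) (x : V) (k : ℕ) :
    ‖shiftD T x * shiftC T x ^ k‖ ≤ 2 / √(k + 1) := by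
  rw [hT.shiftD_eq, mul_assoc, smul_mul_assoc]
  have h1 := hT.norm_shiftS_mul_pow_le x k
  have h2 := norm_mul_le (T (-x)) ((2 : ℝ) • (shiftS T x * shiftC T x ^ k))
  rw [norm_smul] at h2
  have h3 := hT.norm_le (-x)
  have : ‖(2 : ℝ)‖ = 2 := by norm_num
  rw [this] at h2
  have h4 : ‖T (-x)‖ * (2 * ‖shiftS T x * shiftC T x ^ k‖)
      ≤ 1 * (2 * ‖shiftS T x * shiftC T x ^ k‖) := by gcongr
  calc _ ≤ 2 * ‖shiftS T x * shiftC T x ^ k‖ := by linarith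
    _ ≤ 2 * (1 / √(k + 1)) := by gcongr
    _ = _ := by ring

end Expand

/-! ### Differences are additive up to second order -/

section Linear

variable {V A : Type*} [AddCommGroup V] [SeminormedCommRing A] {T : V → A}

/-- Every difference needs its own copy of the smoothing factor `H` to become small, hence the
square. -/
lemma norm_mul_mul_sq_le {a b H : A} {α β : ℝ} (ha : ‖a * H‖ ≤ α) (hb : ‖b * H‖ ≤ β) :
    ‖a * b * H ^ 2‖ ≤ α * β := by
  rw [show a * b * H ^ 2 = (a * H) * (b * H) by ring]
  exact (norm_mul_le _ _).trans
    (mul_le_mul ha hb (norm_nonneg _) ((norm_nonneg _).trans ha))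

lemma IsShift.norm_shiftD_sub_mul_le (hT : IsShift T) {H : A} {η : ℝ} {x y : V}
    (hx : ‖shiftD T x * H‖ ≤ η) (hy : ‖shiftD T y * H‖ ≤ η) :
    ‖shiftD T (x - y) * H‖ ≤ 2 * η := by
  rw [hT.shiftD_sub, mul_assoc, sub_mul]
  refine (norm_mul_le _ _).trans ((mul_le_of_le_one_left (norm_nonneg _) (hT.norm_le _)).trans ?_)
  linarith [norm_sub_le (shiftD T x * H) (shiftD T y * H)]

lemma IsShift.norm_shiftD_sub_sub_le (hT : IsShift T) {H : A} {η : ℝ} {x y : V}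
    (hx : ‖shiftD T x * H‖ ≤ η) (hy : ‖shiftD T y * H‖ ≤ η) :
    ‖(shiftD T x - shiftD T y - shiftD T (x - y)) * H ^ 2‖ ≤ 2 * η ^ 2 := by
  have h := hT.shiftD_add y (x - y)
  rw [add_sub_cancel] at h
  rw [show (shiftD T x - shiftD T y - shiftD T (x - y)) * H ^ 2
    = -(shiftD T y * shiftD T (x - y) * H ^ 2) by rw [h]; ring, norm_neg]
  exact (norm_mul_mul_sq_le hy (hT.norm_shiftD_sub_mul_le hx hy)).trans (by linarith)

/-- By `shiftD_add`, a new summand adds an error which is the product of its own difference with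
that of the partial sum. The first bound, of size `card * η`, controls that product in the induction
for the second. -/
lemma IsShift.norm_shiftD_sum_le (hT : IsShift T) {H : A} {η : ℝ} {J : Type*} (s : Finset J)
    (d : J → V) (hd : ∀ j, ‖shiftD T (d j) * H‖ ≤ η) :
    ‖shiftD T (∑ j ∈ s, d j) * H‖ ≤ s.card * η ∧
      ‖(shiftD T (∑ j ∈ s, d j) - ∑ j ∈ s, shiftD T (d j)) * H ^ 2‖ ≤ s.card ^ 2 * η ^ 2 := by
  classical
  induction s using Finset.induction_on with
  | empty => simp [shiftD, hT.zero]
  | insert j s hj ih =>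
    obtain ⟨ih1, ih2⟩ := ih
    have hη : 0 ≤ η := (norm_nonneg _).trans (hd j)
    rw [Finset.sum_insert hj, Finset.sum_insert hj, Finset.card_insert_of_notMem hj]
    push_cast
    constructor
    · have e : shiftD T (d j + ∑ j ∈ s, d j)
          = shiftD T (d j) + T (-(d j + d j)) * shiftD T (∑ j ∈ s, d j) := by
        rw [hT.shiftD_add]
        simp only [shiftD]
        ring
      rw [e, add_mul, mul_assoc]
      have h1 := norm_add_le (shiftD T (d j) * H)
        (T (-(d j + d j)) * (shiftD T (∑ j ∈ s, d j) * H))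
      have h2 := (norm_mul_le (T (-(d j + d j))) (shiftD T (∑ j ∈ s, d j) * H)).trans
        (mul_le_of_le_one_left (norm_nonneg _) (hT.norm_le _))
      linarith [hd j]
    · rw [hT.shiftD_add, show (shiftD T (d j) + shiftD T (∑ j ∈ s, d j)
          - shiftD T (d j) * shiftD T (∑ j ∈ s, d j) - (shiftD T (d j) + ∑ j ∈ s, shiftD T (d j)))
          * H ^ 2 = (shiftD T (∑ j ∈ s, d j) - ∑ j ∈ s, shiftD T (d j)) * H ^ 2
          - shiftD T (d j) * shiftD T (∑ j ∈ s, d j) * H ^ 2 by ring]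
      refine (norm_sub_le _ _).trans ?_
      have := norm_mul_mul_sq_le (hd j) ih1
      nlinarith [sq_nonneg η, mul_nonneg (Nat.cast_nonneg (α := ℝ) s.card) (sq_nonneg η)]

variable [NormedAlgebra ℝ A] {J B : Type*} [Fintype J] [DecidableEq J] [Fintype B] [DecidableEq B]

/-- A bucket with the opposite sign. -/
def flip (c : B × Bool) : B × Bool := (c.1, !c.2)

/-- The product of the signs of two entries if they lie in the same bucket, and `0` otherwise. -/
def rel (c c' : B × Bool) : ℝ := if c.1 = c'.1 then sgn c.2 * sgn c'.2 else 0

/-- The weight `rel c c₀` vanishes outside the bucket of `c₀` and changes sign with the sign of `c`.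
This is how agreement with the heavy key picks out the direction of that key. -/
lemma sum_rel_smul {E : Type*} [AddCommGroup E] [Module ℝ E] (c₀ : B × Bool) (F : B × Bool → E) :
    ∑ c, rel c c₀ • F c = F c₀ - F (flip c₀) := by
  rw [Fintype.sum_prod_type, Finset.sum_eq_single c₀.1]
  · rcases c₀ with ⟨k, s⟩
    cases s <;> simp [rel, flip, sub_eq_add_neg, add_comm]
  · intro k _ hk
    simp [rel, hk]
  · simp

lemma sum_rel (c₀ : B × Bool) : ∑ c, rel c c₀ = 0 := by
  simpa using sum_rel_smul c₀ fun _ => (1 : ℝ)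

lemma sum_rel_sq (c₀ : B × Bool) : ∑ c, rel c c₀ ^ 2 = 2 := by
  have := sum_rel_smul c₀ fun c => rel c c₀
  simp only [smul_eq_mul, ← sq] at this
  rw [this]
  rcases c₀ with ⟨k, s⟩
  cases s <;> norm_num [rel, flip]

omit [Fintype B] in
lemma abs_rel_le (c c₀ : B × Bool) : |rel c c₀| ≤ 1 := by
  unfold rel
  split_ifs <;> simp [abs_mul]

/-- Resampling row `j` turns the weight of that row into a difference of `shiftD` at two columns.
These differ by a vector that does not depend on the other rows, so up to a second-order term the
result is `shiftD` at that vector. Additivity up to second order then collects the rows. The factor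
`(card (B × Bool))⁻¹` is the probability of one value of the resampled entry. -/
lemma IsShift.norm_avg_rel_le [Nonempty B] (hT : IsShift T) (e : J → B × Bool → V)
    (τ₀ : J → B × Bool)
    {H : A} {η : ℝ} (hη : ∀ τ : J → B × Bool, ‖shiftD T (∑ j, e j (τ j)) * H‖ ≤ η) :
    ‖(avg (fun τ : J → B × Bool => (∑ j, rel (τ j) (τ₀ j)) • shiftD T (∑ j, e j (τ j)))
        - (Fintype.card (B × Bool) : ℝ)⁻¹ •
          shiftD T (∑ j, (e j (τ₀ j) - e j (flip (τ₀ j))))) * H ^ 2‖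
      ≤ (2 * Fintype.card J + 4 * Fintype.card J ^ 2) * η ^ 2 := by
  set K : ℝ := (Fintype.card (B × Bool) : ℝ)⁻¹ with hK
  have hK0 : 0 ≤ K := by positivity
  have hK1 : K ≤ 1 := by
    refine inv_le_one_of_one_le₀ ?_
    exact_mod_cast Nat.one_le_iff_ne_zero.2 Fintype.card_ne_zero
  have hcol : ∀ (j : J) (τ : J → B × Bool) (c : B × Bool),
      ∑ i, e i (Function.update τ j c i) = e j c + ∑ i ∈ Finset.univ.erase j, e i (τ i) := by
    intro j τ c
    rw [← Finset.add_sum_erase _ _ (Finset.mem_univ j), Function.update_self]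
    congr 1
    exact Finset.sum_congr rfl fun i hi => by
      rw [Function.update_of_ne (Finset.ne_of_mem_erase hi)]
  have hdiff : ∀ (j : J) (τ : J → B × Bool), e j (τ₀ j) - e j (flip (τ₀ j))
      = ∑ i, e i (Function.update τ j (τ₀ j) i)
        - ∑ i, e i (Function.update τ j (flip (τ₀ j)) i) := by
    intro j τ; rw [hcol, hcol]; abel
  -- The vector of one row is a difference of two columns, which costs `2 * η`; its square is the 4
  -- in the bound.
  have hd : ∀ j, ‖shiftD T (e j (τ₀ j) - e j (flip (τ₀ j))) * H‖ ≤ 2 * η := by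
    intro j
    rw [hdiff j τ₀]
    exact hT.norm_shiftD_sub_mul_le (hη _) (hη _)
  have hrow : ∀ j, ‖avg (fun τ : J → B × Bool =>
      (shiftD T (∑ i, e i (Function.update τ j (τ₀ j) i))
        - shiftD T (∑ i, e i (Function.update τ j (flip (τ₀ j)) i))
        - shiftD T (e j (τ₀ j) - e j (flip (τ₀ j)))) * H ^ 2)‖ ≤ 2 * η ^ 2 := by
    intro j
    refine (norm_avg_le _).trans ((avg_mono fun τ => ?_).trans (avg_const _).le)
    rw [hdiff j τ]
    exact hT.norm_shiftD_sub_sub_le (hη _) (hη _)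
  have hsum := (hT.norm_shiftD_sum_le Finset.univ
    (fun j => e j (τ₀ j) - e j (flip (τ₀ j))) hd).2
  have hmul : ∀ G : (J → B × Bool) → A, avg (fun τ => G τ * H ^ 2) = avg G * H ^ 2 := by
    intro G
    exact (map_avg (LinearMap.mulRight ℝ (H ^ 2)) G).symm
  have key : (avg (fun τ : J → B × Bool => (∑ j, rel (τ j) (τ₀ j)) • shiftD T (∑ j, e j (τ j)))
        - K • shiftD T (∑ j, (e j (τ₀ j) - e j (flip (τ₀ j))))) * H ^ 2
      = K • (∑ j, avg (fun τ : J → B × Bool =>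
        (shiftD T (∑ i, e i (Function.update τ j (τ₀ j) i))
          - shiftD T (∑ i, e i (Function.update τ j (flip (τ₀ j)) i))
          - shiftD T (e j (τ₀ j) - e j (flip (τ₀ j)))) * H ^ 2)
        - (shiftD T (∑ j, (e j (τ₀ j) - e j (flip (τ₀ j))))
          - ∑ j, shiftD T (e j (τ₀ j) - e j (flip (τ₀ j)))) * H ^ 2) := by
    have h1 : ∀ j, avg (fun τ : J → B × Bool => rel (τ j) (τ₀ j) • shiftD T (∑ j, e j (τ j)))
        = K • avg (fun τ : J → B × Bool =>
          (shiftD T (∑ i, e i (Function.update τ j (τ₀ j) i))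
            - shiftD T (∑ i, e i (Function.update τ j (flip (τ₀ j)) i)))) := by
      intro j
      rw [← avg_update j, ← avg_smul]
      congr 1
      ext τ
      simp only [Function.update_self]
      rw [sum_rel_smul (τ₀ j) fun c => shiftD T (∑ i, e i (Function.update τ j c i))]
    simp only [Finset.sum_smul, avg_sum, h1, hmul]
    simp only [avg_sub, avg_const, Finset.sum_sub_distrib, sub_mul, smul_sub, Finset.sum_mul,
      Finset.smul_sum, smul_mul_assoc]
    abel
  rw [key, norm_smul, Real.norm_of_nonneg hK0]
  refine (mul_le_of_le_one_left (norm_nonneg _) hK1).trans ((norm_sub_le _ _).trans ?_)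
  have h2 := (norm_sum_le _ _).trans (Finset.sum_le_sum fun j (_ : j ∈ Finset.univ) => hrow j)
  simp only [Finset.sum_const, Finset.card_univ, nsmul_eq_mul] at h2 hsum
  linarith

end Linear

end

/-! ### Integration by parts when every type of column occurs often -/

section

/-- The number of nonzero entries of `z` at positions of a given type. -/
def typeCount {ι 𝒯 : Type*} [Fintype ι] [DecidableEq 𝒯] (z : ι → ℝ) (ty : ι → 𝒯) (τ : 𝒯) : ℕ :=
  {i | z i ≠ 0 ∧ ty i = τ}.ncard

section Types

variable {V A : Type*} [AddCommGroup V] [Module ℝ V] [SeminormedCommRing A] [NormedAlgebra ℝ A]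
  {T : V → A} {ι : Type*} [Fintype ι] [DecidableEq ι] {𝒯 : Type*} [Fintype 𝒯] [DecidableEq 𝒯]

-- Only `2 * M` factors of each type are used for smoothing, in two equal halves that serve the two
-- differences of a second-order term; the surplus factors have norm at most one.
omit [Module ℝ V] [Fintype ι] [DecidableEq ι] in
lemma IsShift.exists_prod_eq (hT : IsShift T) (col : 𝒯 → V) (ty : ι → 𝒯) (I : Finset ι) (M : ℕ)
    (hM : ∀ τ, 2 * M ≤ (I.filter fun i => ty i = τ).card) :
    ∃ R : A, ‖R‖ ≤ 1 ∧
      ∏ i ∈ I, shiftC T (col (ty i)) = (∏ τ, shiftC T (col τ) ^ M) ^ 2 * R := by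
  refine ⟨∏ τ, shiftC T (col τ) ^ ((I.filter fun i => ty i = τ).card - 2 * M),
    hT.norm_prod_le_one _ _ fun τ _ => hT.norm_pow_le_one (hT.norm_shiftC_le _) _, ?_⟩
  rw [← Finset.prod_pow, ← Finset.prod_mul_distrib, ← Finset.prod_fiberwise I ty]
  refine Finset.prod_congr rfl fun τ _ => ?_
  rw [Finset.prod_congr rfl (g := fun _ => shiftC T (col τ))
    fun i hi => by rw [(Finset.mem_filter.1 hi).2], Finset.prod_const, ← pow_mul, ← pow_add]
  congr 1
  have := hM τ
  omega

lemma IsShift.norm_shiftD_mul_prod_le (hT : IsShift T) (col : 𝒯 → V) (M : ℕ) (τ : 𝒯) :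
    ‖shiftD T (col τ) * ∏ τ, shiftC T (col τ) ^ M‖ ≤ 2 / √(M + 1) := by
  rw [← Finset.mul_prod_erase _ _ (Finset.mem_univ τ), ← mul_assoc]
  refine (norm_mul_le _ _).trans ((mul_le_of_le_one_right (norm_nonneg _) ?_).trans
    (hT.norm_shiftD_mul_pow_le _ _))
  exact hT.norm_prod_le_one _ _ fun τ _ => hT.norm_pow_le_one (hT.norm_shiftC_le _) _

variable {J B : Type*} [Fintype J] [DecidableEq J] [Fintype B] [DecidableEq B] [Nonempty B]

/-- The integration by parts in the algebra. The three errors come from replacing `shiftS` by half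
of `shiftD * shiftC`, from replacing the type counts by a common value `N`, and from replacing the
weighted average over the types by a single difference. -/
lemma IsShift.norm_avg_sub_le (hT : IsShift T) (e : J → B × Bool → V) (τ₀ : J → B × Bool)
    (ty : ι → J → B × Bool) (z : ι → ℝ) (hz : ∀ i, z i = -1 ∨ z i = 0 ∨ z i = 1)
    (M : ℕ) (N : ℝ) (hN : 0 ≤ N)
    (hM : ∀ τ, 2 * M + 1 ≤ typeCount z ty τ) :
    ‖avg (fun θ : ι → Bool => (∑ i, sgn (θ i) * (z i * ∑ j, rel (ty i j) (τ₀ j))) •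
          T (∑ i, sgn (θ i) • z i • ∑ j, e j (ty i j)))
        - (N * Fintype.card (J → B × Bool) / (2 * Fintype.card (B × Bool))) •
          (avg (fun θ : ι → Bool => T (∑ i, sgn (θ i) • z i • ∑ j, e j (ty i j))) *
            shiftD T (∑ j, (e j (τ₀ j) - e j (flip (τ₀ j)))))‖
      ≤ ({i | z i ≠ 0}.ncard * Fintype.card J) * (1 / (M + 1))
        + (Fintype.card J * ∑ τ, |typeCount z ty τ - N|) * (1 / √(M + 1))
        + N * Fintype.card (J → B × Bool) *
          (4 * Fintype.card J + 8 * Fintype.card J ^ 2) * (1 / (M + 1)) := by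
  classical
  set col : (J → B × Bool) → V := fun τ => ∑ j, e j (τ j) with hcol
  set q : (J → B × Bool) → ℝ := fun τ => ∑ j, rel (τ j) (τ₀ j) with hq
  set I : Finset ι := Finset.univ.filter fun i => z i ≠ 0 with hI
  set H : A := ∏ τ, shiftC T (col τ) ^ M with hH
  set η : ℝ := 2 / √((M : ℝ) + 1) with hη
  have hη2 : η ^ 2 = 4 * (1 / (M + 1)) := by
    rw [hη, div_pow, Real.sq_sqrt (by positivity)]; ring
  have hcard : ∀ τ, typeCount z ty τ = (I.filter fun i => ty i = τ).card := by
    intro τ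
    rw [typeCount, Set.ncard_eq_toFinset_card', hI, Finset.filter_filter]
    congr 1
    ext i
    simp
  have hIcard : {i | z i ≠ 0}.ncard = I.card := by
    rw [Set.ncard_eq_toFinset_card']; congr 1; ext i; simp [hI]
  have hH1 : ‖H‖ ≤ 1 :=
    hT.norm_prod_le_one _ _ fun τ _ => hT.norm_pow_le_one (hT.norm_shiftC_le _) _
  have hf : ∀ τ, ‖shiftD T (col τ) * H‖ ≤ η := hT.norm_shiftD_mul_prod_le col M
  have hqle : ∀ τ, |q τ| ≤ Fintype.card J := fun τ =>
    (Finset.abs_sum_le_sum_abs _ _).trans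
      ((Finset.sum_le_sum fun j _ => abs_rel_le _ _).trans (by simp))
  have hJ : (0 : ℝ) ≤ Fintype.card J := Nat.cast_nonneg _
  obtain ⟨R, hR1, hR⟩ := hT.exists_prod_eq col ty I M fun τ => by
    have := hM τ; rw [hcard] at this; omega
  -- The key `i` is missing from the product, so `2 * M + 1` keys of each type are required to leave
  -- `2 * M`.
  have hRi : ∀ i ∈ I, ∃ R : A, ‖R‖ ≤ 1 ∧
      ∏ i' ∈ I.erase i, shiftC T (col (ty i')) = H ^ 2 * R := by
    intro i _
    refine hT.exists_prod_eq col ty (I.erase i) M fun τ => ?_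
    have h1 := hM τ
    rw [hcard] at h1
    rw [Finset.filter_erase]
    have := Finset.pred_card_le_card_erase (a := i) (s := I.filter fun i => ty i = τ)
    omega
  -- `shiftC` is even and `shiftS` is odd, so the signs of the entries of `z` disappear and only its
  -- support matters.
  have hC : ∀ i, shiftC T (z i • col (ty i)) = if z i ≠ 0 then shiftC T (col (ty i)) else 1 := by
    intro i
    rcases hz i with h | h | h <;> rw [h] <;> simp [hT.shiftC_zero, shiftC_neg]
  have hS : ∀ i ∈ I, z i • shiftS T (z i • col (ty i)) = shiftS T (col (ty i)) := by
    intro i hi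
    rcases hz i with h | h | h
    · rw [h]; simp [shiftS_neg]
    · exact absurd h (Finset.mem_filter.1 hi).2
    · rw [h]; simp
  set P : A := avg (fun θ : ι → Bool => T (∑ i, sgn (θ i) • z i • col (ty i))) with hP
  have hPR : P = H ^ 2 * R := by
    rw [hP, hT.avg_eq_prod, ← hR, hI, Finset.prod_filter]
    exact Finset.prod_congr rfl fun i _ => hC i
  have hE : avg (fun θ : ι → Bool => (∑ i, sgn (θ i) * (z i * q (ty i))) •
        T (∑ i, sgn (θ i) • z i • col (ty i)))
      = ∑ i ∈ I, q (ty i) • (shiftS T (col (ty i)) *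
          ∏ i' ∈ I.erase i, shiftC T (col (ty i'))) := by
    rw [hT.avg_sum_smul, ← Finset.sum_filter_add_sum_filter_not Finset.univ (fun i => z i ≠ 0),
      ← hI]
    rw [Finset.sum_eq_zero (s := Finset.univ.filter fun i => ¬ z i ≠ 0), add_zero]
    · refine Finset.sum_congr rfl fun i hi => ?_
      rw [mul_comm, mul_smul, ← smul_mul_assoc, hS i hi]
      congr 2
      rw [hI, ← Finset.filter_erase, Finset.prod_filter]
      exact Finset.prod_congr rfl fun i _ => hC i
    · intro i hi
      have : z i = 0 := by simpa using hi
      simp [this]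
  -- The remainder in `shiftS_sub` has norm at most `η ^ 2 / 4 = 1 / (M + 1)` after smoothing.
  have hterm : ∀ i ∈ I, ‖q (ty i) • (shiftS T (col (ty i)) *
        ∏ i' ∈ I.erase i, shiftC T (col (ty i')))
      - (1 / 2 : ℝ) • q (ty i) • (shiftD T (col (ty i)) * P)‖
      ≤ Fintype.card J * (1 / (M + 1)) := by
    intro i hi
    obtain ⟨Ri, hRi1, hRi⟩ := hRi i hi
    have hPi : P = shiftC T (col (ty i)) * (H ^ 2 * Ri) := by
      rw [hPR, ← hR, ← hRi, Finset.mul_prod_erase I (fun i => shiftC T (col (ty i))) hi]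
    have e1 : q (ty i) • (shiftS T (col (ty i)) *
        ∏ i' ∈ I.erase i, shiftC T (col (ty i')))
      - (1 / 2 : ℝ) • q (ty i) • (shiftD T (col (ty i)) * P)
      = q (ty i) • (1 / 4 : ℝ) • (T (col (ty i)) *
        ((shiftD T (col (ty i)) * shiftD T (col (ty i)) * H ^ 2) * Ri)) := by
      rw [hRi, hPi, smul_comm (1 / 2 : ℝ), ← smul_sub, ← mul_assoc (shiftD T _),
        ← smul_mul_assoc, ← sub_mul, hT.shiftS_sub, smul_mul_assoc]
      congr 2
      ring
    rw [e1, norm_smul, norm_smul, Real.norm_eq_abs, Real.norm_of_nonneg (by norm_num)]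
    have h2 := norm_mul_mul_sq_le (hf (ty i)) (hf (ty i))
    have h3 : ‖T (col (ty i)) *
        ((shiftD T (col (ty i)) * shiftD T (col (ty i)) * H ^ 2) * Ri)‖ ≤ η * η :=
      (norm_mul_le _ _).trans ((mul_le_of_le_one_left (norm_nonneg _) (hT.norm_le _)).trans
        ((norm_mul_le _ _).trans ((mul_le_of_le_one_right (norm_nonneg _) hRi1).trans h2)))
    calc _ ≤ (Fintype.card J : ℝ) * (1 / 4 * (η * η)) := by
          gcongr
          exact hqle _
      _ = _ := by rw [← sq, hη2]; ring
  have hfib : ∑ i ∈ I, q (ty i) • (shiftD T (col (ty i)) * P)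
      = ∑ τ, (typeCount z ty τ : ℝ) • q τ • (shiftD T (col τ) * P) := by
    rw [← Finset.sum_fiberwise I ty]
    refine Finset.sum_congr rfl fun τ _ => ?_
    rw [Finset.sum_congr rfl (g := fun _ => q τ • (shiftD T (col τ) * P))
      fun i hi => by rw [(Finset.mem_filter.1 hi).2], Finset.sum_const, hcard,
      Nat.cast_smul_eq_nsmul]
  have hcardne : (Fintype.card (J → B × Bool) : ℝ) ≠ 0 := by simp
  have havg : ∑ τ, q τ • (shiftD T (col τ) * P)
      = (Fintype.card (J → B × Bool) : ℝ) • (avg (fun τ => q τ • shiftD T (col τ)) * P) := by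
    have : avg (fun τ => q τ • shiftD T (col τ)) * P
        = avg fun τ => q τ • (shiftD T (col τ) * P) := by
      simpa using map_avg (LinearMap.mulRight ℝ P) fun τ => q τ • shiftD T (col τ)
    rw [this]
    simp only [avg]
    rw [smul_smul]
    have : (Fintype.card (J → B × Bool) : ℝ)
        = (Fintype.card (B × Bool) : ℝ) ^ Fintype.card J := by simp
    rw [← this, mul_inv_cancel₀ hcardne, one_smul]
  have hrel := hT.norm_avg_rel_le e τ₀ hf
  have hfP : ∀ τ, ‖shiftD T (col τ) * P‖ ≤ η := by
    intro τ
    rw [hPR, show shiftD T (col τ) * (H ^ 2 * R) = (shiftD T (col τ) * H) * (H * R) by ring]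
    exact (norm_mul_le _ _).trans ((mul_le_of_le_one_right (norm_nonneg _)
      (norm_mul_le_one hH1 hR1)).trans (hf τ))
  set K : ℝ := (Fintype.card (B × Bool) : ℝ)⁻¹ with hK
  set D2 : A := shiftD T (∑ j, (e j (τ₀ j) - e j (flip (τ₀ j)))) with hD2
  rw [hE]
  -- The three summands on the right are the three sources of error, in the order of the bound.
  have key : ∑ i ∈ I, q (ty i) • (shiftS T (col (ty i)) *
        ∏ i' ∈ I.erase i, shiftC T (col (ty i')))
      - (N * Fintype.card (J → B × Bool) / (2 * Fintype.card (B × Bool))) • (P * D2)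
      = ∑ i ∈ I, (q (ty i) • (shiftS T (col (ty i)) *
          ∏ i' ∈ I.erase i, shiftC T (col (ty i')))
        - (1 / 2 : ℝ) • q (ty i) • (shiftD T (col (ty i)) * P))
      + (1 / 2 : ℝ) • ∑ τ, ((typeCount z ty τ : ℝ) - N) • q τ • (shiftD T (col τ) * P)
      + (N / 2 * Fintype.card (J → B × Bool)) •
        ((avg (fun τ => q τ • shiftD T (col τ)) - K • D2) * H ^ 2 * R) := by
    have e2 : (avg (fun τ => q τ • shiftD T (col τ)) - K • D2) * H ^ 2 * R
        = avg (fun τ => q τ • shiftD T (col τ)) * P - K • (P * D2) := by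
      rw [hPR, sub_mul, sub_mul, smul_mul_assoc, smul_mul_assoc]
      congr 1
      · ring
      · congr 1; ring
    rw [e2, Finset.sum_sub_distrib, ← Finset.smul_sum, hfib]
    simp only [sub_smul, Finset.sum_sub_distrib]
    rw [← Finset.smul_sum (r := N), havg, smul_sub, smul_sub, smul_smul, smul_smul, smul_smul,
      show N * (Fintype.card (J → B × Bool) : ℝ) / (2 * Fintype.card (B × Bool))
        = N / 2 * Fintype.card (J → B × Bool) * K by rw [hK]; ring,
      show 1 / 2 * N * (Fintype.card (J → B × Bool) : ℝ)
        = N / 2 * Fintype.card (J → B × Bool) by ring]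
    abel
  rw [key, hIcard]
  refine (norm_add_le _ _).trans (add_le_add ((norm_add_le _ _).trans (add_le_add ?_ ?_)) ?_)
  · refine (norm_sum_le _ _).trans ((Finset.sum_le_sum hterm).trans ?_)
    rw [Finset.sum_const, nsmul_eq_mul, mul_assoc]
  · rw [norm_smul, Real.norm_of_nonneg (by norm_num)]
    have : ∀ τ ∈ Finset.univ, ‖((typeCount z ty τ : ℝ) - N) • q τ • (shiftD T (col τ) * P)‖
        ≤ |typeCount z ty τ - N| * (Fintype.card J * η) := by
      intro τ _
      rw [norm_smul, norm_smul, Real.norm_eq_abs, Real.norm_eq_abs]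
      have h1 := hfP τ
      have h2 := hqle τ
      gcongr
    have h3 := (norm_sum_le _ _).trans (Finset.sum_le_sum this)
    rw [← Finset.sum_mul] at h3
    have h4 : (1 / 2 : ℝ) * ((∑ τ, |(typeCount z ty τ : ℝ) - N|) * (Fintype.card J * η))
        = (Fintype.card J * ∑ τ, |typeCount z ty τ - N|) * (1 / √(M + 1)) := by
      rw [hη]; ring
    rw [← h4]
    gcongr
  · rw [norm_smul, Real.norm_of_nonneg (by positivity)]
    have h5 := (norm_mul_le ((avg (fun τ => q τ • shiftD T (col τ)) - K • D2) * H ^ 2) R).trans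
      ((mul_le_of_le_one_right (norm_nonneg _) hR1).trans hrel)
    calc _ ≤ N / 2 * Fintype.card (J → B × Bool) *
          ((2 * Fintype.card J + 4 * Fintype.card J ^ 2) * η ^ 2) := by gcongr
      _ = _ := by rw [hη2]; ring

end Types

end

/-! ### The `ℓ¹` group algebra and the passage to bounded functions -/

section

section L1

variable {V : Type*}

/-- The sum of the absolute values of the coefficients. -/
def l1 (a : AddMonoidAlgebra ℝ V) : ℝ := a.coeff.sum fun _ c => |c|

lemma l1_single (x : V) (c : ℝ) : l1 (AddMonoidAlgebra.single x c) = |c| := by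
  rw [l1, AddMonoidAlgebra.coeff_single]
  exact Finsupp.sum_single_index abs_zero

lemma l1_eq_sum (a : AddMonoidAlgebra ℝ V) (s : Finset V) (h : a.coeff.support ⊆ s) :
    l1 a = ∑ x ∈ s, |a.coeff x| :=
  Finsupp.sum_of_support_subset _ h _ fun _ _ => abs_zero

lemma l1_add_le (a a' : AddMonoidAlgebra ℝ V) : l1 (a + a') ≤ l1 a + l1 a' := by
  classical
  rw [l1_eq_sum a (a.coeff.support ∪ a'.coeff.support) Finset.subset_union_left,
    l1_eq_sum a' (a.coeff.support ∪ a'.coeff.support) Finset.subset_union_right,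
    l1_eq_sum (a + a') (a.coeff.support ∪ a'.coeff.support)
      (by rw [AddMonoidAlgebra.coeff_add]; exact Finsupp.support_add),
    ← Finset.sum_add_distrib]
  exact Finset.sum_le_sum fun x _ => by simpa using abs_add_le _ _

lemma l1_smul (c : ℝ) (a : AddMonoidAlgebra ℝ V) : l1 (c • a) = |c| * l1 a := by
  rw [l1_eq_sum (c • a) a.coeff.support
    (by rw [AddMonoidAlgebra.coeff_smul]; exact Finsupp.support_smul), l1, Finsupp.sum,
    Finset.mul_sum]
  exact Finset.sum_congr rfl fun x _ => by simp [abs_mul]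

lemma l1_neg (a : AddMonoidAlgebra ℝ V) : l1 (-a) = l1 a := by
  rw [← neg_one_smul ℝ a, l1_smul]; simp

lemma l1_zero : l1 (0 : AddMonoidAlgebra ℝ V) = 0 := by simp [l1]

lemma l1_sum_le {ι : Type*} (s : Finset ι) (f : ι → AddMonoidAlgebra ℝ V) :
    l1 (∑ i ∈ s, f i) ≤ ∑ i ∈ s, l1 (f i) := by
  classical
  induction s using Finset.induction_on with
  | empty => simp [l1_zero]
  | insert i s hi ih =>
    rw [Finset.sum_insert hi, Finset.sum_insert hi]
    exact (l1_add_le _ _).trans (by linarith)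

variable [AddCommGroup V]

lemma l1_mul_le (a a' : AddMonoidAlgebra ℝ V) : l1 (a * a') ≤ l1 a * l1 a' := by
  have h : l1 a * l1 a' = ∑ x ∈ a.coeff.support, ∑ y ∈ a'.coeff.support,
      |a.coeff x| * |a'.coeff y| := by
    rw [l1, l1, Finsupp.sum, Finsupp.sum, Finset.sum_mul_sum]
  rw [AddMonoidAlgebra.mul_def, h]
  refine (l1_sum_le _ _).trans (Finset.sum_le_sum fun x _ => ?_)
  refine (l1_sum_le _ _).trans (Finset.sum_le_sum fun y _ => ?_)
  rw [l1_single, abs_mul]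

/-- The group algebra as a normed ring, with the `ℓ¹` norm. -/
@[reducible] def l1Ring : SeminormedCommRing (AddMonoidAlgebra ℝ V) :=
  { AddGroupSeminorm.toSeminormedAddCommGroup
      ({ toFun := l1, map_zero' := l1_zero, add_le' := l1_add_le, neg' := l1_neg } :
        AddGroupSeminorm (AddMonoidAlgebra ℝ V)),
    (inferInstance : CommRing (AddMonoidAlgebra ℝ V)) with
    norm_mul_le := l1_mul_le }

attribute [local instance] l1Ring

/-- The group algebra as a normed algebra, with the `ℓ¹` norm. -/
@[reducible] def l1Algebra : NormedAlgebra ℝ (AddMonoidAlgebra ℝ V) :=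
  { (inferInstance : Algebra ℝ (AddMonoidAlgebra ℝ V)) with
    norm_smul_le := fun c a => (l1_smul c a).le }

attribute [local instance] l1Algebra

/-- Translations in the group algebra. -/
def transl (x : V) : AddMonoidAlgebra ℝ V := AddMonoidAlgebra.single x 1

lemma isShift_transl : IsShift (transl (V := V)) where
  zero := rfl
  add x y := by simp [transl, AddMonoidAlgebra.single_mul_single]
  norm_le x := (l1_single x 1).le.trans (by simp)

/-- The linear functional on the group algebra given by a function on the group. -/
def evalAt (φ : V → ℝ) : AddMonoidAlgebra ℝ V →ₗ[ℝ] ℝ where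
  toFun a := a.coeff.sum fun x c => c * φ x
  map_add' a a' := by
    rw [AddMonoidAlgebra.coeff_add]
    exact Finsupp.sum_add_index' (by simp) (by intros; ring)
  map_smul' c a := by
    rw [AddMonoidAlgebra.coeff_smul, Finsupp.sum_smul_index (by simp), Finsupp.sum, Finsupp.sum,
      RingHom.id_apply, smul_eq_mul, Finset.mul_sum]
    exact Finset.sum_congr rfl fun x _ => by ring

omit [AddCommGroup V] in
lemma evalAt_transl (φ : V → ℝ) (x : V) : evalAt φ (transl x) = φ x := by
  change ((transl x).coeff.sum fun x c => c * φ x) = φ x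
  rw [transl, AddMonoidAlgebra.coeff_single, Finsupp.sum_single_index] <;> simp

lemma abs_evalAt_le (φ : V → ℝ) (hφ : ∀ x, |φ x| ≤ 1) (a : AddMonoidAlgebra ℝ V) :
    |evalAt φ a| ≤ ‖a‖ := by
  refine (Finset.abs_sum_le_sum_abs _ _).trans (Finset.sum_le_sum fun x _ => ?_)
  rw [abs_mul]
  exact mul_le_of_le_one_right (abs_nonneg _) (hφ x)

variable [Module ℝ V] {ι : Type*} [Fintype ι] [DecidableEq ι]
  {J B : Type*} [Fintype J] [DecidableEq J] [Fintype B] [DecidableEq B] [Nonempty B]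

/-- Integration by parts for a bounded function of a signed sum of columns. -/
lemma abs_avg_sub_le (φ : V → ℝ) (hφ : ∀ x, |φ x| ≤ 1) (e : J → B × Bool → V)
    (he : ∀ j c, e j (flip c) = -e j c)
    (τ₀ : J → B × Bool)
    (ty : ι → J → B × Bool) (z : ι → ℝ) (hz : ∀ i, z i = -1 ∨ z i = 0 ∨ z i = 1)
    (M : ℕ) (N : ℝ) (hN : 0 ≤ N)
    (hM : ∀ τ, 2 * M + 1 ≤ typeCount z ty τ) :
    |avg (fun θ : ι → Bool => (∑ i, sgn (θ i) * (z i * ∑ j, rel (ty i j) (τ₀ j))) *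
          φ (∑ i, sgn (θ i) • z i • ∑ j, e j (ty i j)))
        - (N * Fintype.card (J → B × Bool) / (2 * Fintype.card (B × Bool))) *
          avg (fun θ : ι → Bool => φ (∑ i, sgn (θ i) • z i • ∑ j, e j (ty i j)) -
            φ (∑ i, sgn (θ i) • z i • ∑ j, e j (ty i j) - (4 : ℝ) • ∑ j, e j (τ₀ j)))|
      ≤ ({i | z i ≠ 0}.ncard * Fintype.card J) * (1 / (M + 1))
        + (Fintype.card J * ∑ τ, |typeCount z ty τ - N|) * (1 / √(M + 1))
        + N * Fintype.card (J → B × Bool) *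
          (4 * Fintype.card J + 8 * Fintype.card J ^ 2) * (1 / (M + 1)) := by
  -- Evaluation at `φ` is a functional of norm at most one, so the bound in the algebra holds for
  -- every bounded `φ`, however irregular.
  refine le_trans (le_of_eq ?_) ((abs_evalAt_le φ hφ _).trans
    (isShift_transl.norm_avg_sub_le e τ₀ ty z hz M N hN hM))
  -- Flipping the sign negates a column, which gives a factor 2; `shiftD` translates by twice its
  -- argument, which gives another.
  have h4 : -((∑ j, (e j (τ₀ j) - e j (flip (τ₀ j))))
      + ∑ j, (e j (τ₀ j) - e j (flip (τ₀ j)))) = -((4 : ℝ) • ∑ j, e j (τ₀ j)) := by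
    simp only [he, sub_neg_eq_add, Finset.sum_add_distrib]
    rw [show (4 : ℝ) = 1 + 1 + 1 + 1 by norm_num]
    simp only [add_smul, one_smul]
    abel
  have h5 : avg (fun θ : ι → Bool => transl (∑ i, sgn (θ i) • z i • ∑ j, e j (ty i j))) *
      shiftD transl (∑ j, (e j (τ₀ j) - e j (flip (τ₀ j))))
      = avg fun θ : ι → Bool => transl (∑ i, sgn (θ i) • z i • ∑ j, e j (ty i j)) -
        transl (∑ i, sgn (θ i) • z i • ∑ j, e j (ty i j) - (4 : ℝ) • ∑ j, e j (τ₀ j)) := by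
    have := map_avg (LinearMap.mulRight ℝ
      (shiftD (transl (V := V)) (∑ j, (e j (τ₀ j) - e j (flip (τ₀ j))))))
      (fun θ : ι → Bool => transl (∑ i, sgn (θ i) • z i • ∑ j, e j (ty i j)))
    simp only [LinearMap.mulRight_apply] at this
    rw [this]
    congr 1
    ext1 θ
    rw [shiftD, h4, mul_sub, mul_one, ← isShift_transl.add, ← sub_eq_add_neg]
  rw [h5, map_sub, map_smul, map_avg, map_avg]
  simp only [map_smul, map_sub, evalAt_transl, smul_eq_mul]

end L1

end

/-! ### Sketches as sums of columns, and conditional moments given the supports -/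

section

variable {n ℓ b m r : ℕ}

/-- The bucket and the sign of a key in every row. -/
def keyType (ρ : Randomness n ℓ b) (i : Fin n) (j : Fin ℓ) : Fin b × Bool := (ρ.1 j i, ρ.2 j i)

/-- The contribution of row `j` to the sketch of a basis vector. -/
def entry (j : Fin ℓ) (c : Fin b × Bool) : Fin ℓ → Fin b → ℝ :=
  Pi.single j (Pi.single c.1 (sgn c.2))

lemma entry_flip (j : Fin ℓ) (c : Fin b × Bool) : entry j (flip c) = -entry j c := by
  simp [entry, flip, Pi.single_neg]

/-- A vector with the signs of its entries changed. -/
def signed (θ : Fin n → Bool) (z : Fin n → ℝ) : Fin n → ℝ := fun i => sgn (θ i) * z i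

lemma sketch_eq (ρ : Randomness n ℓ b) (v : Fin n → ℝ) :
    sketch ρ v = ∑ i, v i • ∑ j, entry j (keyType ρ i j) := by
  ext j k
  simp only [sketch, dotProduct, measVec, Finset.sum_apply, Pi.smul_apply, smul_eq_mul]
  refine Finset.sum_congr rfl fun i _ => ?_
  rw [Finset.sum_eq_single j]
  · rw [mul_comm]
    by_cases hk : ρ.1 j i = k
    · subst hk; cases hs : ρ.2 j i <;> simp [entry, keyType, hs]
    · simp [entry, keyType, hk, Ne.symm hk]
  · intro j' _ hj
    simp [entry, hj.symm]
  · simp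

lemma sketch_add (ρ : Randomness n ℓ b) (v w : Fin n → ℝ) :
    sketch ρ (v + w) = sketch ρ v + sketch ρ w := by
  ext j k; simp [sketch, dotProduct_add]

lemma sketch_smul (ρ : Randomness n ℓ b) (c : ℝ) (v : Fin n → ℝ) :
    sketch ρ (c • v) = c • sketch ρ v := by
  ext j k; simp [sketch]

lemma sketch_single (ρ : Randomness n ℓ b) (h : Fin n) :
    sketch ρ (Pi.single h 1) = ∑ j, entry j (keyType ρ h j) := by
  rw [sketch_eq, Finset.sum_eq_single h]
  · simp
  · intro i _ hi; simp [hi]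
  · simp

lemma sketch_query (ρ : Randomness n ℓ b) (h : Fin n) (z : Fin r → Fin n → ℝ) (v : Fin r → ℝ)
    (t : Fin r) : sketch ρ (query h z v t) = v t • sketch ρ (Pi.single h 1) + sketch ρ (z t) := by
  rw [query, sketch_add, sketch_smul]

lemma sketch_signed (ρ : Randomness n ℓ b) (θ : Fin n → Bool) (z : Fin n → ℝ) :
    sketch ρ (signed θ z) = ∑ i, sgn (θ i) • z i • ∑ j, entry j (keyType ρ i j) := by
  simp [sketch_eq, signed, mul_smul]

/-- The sum over the rows of the relative signs of two keys. -/
def relSum (τ τ₀ : Fin ℓ → Fin b × Bool) : ℝ := ∑ j, rel (τ j) (τ₀ j)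

lemma abs_relSum_le (τ τ₀ : Fin ℓ → Fin b × Bool) : |relSum τ τ₀| ≤ ℓ :=
  (Finset.abs_sum_le_sum_abs _ _).trans
    ((Finset.sum_le_sum fun j _ => abs_rel_le _ _).trans (by simp))

lemma avgAdjusted_eq (ρ : Randomness n ℓ b) (h : Fin n) (v : Fin n → ℝ) :
    avgAdjusted ρ h v = (1 / (ℓ : ℝ)) * ∑ i, v i * relSum (keyType ρ i) (keyType ρ h) := by
  simp only [avgAdjusted, dotProduct, relSum, Finset.sum_mul]
  rw [Finset.sum_comm]
  congr 1
  refine Finset.sum_congr rfl fun i _ => ?_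
  rw [Finset.mul_sum]
  refine Finset.sum_congr rfl fun j _ => ?_
  rw [mul_assoc]
  congr 1
  have h1 : keyVec ρ h j i = if ρ.1 j i = ρ.1 j h then sgn (ρ.2 j i) else 0 := rfl
  have h2 : keyVec ρ h j h = sgn (ρ.2 j h) := by simp [keyVec, measVec, sgn]
  have h3 : rel (keyType ρ i j) (keyType ρ h j)
      = if ρ.1 j i = ρ.1 j h then sgn (ρ.2 j i) * sgn (ρ.2 j h) else 0 := rfl
  rw [h1, h2, h3]
  split_ifs <;> simp

lemma avgAdjusted_signed (ρ : Randomness n ℓ b) (h : Fin n) (θ : Fin n → Bool) (z : Fin n → ℝ) :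
    avgAdjusted ρ h (signed θ z)
      = (1 / (ℓ : ℝ)) * ∑ i, sgn (θ i) * (z i * relSum (keyType ρ i) (keyType ρ h)) := by
  simp [avgAdjusted_eq, signed, mul_assoc]

lemma avgAdjusted_sum {κ : Type*} (ρ : Randomness n ℓ b) (h : Fin n) (s : Finset κ)
    (c : κ → ℝ) (v : κ → Fin n → ℝ) :
    avgAdjusted ρ h (∑ t ∈ s, c t • v t) = ∑ t ∈ s, c t * avgAdjusted ρ h (v t) := by
  simp only [avgAdjusted_eq, Finset.sum_apply, Pi.smul_apply, smul_eq_mul, Finset.sum_mul,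
    Finset.mul_sum]
  rw [Finset.sum_comm]
  refine Finset.sum_congr rfl fun i _ => Finset.sum_congr rfl fun j _ => ?_
  ring

/-- The number of types of keys. -/
def numTypes (ℓ b : ℕ) : ℝ := Fintype.card (Fin ℓ → Fin b × Bool)

/-- The total deviation of the numbers of nonzero entries of `z` of each type from their mean. -/
def typeDev (m : ℕ) (ρ : Randomness n ℓ b) (z : Fin n → ℝ) : ℝ :=
  ∑ τ, |(typeCount z (keyType ρ) τ : ℝ) - m / numTypes ℓ b|

lemma typeDev_nonneg (ρ : Randomness n ℓ b) (z : Fin n → ℝ) : 0 ≤ typeDev m ρ z :=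
  Finset.sum_nonneg fun _ _ => abs_nonneg _

/-- A vector with entries in `{-1, 0, 1}` and support of size `m`. -/
def IsTail (m : ℕ) (z : Fin n → ℝ) : Prop :=
  (∀ i, z i = -1 ∨ z i = 0 ∨ z i = 1) ∧ {i | z i ≠ 0}.ncard = m

lemma IsTail.sum_sq {z : Fin n → ℝ} (hz : IsTail m z) (g : Fin n → ℝ) :
    ∑ i, z i ^ 2 * g i = ∑ i ∈ Finset.univ.filter (fun i => z i ≠ 0), g i := by
  rw [Finset.sum_filter]
  refine Finset.sum_congr rfl fun i _ => ?_
  rcases hz.1 i with h | h | h <;> simp [h]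

lemma IsTail.card_filter {z : Fin n → ℝ} (hz : IsTail m z) :
    (Finset.univ.filter fun i => z i ≠ 0).card = m := by
  rw [← hz.2, Set.ncard_eq_toFinset_card']; congr 1; ext i; simp

lemma typeCount_eq {𝒯 : Type*} [DecidableEq 𝒯] (z : Fin n → ℝ) (ty : Fin n → 𝒯) (τ : 𝒯) :
    typeCount z ty τ
      = ((Finset.univ.filter fun i => z i ≠ 0).filter fun i => ty i = τ).card := by
  rw [typeCount, Set.ncard_eq_toFinset_card', Finset.filter_filter]
  congr 1; ext i; simp

lemma IsTail.sum_sq_type {z : Fin n → ℝ} (hz : IsTail m z) {𝒯 : Type*} [Fintype 𝒯]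
    [DecidableEq 𝒯] (ty : Fin n → 𝒯) (g : 𝒯 → ℝ) :
    ∑ i, z i ^ 2 * g (ty i) = ∑ τ, typeCount z ty τ * g τ := by
  rw [hz.sum_sq, ← Finset.sum_fiberwise _ ty]
  refine Finset.sum_congr rfl fun τ _ => ?_
  rw [Finset.sum_congr rfl (g := fun _ => g τ)
      fun i hi => by rw [(Finset.mem_filter.1 hi).2], Finset.sum_const, typeCount_eq,
      nsmul_eq_mul]

lemma numTypes_pos (hb : 0 < b) : 0 < numTypes ℓ b := by
  have : Nonempty (Fin b) := ⟨⟨0, hb⟩⟩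
  rw [numTypes]
  exact_mod_cast Fintype.card_pos

lemma one_le_numTypes (hb : 0 < b) : 1 ≤ numTypes ℓ b := by
  have : Nonempty (Fin b) := ⟨⟨0, hb⟩⟩
  rw [numTypes]
  exact_mod_cast Fintype.card_pos

/-- The conditional second moment of the average adjusted measurement, given the supports. -/
lemma avg_avgAdjusted_sq (hℓ : 0 < ℓ) (hb : 0 < b) (ρ : Randomness n ℓ b) (h : Fin n)
    {z : Fin n → ℝ} (hz : IsTail m z) :
    |avg (fun θ : Fin n → Bool => avgAdjusted ρ h (signed θ z) ^ 2) - m / (b * ℓ)|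
      ≤ typeDev m ρ z := by
  have : Nonempty (Fin b) := ⟨⟨0, hb⟩⟩
  have hℓ' : (0 : ℝ) < ℓ := by exact_mod_cast hℓ
  have hb' : (0 : ℝ) < b := by exact_mod_cast hb
  set q : (Fin ℓ → Fin b × Bool) → ℝ := fun τ => (relSum τ (keyType ρ h) / ℓ) ^ 2 with hq
  have hq1 : ∀ τ, |q τ| ≤ 1 := by
    intro τ
    rw [hq, abs_of_nonneg (sq_nonneg _), sq_le_one_iff_abs_le_one, abs_div, abs_of_pos hℓ']
    exact (div_le_one hℓ').2 (abs_relSum_le _ _)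
  have h1 : avg (fun θ : Fin n → Bool => avgAdjusted ρ h (signed θ z) ^ 2)
      = ∑ τ, typeCount z (keyType ρ) τ * q τ := by
    simp only [avgAdjusted_signed, mul_pow, avg_mul_left]
    rw [avg_sgn_sum_sq, ← hz.sum_sq_type, Finset.mul_sum]
    refine Finset.sum_congr rfl fun i _ => ?_
    simp only [hq]
    ring
  have h2 : ∑ τ, q τ = numTypes ℓ b / (b * ℓ) := by
    have e1 : avg q = 1 / (b * ℓ) := by
      have := avg_sum_sq Finset.univ (fun (j : Fin ℓ) c => rel c (keyType ρ h j))
        fun j => sum_rel _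
      simp only [sum_rel_sq] at this
      have e2 : avg q = (1 / (ℓ : ℝ) ^ 2) * avg fun τ => (∑ j, rel (τ j) (keyType ρ h j)) ^ 2 := by
        rw [← avg_mul_left]
        congr 1; ext τ; simp only [hq, relSum]; ring
      rw [e2, this]
      simp
      field_simp
    have e3 : ∑ τ, q τ = numTypes ℓ b * avg q := by
      rw [avg, smul_eq_mul, ← mul_assoc, numTypes]
      have : (Fintype.card (Fin ℓ → Fin b × Bool) : ℝ)
        = (Fintype.card (Fin b × Bool) : ℝ) ^ Fintype.card (Fin ℓ) := by simp
      rw [← this, mul_inv_cancel₀ (Nat.cast_ne_zero.2 Fintype.card_ne_zero), one_mul]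
    rw [e3, e1]; ring
  -- With perfectly equidistributed types the second moment would be exactly `m / (b * ℓ)`, since
  -- the `ℓ` relative signs are orthogonal. As `|q| ≤ 1`, the error is at most the deviation of the
  -- counts.
  have h3 : (m : ℝ) / (b * ℓ) = ∑ τ, m / numTypes ℓ b * q τ := by
    rw [← Finset.mul_sum, h2]
    have := (numTypes_pos (ℓ := ℓ) hb).ne'
    field_simp
  rw [h1, h3, ← Finset.sum_sub_distrib]
  refine (Finset.abs_sum_le_sum_abs _ _).trans (Finset.sum_le_sum fun τ _ => ?_)
  rw [← sub_mul, abs_mul]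
  exact mul_le_of_le_one_right (abs_nonneg _) (hq1 τ)

/-- A crude bound for the conditional first absolute moment. -/
lemma avg_abs_avgAdjusted_le (hℓ : 0 < ℓ) (ρ : Randomness n ℓ b) (h : Fin n)
    {z : Fin n → ℝ} (hz : IsTail m z) :
    avg (fun θ : Fin n → Bool => |avgAdjusted ρ h (signed θ z)|) ≤ √m := by
  have hℓ' : (0 : ℝ) < ℓ := by exact_mod_cast hℓ
  have e : ∀ θ : Fin n → Bool, avgAdjusted ρ h (signed θ z)
      = ∑ i, sgn (θ i) * (z i * relSum (keyType ρ i) (keyType ρ h) / ℓ) := by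
    intro θ
    rw [avgAdjusted_signed, Finset.mul_sum]
    exact Finset.sum_congr rfl fun i _ => by ring
  simp only [e]
  refine (avg_abs_sgn_sum_le _).trans (Real.sqrt_le_sqrt ?_)
  calc ∑ i, (z i * relSum (keyType ρ i) (keyType ρ h) / ℓ) ^ 2
      = ∑ i, z i ^ 2 * (relSum (keyType ρ i) (keyType ρ h) / ℓ) ^ 2 :=
        Finset.sum_congr rfl fun i _ => by ring
    _ ≤ ∑ i, z i ^ 2 * 1 := by
        refine Finset.sum_le_sum fun i _ => mul_le_mul_of_nonneg_left ?_ (sq_nonneg _)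
        rw [sq_le_one_iff_abs_le_one, abs_div, abs_of_pos hℓ']
        exact (div_le_one hℓ').2 (abs_relSum_le _ _)
    _ = m := by rw [hz.sum_sq]; simp [hz.card_filter]

/-- The second moment of the deviation over uniformly random types. -/
lemma avg_typeCount_dev_sq_le {𝒯 : Type*} [Fintype 𝒯] [DecidableEq 𝒯] [Nonempty 𝒯]
    {z : Fin n → ℝ} (hz : IsTail m z) :
    avg (fun f : Fin n → 𝒯 => (∑ τ, |(typeCount z f τ : ℝ) - m / Fintype.card 𝒯|) ^ 2)
      ≤ (Fintype.card 𝒯 : ℝ) ^ 2 * m := by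
  have hc : (0 : ℝ) < Fintype.card 𝒯 := by exact_mod_cast Fintype.card_pos
  set g : 𝒯 → 𝒯 → ℝ := fun τ c => (if c = τ then 1 else 0) - 1 / Fintype.card 𝒯 with hg
  have hg0 : ∀ τ, ∑ c, g τ c = 0 := by
    intro τ
    simp only [hg, Finset.sum_sub_distrib]
    simp
  have hg1 : ∀ τ c, g τ c ^ 2 ≤ 1 := by
    intro τ c
    have h1 : 1 / (Fintype.card 𝒯 : ℝ) ≤ 1 := by
      rw [div_le_one hc]; exact_mod_cast Fintype.card_pos
    have h0 : 0 < 1 / (Fintype.card 𝒯 : ℝ) := by positivity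
    rw [sq_le_one_iff_abs_le_one, abs_le]
    simp only [hg]
    split_ifs <;> constructor <;> linarith
  -- Each count deviates from its mean by a sum of `m` independent centred variables bounded by 1,
  -- so its variance is at most `m`. Cauchy–Schwarz over the types gives the rest.
  have hcount : ∀ (f : Fin n → 𝒯) τ, (typeCount z f τ : ℝ) - m / Fintype.card 𝒯
      = ∑ i ∈ Finset.univ.filter (fun i => z i ≠ 0), g τ (f i) := by
    intro f τ
    simp only [hg, Finset.sum_sub_distrib]
    rw [Finset.sum_const, hz.card_filter, typeCount_eq, ← Finset.sum_filter, Finset.sum_const]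
    simp
    ring
  have hτ : ∀ τ, avg (fun f : Fin n → 𝒯 => ((typeCount z f τ : ℝ) - m / Fintype.card 𝒯) ^ 2)
      ≤ m := by
    intro τ
    simp only [hcount]
    rw [avg_sum_sq _ (fun _ c => g τ c) fun _ => hg0 τ, Finset.sum_const, hz.card_filter,
      nsmul_eq_mul]
    refine mul_le_of_le_one_right (Nat.cast_nonneg _) ?_
    rw [inv_mul_le_one₀ hc]
    exact (Finset.sum_le_sum fun c _ => hg1 τ c).trans (by simp)
  calc _ ≤ avg (fun f : Fin n → 𝒯 => (Fintype.card 𝒯 : ℝ) *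
        ∑ τ, ((typeCount z f τ : ℝ) - m / Fintype.card 𝒯) ^ 2) := by
        refine avg_mono fun f => ?_
        have := sq_sum_le_card_mul_sum_sq (s := Finset.univ)
          (f := fun τ => |(typeCount z f τ : ℝ) - m / Fintype.card 𝒯|)
        simpa using this
    _ = (Fintype.card 𝒯 : ℝ) * ∑ τ,
        avg (fun f : Fin n → 𝒯 => ((typeCount z f τ : ℝ) - m / Fintype.card 𝒯) ^ 2) := by
        rw [avg_mul_left, avg_sum]
    _ ≤ (Fintype.card 𝒯 : ℝ) * ∑ _τ : 𝒯, (m : ℝ) := by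
        gcongr with τ
        exact hτ τ
    _ = _ := by simp; ring

/-- Integration by parts when all types are well represented. -/
lemma abs_avg_mul_avgAdjusted_sub_le (hℓ : 0 < ℓ) (hb : 0 < b) (ρ : Randomness n ℓ b) (h : Fin n)
    {z : Fin n → ℝ} (hz : IsTail m z) (hm : 4 * numTypes ℓ b ≤ m)
    (hgood : ∀ τ, m / numTypes ℓ b / 2 ≤ typeCount z (keyType ρ) τ)
    (φ : (Fin ℓ → Fin b → ℝ) → ℝ) (hφ : ∀ u, |φ u| ≤ 1) (y : ℝ) :
    |avg (fun θ : Fin n → Bool =>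
          φ (y • sketch ρ (Pi.single h 1) + sketch ρ (signed θ z)) *
            avgAdjusted ρ h (signed θ z))
        - m / (4 * b * ℓ) *
          (avg (fun θ : Fin n → Bool =>
              φ (y • sketch ρ (Pi.single h 1) + sketch ρ (signed θ z))) -
            avg (fun θ : Fin n → Bool =>
              φ ((y - 4) • sketch ρ (Pi.single h 1) + sketch ρ (signed θ z))))|
      ≤ 8 * numTypes ℓ b * (5 + 8 * ℓ) * (1 + typeDev m ρ z / √m) := by
  have : Nonempty (Fin b) := ⟨⟨0, hb⟩⟩
  have hℓ' : (0 : ℝ) < ℓ := by exact_mod_cast hℓ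
  have hb' : (0 : ℝ) < b := by exact_mod_cast hb
  have hK := one_le_numTypes (ℓ := ℓ) hb
  set K := numTypes ℓ b with hKdef
  have hm0 : (0 : ℝ) < m := by linarith
  set D := typeDev m ρ z with hD
  have hD0 : 0 ≤ D := typeDev_nonneg ρ z
  set N : ℝ := m / K with hN
  have hN4 : 4 ≤ N := by rw [hN, le_div_iff₀ (by linarith)]; exact hm
  -- With `N ≥ 4` this gives `2 * M + 1 ≤ N / 4 + 1 ≤ N / 2`, the guaranteed count of each type, and
  -- still `M + 1 ≥ N / 8`.
  set M : ℕ := ⌊N / 8⌋₊ with hM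
  have hM1 : (M : ℝ) ≤ N / 8 := Nat.floor_le (by linarith)
  have hM2 : N / 8 ≤ M + 1 := (Nat.lt_floor_add_one _).le
  have hcount : ∀ τ, 2 * M + 1 ≤ typeCount z (keyType ρ) τ := by
    intro τ
    have := hgood τ
    have h' : ((2 * M + 1 : ℕ) : ℝ) ≤ typeCount z (keyType ρ) τ := by push_cast; linarith
    exact_mod_cast h'
  set k := sketch ρ (Pi.single h 1) with hk
  -- The value of the heavy key is absorbed into the function. Translation by four times the column
  -- sum of the heavy key then amounts to replacing `y` by `y - 4`.
  have main := abs_avg_sub_le (fun u => φ (y • k + u)) (fun u => hφ _) entry entry_flip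
    (keyType ρ h) (keyType ρ) z hz.1 M N (by linarith) hcount
  simp only [← sketch_signed] at main
  simp only [← sketch_single, ← hk, hz.2, Fintype.card_fin] at main
  have hshift : ∀ θ : Fin n → Bool, y • k + (sketch ρ (signed θ z) - (4 : ℝ) • k)
      = (y - 4) • k + sketch ρ (signed θ z) := by
    intro θ; rw [sub_smul]; abel
  simp only [hshift] at main
  rw [avg_sub] at main
  have hcoef : N * (Fintype.card (Fin ℓ → Fin b × Bool) : ℝ)
      / (2 * (Fintype.card (Fin b × Bool) : ℝ)) = m / (4 * b) := by
    change N * K / _ = _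
    rw [hN]
    simp
    field_simp
    norm_num
  have hNK : N * (Fintype.card (Fin ℓ → Fin b × Bool) : ℝ) = m := by
    change N * K = m
    rw [hN]; field_simp
  rw [hcoef, hNK] at main
  have hW : avg (fun θ : Fin n → Bool => φ (y • k + sketch ρ (signed θ z)) *
      avgAdjusted ρ h (signed θ z))
      = (1 / (ℓ : ℝ)) * avg (fun θ : Fin n → Bool =>
        (∑ i, sgn (θ i) * (z i * ∑ j, rel (keyType ρ i j) (keyType ρ h j))) *
          φ (y • k + sketch ρ (signed θ z))) := by
    rw [← avg_mul_left]
    congr 1; ext θ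
    rw [avgAdjusted_signed]
    simp only [relSum]
    ring
  rw [hW]
  have hfac : ∀ X Y : ℝ, (1 / (ℓ : ℝ)) * X - m / (4 * b * ℓ) * Y
      = (1 / (ℓ : ℝ)) * (X - m / (4 * b) * Y) := by
    intro X Y; field_simp
  rw [hfac, abs_mul, abs_of_pos (by positivity)]
  have hinv : 1 / ((M : ℝ) + 1) ≤ 8 * K / m := by
    have : (m : ℝ) / (8 * K) ≤ M + 1 := by
      rw [hN] at hM2; calc (m : ℝ) / (8 * K) = m / K / 8 := by ring
        _ ≤ _ := hM2
    rw [div_le_div_iff₀ (by positivity) (by positivity)]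
    rw [div_le_iff₀ (by positivity)] at this
    linarith
  have hsqrt : 1 / √((M : ℝ) + 1) ≤ 8 * K / √m := by
    have h1 : 1 / √((M : ℝ) + 1) = √(1 / ((M : ℝ) + 1)) := by
      rw [Real.sqrt_div zero_le_one, Real.sqrt_one]
    have h2 : √(8 * K / m) = √(8 * K) / √m := Real.sqrt_div (by positivity) _
    rw [h1]
    refine (Real.sqrt_le_sqrt hinv).trans ?_
    rw [h2]
    gcongr
    rw [Real.sqrt_le_left (by positivity)]
    nlinarith
  have hDsum : ∑ τ, |(typeCount z (keyType ρ) τ : ℝ) - N| = D := rfl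
  rw [hDsum] at main
  calc _ ≤ (1 / (ℓ : ℝ)) * ((m * ℓ) * (8 * K / m) + (ℓ * D) * (8 * K / √m)
        + m * (4 * ℓ + 8 * ℓ ^ 2) * (8 * K / m)) := by
        gcongr
        refine main.trans ?_
        gcongr
    _ = 8 * K * (5 + 8 * ℓ) + 8 * K * (D / √m) := by
        field_simp; ring
    _ ≤ 8 * K * (5 + 8 * ℓ) * (1 + D / √m) := by
        have : 0 ≤ D / √m := by positivity
        have h8 : 0 ≤ 8 * K * (D / √m) := by positivity
        have h9 : 0 ≤ 8 * K * (D / √m) * ℓ := by positivity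
        nlinarith

end

section

/-! ### Uniform distributions on finite sets -/

lemma measurePreserving_uniformOn {α : Type*} [MeasurableSpace α] [MeasurableSingletonClass α]
    {s : Set α} (hs : s.Finite) (e : α ≃ᵐ α) (he : ∀ x, e x ∈ s ↔ x ∈ s) :
    MeasurePreserving e (uniformOn s) (uniformOn s) := by
  refine ⟨e.measurable, ?_⟩
  ext A hA
  rw [Measure.map_apply e.measurable hA, uniformOn, cond_apply hs.measurableSet,
    cond_apply hs.measurableSet]
  congr 1
  have h : s ∩ e ⁻¹' A = e.symm '' (s ∩ A) := by
    ext x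
    simp only [Set.mem_inter_iff, Set.mem_preimage, Set.mem_image]
    constructor
    · rintro ⟨h1, h2⟩
      exact ⟨e x, ⟨(he x).2 h1, h2⟩, by simp⟩
    · rintro ⟨y, ⟨h1, h2⟩, rfl⟩
      refine ⟨(he _).1 (by simpa using h1), by simpa using h2⟩
  rw [h, Measure.count_injective_image e.symm.injective]

lemma integral_uniformOn_univ {α : Type*} [Fintype α] [MeasurableSpace α]
    [MeasurableSingletonClass α] (f : α → ℝ) :
    ∫ x, f x ∂(uniformOn (Set.univ : Set α)) = (Fintype.card α : ℝ)⁻¹ * ∑ x, f x := by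
  rw [integral_fintype Integrable.of_finite, Finset.mul_sum]
  refine Finset.sum_congr rfl fun x _ => ?_
  rw [measureReal_def, uniformOn_univ]
  simp

/-- Resampling one coordinate preserves a product measure. -/
lemma measurePreserving_update {ι : Type*} [Fintype ι] [DecidableEq ι] {α : Type*}
    [MeasurableSpace α] (ν : Measure α) [IsProbabilityMeasure ν] (t : ι) :
    MeasurePreserving (fun p : (ι → α) × α => Function.update p.1 t p.2)
      ((Measure.pi fun _ => ν).prod ν) (Measure.pi fun _ => ν) := by
  have hm : Measurable fun p : (ι → α) × α => Function.update p.1 t p.2 := by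
    refine measurable_pi_iff.2 fun i => ?_
    by_cases hi : i = t
    · subst hi; simpa using measurable_snd
    · simp only [Function.update_of_ne hi]; fun_prop
  refine ⟨hm, (Measure.pi_eq fun s hs => ?_).symm⟩
  rw [Measure.map_apply hm (MeasurableSet.univ_pi hs)]
  have h : (fun p : (ι → α) × α => Function.update p.1 t p.2) ⁻¹' Set.univ.pi s
      = (Set.univ.pi (Function.update s t Set.univ)) ×ˢ s t := by
    ext ⟨v, y⟩
    simp only [Set.mem_preimage, Set.mem_pi, Set.mem_univ, true_implies, Set.mem_prod]
    constructor
    · intro h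
      refine ⟨fun i => ?_, by simpa using h t⟩
      by_cases hi : i = t
      · subst hi; simp
      · simpa [Function.update_of_ne hi] using h i
    · rintro ⟨h1, h2⟩ i
      by_cases hi : i = t
      · subst hi; simpa using h2
      · simpa [Function.update_of_ne hi] using h1 i
  rw [h, Measure.prod_prod, Measure.pi_pi, ← Finset.mul_prod_erase _ _ (Finset.mem_univ t),
    ← Finset.mul_prod_erase _ (fun i => ν (s i)) (Finset.mem_univ t), Function.update_self,
    measure_univ, one_mul, mul_comm]
  congr 1
  exact Finset.prod_congr rfl fun i hi => by
    rw [Function.update_of_ne (Finset.ne_of_mem_erase hi)]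

variable {n ℓ b m r : ℕ}

/-! ### The tails -/

lemma isTail_of_mem {x : Fin n × (Fin r → Fin n → ℝ)} (hx : x ∈ tailOutcomes n m r) (t : Fin r) :
    IsTail m (x.2 t) := ⟨hx.1 t, hx.2.1 t⟩

lemma finite_tailOutcomes : (tailOutcomes n m r).Finite := by
  have h : (Set.univ ×ˢ Set.univ.pi fun _ : Fin r => Set.univ.pi fun _ : Fin n =>
      ({-1, 0, 1} : Set ℝ)).Finite (α := Fin n × (Fin r → Fin n → ℝ)) :=
    Set.finite_univ.prod (Set.Finite.pi fun _ => Set.Finite.pi fun _ => by simp)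
  refine h.subset fun x hx => ?_
  refine ⟨trivial, fun t _ i _ => ?_⟩
  simpa using hx.1 t i

lemma nonempty_tailOutcomes (hn : r * m + 1 ≤ n) : (tailOutcomes n m r).Nonempty := by
  -- Key 0 is the heavy key, and the supports are the consecutive blocks of length `m` after it.
  set s : Fin r → Set (Fin n) := fun t =>
    {i | 1 + t.val * m ≤ i.val ∧ i.val < 1 + t.val * m + m} with hs
  classical
  refine ⟨(⟨0, by omega⟩, fun t i => if i ∈ s t then 1 else 0), ?_, ?_, ?_, ?_⟩
  · intro t i
    dsimp only
    split_ifs <;> simp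
  · intro t
    have ht : (t.val + 1) * m ≤ r * m := Nat.mul_le_mul_right m t.isLt
    have h1 : {i | (if i ∈ s t then (1 : ℝ) else 0) ≠ 0} = s t := by
      ext i; by_cases h : i ∈ s t <;> simp [h]
    dsimp only
    rw [h1]
    have h2 : (Fin.val '' s t) = Set.Ico (1 + t.val * m) (1 + t.val * m + m) := by
      ext k
      simp only [hs, Set.mem_image, Set.mem_ofPred_eq, Set.mem_Ico]
      constructor
      · rintro ⟨i, hi, rfl⟩; exact hi
      · intro hk
        refine ⟨⟨k, ?_⟩, hk, rfl⟩
        rw [add_mul] at ht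
        omega
    rw [← Set.ncard_image_of_injective _ Fin.val_injective, h2, Set.ncard_eq_toFinset_card']
    simp
  · intro t
    simp [hs]
  · intro t₁ t₂ hne
    refine Set.disjoint_left.2 fun i h1 h2 => hne ?_
    have e : ∀ t : Fin r, (if i ∈ s t then (1 : ℝ) else 0) ≠ 0 → i ∈ s t := by
      intro t h; by_contra h'; simp [h'] at h
    obtain ⟨a1, a2⟩ := e t₁ h1
    obtain ⟨b1, b2⟩ := e t₂ h2
    ext
    rcases lt_trichotomy t₁.val t₂.val with h | h | h
    · have := Nat.mul_le_mul_right m (Nat.succ_le_of_lt h)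
      rw [Nat.succ_mul] at this; omega
    · exact h
    · have := Nat.mul_le_mul_right m (Nat.succ_le_of_lt h)
      rw [Nat.succ_mul] at this; omega

lemma signed_signed (θ : Fin n → Bool) (z : Fin n → ℝ) : signed θ (signed θ z) = z := by
  ext i; simp [signed, ← mul_assoc]

/-- The outcomes with the signs of one tail changed. -/
def signTail (t : Fin r) (θ : Fin n → Bool) (x : Fin n × (Fin r → Fin n → ℝ)) :
    Fin n × (Fin r → Fin n → ℝ) :=
  (x.1, Function.update x.2 t (signed θ (x.2 t)))

lemma measurable_signTail (t : Fin r) (θ : Fin n → Bool) : Measurable (signTail t θ) := by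
  refine measurable_fst.prodMk (measurable_pi_iff.2 fun s => measurable_pi_iff.2 fun i => ?_)
  by_cases hs : s = t
  · subst hs
    simp only [Function.update_self, signed]
    fun_prop
  · simp only [Function.update_of_ne hs]
    fun_prop

lemma signTail_signTail (t : Fin r) (θ : Fin n → Bool) (x : Fin n × (Fin r → Fin n → ℝ)) :
    signTail t θ (signTail t θ x) = x := by
  simp [signTail, signed_signed]

lemma signed_ne_zero_iff (θ : Fin n → Bool) (z : Fin n → ℝ) (i : Fin n) :
    signed θ z i ≠ 0 ↔ z i ≠ 0 := by
  cases h : θ i <;> simp [signed, h]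

lemma signTail_mem {t : Fin r} {θ : Fin n → Bool} {x : Fin n × (Fin r → Fin n → ℝ)}
    (hx : x ∈ tailOutcomes n m r) : signTail t θ x ∈ tailOutcomes n m r := by
  obtain ⟨h1, h2, h3, h4⟩ := hx
  have hne : ∀ s i, (signTail t θ x).2 s i ≠ 0 ↔ x.2 s i ≠ 0 := by
    intro s i
    by_cases hs : s = t
    · subst hs; simpa [signTail] using signed_ne_zero_iff θ (x.2 s) i
    · simp [signTail, Function.update_of_ne hs]
  refine ⟨fun s i => ?_, fun s => ?_, fun s => ?_, fun s s' hss => ?_⟩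
  · by_cases hs : s = t
    · subst hs
      rcases h1 s i with h | h | h <;> cases hθ : θ i <;> simp [signTail, signed, h, hθ]
    · simpa [signTail, Function.update_of_ne hs] using h1 s i
  · simpa only [hne] using h2 s
  · by_contra h
    exact (hne s x.1).1 h (h3 s)
  · simpa only [hne] using h4 s s' hss

lemma measurePreserving_signTail (t : Fin r) (θ : Fin n → Bool) :
    MeasurePreserving (signTail t θ) (tailLaw n m r) (tailLaw n m r) := by
  let e : (Fin n × (Fin r → Fin n → ℝ)) ≃ᵐ (Fin n × (Fin r → Fin n → ℝ)) :=
    { toFun := signTail t θ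
      invFun := signTail t θ
      left_inv := signTail_signTail t θ
      right_inv := signTail_signTail t θ
      measurable_toFun := measurable_signTail t θ
      measurable_invFun := measurable_signTail t θ }
  refine measurePreserving_uniformOn finite_tailOutcomes e fun x =>
    ⟨fun h => ?_, fun h => signTail_mem h⟩
  have h' := signTail_mem (t := t) (θ := θ) h
  rwa [show signTail t θ (e x) = x from signTail_signTail t θ x] at h'

lemma isProbabilityMeasure_tailLaw (hn : r * m + 1 ≤ n) :
    IsProbabilityMeasure (tailLaw n m r) :=
  isProbabilityMeasure_uniformOn finite_tailOutcomes (nonempty_tailOutcomes hn)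

lemma isProbabilityMeasure_randomnessLaw (hb : 0 < b) :
    IsProbabilityMeasure (randomnessLaw n ℓ b) := by
  have : Nonempty (Fin b) := ⟨⟨0, hb⟩⟩
  exact isProbabilityMeasure_uniformOn Set.finite_univ Set.univ_nonempty

lemma ae_mem_tailOutcomes :
    ∀ᵐ x ∂(tailLaw n m r), x ∈ tailOutcomes n m r :=
  ae_cond_mem finite_tailOutcomes.measurableSet

/-! ### The values of the heavy key -/

/-- The law of one value of the heavy key. -/
def stepLaw (b m : ℕ) (a c : ℝ) : Measure ℝ :=
  cond volume (Set.Icc (a * sigma m b) ((c + 2 * a) * sigma m b))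

lemma sigma_pos (hm : 0 < m) (hb : 0 < b) : 0 < sigma m b := by
  have : (0 : ℝ) < m := by exact_mod_cast hm
  have : (0 : ℝ) < b := by exact_mod_cast hb
  exact Real.sqrt_pos.2 (by positivity)

lemma isProbabilityMeasure_stepLaw {a c : ℝ} (ha : 0 < a) (hac : a < c) (hm : 0 < m)
    (hb : 0 < b) : IsProbabilityMeasure (stepLaw b m a c) := by
  have := sigma_pos hm hb
  have h1 : volume (Set.Icc (a * sigma m b) ((c + 2 * a) * sigma m b)) ≠ 0 := by
    rw [Real.volume_Icc, ne_eq, ENNReal.ofReal_eq_zero, not_le]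
    nlinarith
  have h2 : volume (Set.Icc (a * sigma m b) ((c + 2 * a) * sigma m b)) ≠ ⊤ := by
    rw [Real.volume_Icc]; exact ENNReal.ofReal_ne_top
  exact cond_isProbabilityMeasure_of_finite h1 h2

lemma integral_stepLaw {a c : ℝ} (ha : 0 < a) (hac : a < c) (hm : 0 < m) (hb : 0 < b)
    (f : ℝ → ℝ) :
    ∫ y, f y ∂(stepLaw b m a c) = ((c + a) * sigma m b)⁻¹ *
      ∫ y in (a * sigma m b)..((c + 2 * a) * sigma m b), f y := by
  have := sigma_pos hm hb
  have hle : a * sigma m b ≤ (c + 2 * a) * sigma m b := by nlinarith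
  rw [stepLaw, ProbabilityTheory.cond, integral_smul_measure, Real.volume_Icc, ENNReal.toReal_inv,
    ENNReal.toReal_ofReal (by linarith), intervalIntegral.integral_of_le hle,
    integral_Icc_eq_integral_Ioc, smul_eq_mul]
  congr 2
  ring

end

section

variable {n ℓ b m r : ℕ} {Ω : Type*} [MeasurableSpace Ω]

/-! ### Measurability of the interaction -/

lemma measurable_query_apply (t : Fin r) (i : Fin n) :
    Measurable fun x : AttackSpace n ℓ b r Ω =>
      query x.2.2.1.1 x.2.2.1.2 x.2.2.2 t i := by
  have h : Measurable fun x : AttackSpace n ℓ b r Ω => (Pi.single x.2.2.1.1 1 : Fin n → ℝ) i :=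
    (measurable_of_finite fun h : Fin n => (Pi.single h 1 : Fin n → ℝ) i).comp (by fun_prop)
  simp only [query, Pi.add_apply, Pi.smul_apply, smul_eq_mul]
  fun_prop

lemma measurable_apply_key (f : AttackSpace n ℓ b r Ω → Fin n → ℝ)
    (hf : ∀ i, Measurable fun x => f x i) :
    Measurable fun x : AttackSpace n ℓ b r Ω => f x x.2.2.1.1 := by
  have e : (fun x : AttackSpace n ℓ b r Ω => f x x.2.2.1.1)
      = fun x => ∑ i, (if x.2.2.1.1 = i then 1 else 0) * f x i := by
    ext x; simp
  rw [e]
  refine Finset.measurable_sum _ fun i _ => Measurable.mul ?_ (hf i)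
  exact (measurable_of_finite fun h : Fin n => if h = i then (1 : ℝ) else 0).comp (by fun_prop)

lemma measurable_sketch (f : AttackSpace n ℓ b r Ω → Fin n → ℝ)
    (hf : ∀ i, Measurable fun x => f x i) :
    Measurable fun x : AttackSpace n ℓ b r Ω => sketch x.2.1 (f x) := by
  refine measurable_pi_iff.2 fun j => measurable_pi_iff.2 fun k => ?_
  simp only [sketch, dotProduct]
  refine Finset.measurable_sum _ fun i _ => Measurable.mul ?_ (hf i)
  exact (measurable_of_finite fun ρ : Randomness n ℓ b => measVec ρ j k i).comp (by fun_prop)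

lemma measurable_avgAdjusted (f : AttackSpace n ℓ b r Ω → Fin n → ℝ)
    (hf : ∀ i, Measurable fun x => f x i) :
    Measurable fun x : AttackSpace n ℓ b r Ω => avgAdjusted x.2.1 x.2.2.1.1 (f x) := by
  simp only [avgAdjusted_eq]
  refine Measurable.const_mul (Finset.measurable_sum _ fun i _ => (hf i).mul ?_) _
  exact (measurable_of_finite fun p : Randomness n ℓ b × Fin n =>
    relSum (keyType p.1 i) (keyType p.1 p.2)).comp
      (f := fun x : AttackSpace n ℓ b r Ω => (x.2.1, x.2.2.1.1)) (by fun_prop)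

namespace QueryResponse

variable (Q : QueryResponse n ℓ b r Ω)

/-- The history that is available to the responder at step `t`. -/
def history (ω : Ω) (ρ : Randomness n ℓ b) (h : Fin n) (q : Fin r → Fin n → ℝ) (t : Fin r) :
    Fin t → ℝ × (Fin ℓ → Fin b → ℝ) × Set (Fin n) :=
  fun i : Fin t => (q ⟨i, i.isLt.trans t.isLt⟩ h, sketch ρ (q ⟨i, i.isLt.trans t.isLt⟩),
    Q.response ω ρ h q ⟨i, i.isLt.trans t.isLt⟩)

lemma response_eq (ω : Ω) (ρ : Randomness n ℓ b) (h : Fin n) (q : Fin r → Fin n → ℝ)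
    (t : Fin r) :
    Q.response ω ρ h q t = Q.estimator t (ω, ρ, h, Q.history ω ρ h q t, sketch ρ (q t)) := by
  rw [response]; rfl

lemma response_congr (ω : Ω) (ρ : Randomness n ℓ b) (h : Fin n) {q q' : Fin r → Fin n → ℝ}
    (t : Fin r) (hq : ∀ s ≤ t, q s = q' s) : Q.response ω ρ h q t = Q.response ω ρ h q' t := by
  induction t using WellFoundedLT.induction with
  | ind t ih =>
    rw [response_eq, response_eq, hq t le_rfl]
    have : Q.history ω ρ h q t = Q.history ω ρ h q' t := by
      funext i
      have hi : (⟨i, i.isLt.trans t.isLt⟩ : Fin r) < t := i.isLt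
      simp only [history]
      rw [hq _ hi.le, ih _ hi fun s hs => hq s (hs.trans hi.le)]
    rw [this]

lemma history_congr (ω : Ω) (ρ : Randomness n ℓ b) (h : Fin n) {q q' : Fin r → Fin n → ℝ}
    (t : Fin r) (hq : ∀ s < t, q s = q' s) : Q.history ω ρ h q t = Q.history ω ρ h q' t := by
  funext i
  have hi : (⟨i, i.isLt.trans t.isLt⟩ : Fin r) < t := i.isLt
  simp only [history]
  rw [hq _ hi, Q.response_congr ω ρ h _ fun s hs => hq s (hs.trans_lt hi)]

lemma measurable_response (t : Fin r) : Measurable fun x : AttackSpace n ℓ b r Ω =>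
    Q.response x.1 x.2.1 x.2.2.1.1 (query x.2.2.1.1 x.2.2.1.2 x.2.2.2) t := by
  induction t using WellFoundedLT.induction with
  | ind t ih =>
    simp only [response_eq]
    refine (Q.measurable_estimator t).comp ?_
    have h1 : Measurable fun x : AttackSpace n ℓ b r Ω =>
        Q.history x.1 x.2.1 x.2.2.1.1 (query x.2.2.1.1 x.2.2.1.2 x.2.2.2) t := by
      refine measurable_pi_iff.2 fun i => ?_
      have hi : (⟨i, i.isLt.trans t.isLt⟩ : Fin r) < t := i.isLt
      exact (measurable_apply_key _ fun i' => measurable_query_apply _ i').prodMk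
        ((measurable_sketch _ fun i' => measurable_query_apply _ i').prodMk (ih _ hi))
    have h2 : Measurable fun x : AttackSpace n ℓ b r Ω =>
        sketch x.2.1 (query x.2.2.1.1 x.2.2.1.2 x.2.2.2 t) :=
      measurable_sketch _ fun i' => measurable_query_apply _ i'
    exact measurable_fst.prodMk ((by fun_prop : Measurable fun x : AttackSpace n ℓ b r Ω =>
      x.2.1).prodMk ((by fun_prop : Measurable fun x : AttackSpace n ℓ b r Ω =>
        x.2.2.1.1).prodMk (h1.prodMk h2)))

/-- The sign of step `t` as a random variable. -/
def stepSign (t : Fin r) (x : AttackSpace n ℓ b r Ω) : ℝ :=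
  Q.reportSign x.1 x.2.1 x.2.2.1.1 (query x.2.2.1.1 x.2.2.1.2 x.2.2.2) t

lemma measurableSet_reported (t : Fin r) : MeasurableSet {x : AttackSpace n ℓ b r Ω |
    x.2.2.1.1 ∈ Q.response x.1 x.2.1 x.2.2.1.1 (query x.2.2.1.1 x.2.2.1.2 x.2.2.2) t} := by
  have e : {x : AttackSpace n ℓ b r Ω |
      x.2.2.1.1 ∈ Q.response x.1 x.2.1 x.2.2.1.1 (query x.2.2.1.1 x.2.2.1.2 x.2.2.2) t}
      = ⋃ i, ((fun x : AttackSpace n ℓ b r Ω => x.2.2.1.1) ⁻¹' {i} ∩ {x |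
        i ∈ Q.response x.1 x.2.1 x.2.2.1.1 (query x.2.2.1.1 x.2.2.1.2 x.2.2.2) t}) := by
    ext x; simp
  rw [e]
  refine MeasurableSet.iUnion fun i => MeasurableSet.inter ?_ ?_
  · exact (by fun_prop : Measurable fun x : AttackSpace n ℓ b r Ω => x.2.2.1.1)
      (measurableSet_singleton i)
  · exact measurableSet_setOfPred.2 (measurable_set_iff.1 (Q.measurable_response t) i)

open Classical in
lemma stepSign_eq (t : Fin r) : Q.stepSign t = fun x => if x ∈ {x : AttackSpace n ℓ b r Ω |
    x.2.2.1.1 ∈ Q.response x.1 x.2.1 x.2.2.1.1 (query x.2.2.1.1 x.2.2.1.2 x.2.2.2) t}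
    then 1 else -1 := rfl

lemma measurable_stepSign (t : Fin r) : Measurable (Q.stepSign t) := by
  classical
  rw [stepSign_eq]
  exact Measurable.ite (Q.measurableSet_reported t) measurable_const measurable_const

lemma abs_stepSign (t : Fin r) (x : AttackSpace n ℓ b r Ω) : |Q.stepSign t x| = 1 := by
  rw [stepSign, reportSign]; split_ifs <;> simp

lemma stepSign_sq (t : Fin r) (x : AttackSpace n ℓ b r Ω) : Q.stepSign t x ^ 2 = 1 := by
  rw [← sq_abs, abs_stepSign, one_pow]

end QueryResponse

/-- The average adjusted measurement of the `t`-th tail. -/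
def stepValue (t : Fin r) (x : AttackSpace n ℓ b r Ω) : ℝ :=
  avgAdjusted x.2.1 x.2.2.1.1 (x.2.2.1.2 t)

lemma measurable_stepValue (t : Fin r) :
    Measurable (stepValue (n := n) (ℓ := ℓ) (b := b) (Ω := Ω) t) :=
  measurable_avgAdjusted _ fun i => by fun_prop

lemma attackBias_eq (Q : QueryResponse n ℓ b r Ω) (x : AttackSpace n ℓ b r Ω) :
    Q.attackBias x = ∑ t, Q.stepSign t x * stepValue t x :=
  avgAdjusted_sum _ _ _ _ _

/-! ### Resampling the signs of a tail and the value of the heavy key -/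

/-- The outcome in which the signs of the `t`-th tail are multiplied by `θ` and the `t`-th value
of the heavy key is replaced by `y`. -/
def resample (t : Fin r) (θ : Fin n → Bool) (y : ℝ) (x : AttackSpace n ℓ b r Ω) :
    AttackSpace n ℓ b r Ω :=
  (x.1, x.2.1, signTail t θ x.2.2.1, Function.update x.2.2.2 t y)

lemma attackLaw_eq (a c : ℝ) (P : Measure Ω) : attackLaw n ℓ b m r a c P
    = P.prod ((randomnessLaw n ℓ b).prod ((tailLaw n m r).prod
      (Measure.pi fun _ => stepLaw b m a c))) := rfl

/-- A resampled outcome has the same law. -/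
lemma measurePreserving_resample {a c : ℝ} (hn : r * m + 1 ≤ n) (hb : 0 < b)
    [IsProbabilityMeasure (stepLaw b m a c)] (P : Measure Ω) [IsProbabilityMeasure P]
    (t : Fin r) (θ : Fin n → Bool) :
    MeasurePreserving (fun p : AttackSpace n ℓ b r Ω × ℝ => resample t θ p.2 p.1)
      ((attackLaw n ℓ b m r a c P).prod (stepLaw b m a c)) (attackLaw n ℓ b m r a c P) := by
  have := isProbabilityMeasure_tailLaw hn
  have := isProbabilityMeasure_randomnessLaw (n := n) (ℓ := ℓ) hb
  rw [attackLaw_eq]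
  -- The fresh value is an extra factor of the product measure; three reassociations bring it next
  -- to the old values.
  have h1 := measurePreserving_update (stepLaw b m a c) t
  have h2 := ((measurePreserving_signTail (n := n) (m := m) t θ).prod h1).comp
    (measurePreserving_prodAssoc (tailLaw n m r) (Measure.pi fun _ => stepLaw b m a c)
      (stepLaw b m a c))
  have h3 := ((MeasurePreserving.id (randomnessLaw n ℓ b)).prod h2).comp
    (measurePreserving_prodAssoc _ _ _)
  have h4 := ((MeasurePreserving.id P).prod h3).comp (measurePreserving_prodAssoc _ _ _)
  exact h4

lemma isProbabilityMeasure_attackLaw {a c : ℝ} (hn : r * m + 1 ≤ n) (hb : 0 < b)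
    [IsProbabilityMeasure (stepLaw b m a c)] (P : Measure Ω) [IsProbabilityMeasure P] :
    IsProbabilityMeasure (attackLaw n ℓ b m r a c P) := by
  have := isProbabilityMeasure_tailLaw hn
  have := isProbabilityMeasure_randomnessLaw (n := n) (ℓ := ℓ) hb
  rw [attackLaw_eq]
  infer_instance

lemma measurePreserving_signs {a c : ℝ} (hn : r * m + 1 ≤ n) (hb : 0 < b)
    [IsProbabilityMeasure (stepLaw b m a c)] (P : Measure Ω) [IsProbabilityMeasure P]
    (t : Fin r) (θ : Fin n → Bool) :
    MeasurePreserving (fun x : AttackSpace n ℓ b r Ω =>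
        ((x.1, x.2.1, signTail t θ x.2.2.1, x.2.2.2) : AttackSpace n ℓ b r Ω))
      (attackLaw n ℓ b m r a c P) (attackLaw n ℓ b m r a c P) := by
  have := isProbabilityMeasure_tailLaw hn
  have := isProbabilityMeasure_randomnessLaw (n := n) (ℓ := ℓ) hb
  rw [attackLaw_eq]
  exact (MeasurePreserving.id P).prod ((MeasurePreserving.id _).prod
    ((measurePreserving_signTail (n := n) (m := m) t θ).prod (MeasurePreserving.id _)))

lemma measurable_resample (t : Fin r) (θ : Fin n → Bool) :
    Measurable fun p : AttackSpace n ℓ b r Ω × ℝ => resample t θ p.2 p.1 := by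
  have h1 := (measurable_signTail (n := n) t θ).comp
    (by fun_prop : Measurable fun p : AttackSpace n ℓ b r Ω × ℝ => p.1.2.2.1)
  have h2 : Measurable fun p : AttackSpace n ℓ b r Ω × ℝ => Function.update p.1.2.2.2 t p.2 := by
    refine measurable_pi_iff.2 fun i => ?_
    by_cases hi : i = t
    · subst hi; simpa using measurable_snd
    · simp only [Function.update_of_ne hi]; fun_prop
  exact (by fun_prop : Measurable fun p : AttackSpace n ℓ b r Ω × ℝ => p.1.1).prodMk
    ((by fun_prop : Measurable fun p : AttackSpace n ℓ b r Ω × ℝ => p.1.2.1).prodMk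
      (h1.prodMk h2))

/-- The conditional expectation given the signs of the other tails and the other values. -/
lemma integral_resample {a c : ℝ} (hn : r * m + 1 ≤ n) (hb : 0 < b)
    [IsProbabilityMeasure (stepLaw b m a c)] (P : Measure Ω) [IsProbabilityMeasure P]
    (t : Fin r) {f : AttackSpace n ℓ b r Ω → ℝ} (hf : Integrable f (attackLaw n ℓ b m r a c P)) :
    Integrable (fun x => avg fun θ : Fin n → Bool =>
        ∫ y, f (resample t θ y x) ∂(stepLaw b m a c)) (attackLaw n ℓ b m r a c P) ∧
    ∫ x, f x ∂(attackLaw n ℓ b m r a c P)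
      = ∫ x, (avg fun θ : Fin n → Bool =>
        ∫ y, f (resample t θ y x) ∂(stepLaw b m a c)) ∂(attackLaw n ℓ b m r a c P) := by
  have := isProbabilityMeasure_attackLaw (n := n) (ℓ := ℓ) (a := a) (c := c) hn hb P
  have hθ : ∀ θ : Fin n → Bool, Integrable (fun p : AttackSpace n ℓ b r Ω × ℝ =>
      f (resample t θ p.2 p.1)) ((attackLaw n ℓ b m r a c P).prod (stepLaw b m a c)) := fun θ =>
    (measurePreserving_resample hn hb P t θ).integrable_comp_of_integrable hf
  have hI : ∀ θ : Fin n → Bool, Integrable (fun x => ∫ y, f (resample t θ y x)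
      ∂(stepLaw b m a c)) (attackLaw n ℓ b m r a c P) := fun θ => (hθ θ).integral_prod_left
  -- Every fixed `θ` already preserves the law, so the average over `θ` does as well.
  have hE : ∀ θ : Fin n → Bool, ∫ x, ∫ y, f (resample t θ y x) ∂(stepLaw b m a c)
      ∂(attackLaw n ℓ b m r a c P) = ∫ x, f x ∂(attackLaw n ℓ b m r a c P) := by
    intro θ
    rw [← integral_prod _ (hθ θ)]
    have hmp := measurePreserving_resample (n := n) (ℓ := ℓ) (a := a) (c := c) hn hb P t θ
    have h := integral_map (φ := fun p : AttackSpace n ℓ b r Ω × ℝ => resample t θ p.2 p.1)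
      (μ := (attackLaw n ℓ b m r a c P).prod (stepLaw b m a c)) (f := f)
      hmp.measurable.aemeasurable (by rw [hmp.map_eq]; exact hf.aestronglyMeasurable)
    rw [hmp.map_eq] at h
    exact h.symm
  constructor
  · simp only [avg, smul_eq_mul]
    exact (integrable_finsetSum _ fun θ _ => hI θ).const_mul _
  · simp only [avg, smul_eq_mul]
    rw [integral_const_mul, integral_finsetSum _ fun θ _ => hI θ]
    simp only [hE]
    exact (avg_const (ι := Fin n) (α := Bool) _).symm

end

/-! ### The conditional mean of a single step -/

section

variable {n ℓ b m r : ℕ} {Ω : Type*} [MeasurableSpace Ω]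

omit [MeasurableSpace Ω] in
lemma stepValue_resample (t : Fin r) (θ : Fin n → Bool) (y : ℝ) (x : AttackSpace n ℓ b r Ω) :
    stepValue t (resample t θ y x) = avgAdjusted x.2.1 x.2.2.1.1 (signed θ (x.2.2.1.2 t)) := by
  simp [stepValue, resample, signTail]

omit [MeasurableSpace Ω] in
lemma stepValue_resample_of_ne {s t : Fin r} (hst : s ≠ t) (θ : Fin n → Bool) (y : ℝ)
    (x : AttackSpace n ℓ b r Ω) : stepValue s (resample t θ y x) = stepValue s x := by
  simp [stepValue, resample, signTail, Function.update_of_ne hst]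

omit [MeasurableSpace Ω] in
lemma query_resample_of_ne {s t : Fin r} (hst : s ≠ t) (θ : Fin n → Bool) (y : ℝ)
    (x : AttackSpace n ℓ b r Ω) :
    query (resample t θ y x).2.2.1.1 (resample t θ y x).2.2.1.2 (resample t θ y x).2.2.2 s
      = query x.2.2.1.1 x.2.2.1.2 x.2.2.2 s := by
  simp [resample, signTail, query, Function.update_of_ne hst]

namespace QueryResponse

variable (Q : QueryResponse n ℓ b r Ω)

lemma stepSign_resample_of_lt {s t : Fin r} (hst : s < t) (θ : Fin n → Bool) (y : ℝ)
    (x : AttackSpace n ℓ b r Ω) : Q.stepSign s (resample t θ y x) = Q.stepSign s x := by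
  classical
  have h := Q.response_congr x.1 x.2.1 x.2.2.1.1 s (q := query (resample t θ y x).2.2.1.1
      (resample t θ y x).2.2.1.2 (resample t θ y x).2.2.2)
    (q' := query x.2.2.1.1 x.2.2.1.2 x.2.2.2)
    fun s' hs' => query_resample_of_ne (hs'.trans_lt hst).ne θ y x
  simp only [stepSign, reportSign]
  exact if_congr (by rw [← h]; rfl) rfl rfl

/-- The sign of step `t` depends on the resampled data only through the sketch. -/
lemma exists_stepSign_resample_eq (t : Fin r) (x : AttackSpace n ℓ b r Ω) :
    ∃ φ : (Fin ℓ → Fin b → ℝ) → ℝ, (∀ u, |φ u| ≤ 1) ∧ ∀ θ y,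
      Q.stepSign t (resample t θ y x)
        = φ (y • sketch x.2.1 (Pi.single x.2.2.1.1 1)
            + sketch x.2.1 (signed θ (x.2.2.1.2 t))) := by
  classical
  -- The history is frozen at `x`: it involves only earlier queries, which resampling step `t`
  -- leaves unchanged.
  refine ⟨fun u => if x.2.2.1.1 ∈ Q.estimator t (x.1, x.2.1, x.2.2.1.1,
    Q.history x.1 x.2.1 x.2.2.1.1 (query x.2.2.1.1 x.2.2.1.2 x.2.2.2) t, u) then 1 else -1,
    fun u => by dsimp only; split_ifs <;> simp, fun θ y => ?_⟩
  have h := Q.history_congr x.1 x.2.1 x.2.2.1.1 t (q := query (resample t θ y x).2.2.1.1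
      (resample t θ y x).2.2.1.2 (resample t θ y x).2.2.2)
    (q' := query x.2.2.1.1 x.2.2.1.2 x.2.2.2)
    fun s' hs' => query_resample_of_ne hs'.ne θ y x
  have h2 : sketch x.2.1 (query (resample t θ y x).2.2.1.1
      (resample t θ y x).2.2.1.2 (resample t θ y x).2.2.2 t)
      = y • sketch x.2.1 (Pi.single x.2.2.1.1 1) + sketch x.2.1 (signed θ (x.2.2.1.2 t)) := by
    rw [sketch_query]
    simp [resample, signTail]
  simp only [stepSign, reportSign]
  refine if_congr ?_ rfl rfl
  rw [← h, ← h2, response_eq]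
  rfl

/-- The conditional mean of the sign of step `t` when its value is `y`. -/
def meanSign (t : Fin r) (x : AttackSpace n ℓ b r Ω) (y : ℝ) : ℝ :=
  avg fun θ : Fin n → Bool => Q.stepSign t (resample t θ y x)

/-- The conditional mean of the contribution of step `t`. -/
def meanStep (m : ℕ) (a c : ℝ) (t : Fin r) (x : AttackSpace n ℓ b r Ω) : ℝ :=
  avg fun θ : Fin n → Bool => ∫ y, Q.stepSign t (resample t θ y x) * stepValue t (resample t θ y x)
    ∂(stepLaw b m a c)

/-- The difference of the mean signs near the two ends of the range of the values. -/
def signGap (m : ℕ) (a c : ℝ) (t : Fin r) (x : AttackSpace n ℓ b r Ω) : ℝ :=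
  (1 / 4) * ((∫ y in ((c + 2 * a) * sigma m b - 4)..((c + 2 * a) * sigma m b), Q.meanSign t x y)
    - ∫ y in (a * sigma m b - 4)..(a * sigma m b), Q.meanSign t x y)

lemma abs_meanSign_le (t : Fin r) (x : AttackSpace n ℓ b r Ω) (y : ℝ) :
    |Q.meanSign t x y| ≤ 1 := by
  refine (abs_avg_le _).trans ?_
  simp only [abs_stepSign]
  exact (avg_const _).le

lemma measurable_meanSign_prod (t : Fin r) :
    Measurable fun p : AttackSpace n ℓ b r Ω × ℝ => Q.meanSign t p.1 p.2 := by
  simp only [meanSign, avg, smul_eq_mul]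
  exact (Finset.measurable_sum _ fun θ _ =>
    (Q.measurable_stepSign t).comp (measurable_resample t θ)).const_mul _

lemma measurable_meanSign (t : Fin r) (x : AttackSpace n ℓ b r Ω) :
    Measurable (Q.meanSign t x) :=
  (Q.measurable_meanSign_prod t).comp measurable_prodMk_left

end QueryResponse

lemma intervalIntegrable_of_abs_le {f : ℝ → ℝ} (hf : Measurable f) {C : ℝ}
    (hC : ∀ y, |f y| ≤ C) (u v : ℝ) : IntervalIntegrable f volume u v := by
  refine (intervalIntegrable_const (c := C)).mono_fun hf.aestronglyMeasurable
    (Filter.Eventually.of_forall fun y => ?_)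
  rw [Real.norm_eq_abs]
  exact (hC y).trans (le_abs_self C)

/-- The integral of `s y - s (y - d)` telescopes to the windows of length `d` at the two ends.
Nothing is needed about `s` inside the range. -/
lemma abs_integral_sub_le {g s : ℝ → ℝ} (hg : Measurable g) (hs : Measurable s) {G S E κ : ℝ}
    (hgb : ∀ y, |g y| ≤ G) (hsb : ∀ y, |s y| ≤ S) {u v d : ℝ} (huv : u < v)
    (h : ∀ y, |g y - κ * (s y - s (y - d))| ≤ E) :
    |(v - u)⁻¹ * (∫ y in u..v, g y)
        - κ * (v - u)⁻¹ * ((∫ y in (v - d)..v, s y) - ∫ y in (u - d)..u, s y)| ≤ E := by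
  have hsi := intervalIntegrable_of_abs_le hs hsb
  have hsd : IntervalIntegrable (fun y => s (y - d)) volume u v :=
    intervalIntegrable_of_abs_le (hs.comp (measurable_id.sub_const d)) (fun y => hsb _) u v
  have h1 : (∫ y in (v - d)..v, s y) - ∫ y in (u - d)..u, s y
      = ∫ y in u..v, (s y - s (y - d)) := by
    rw [intervalIntegral.integral_sub (hsi u v) hsd,
      intervalIntegral.integral_comp_sub_right (fun y => s y) d]
    have e1 := intervalIntegral.integral_add_adjacent_intervals (hsi (u - d) u) (hsi u v)
    have e2 := intervalIntegral.integral_add_adjacent_intervals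
      (hsi (u - d) (v - d)) (hsi (v - d) v)
    linarith
  have h2 : (v - u)⁻¹ * (∫ y in u..v, g y)
        - κ * (v - u)⁻¹ * ((∫ y in (v - d)..v, s y) - ∫ y in (u - d)..u, s y)
      = (v - u)⁻¹ * ∫ y in u..v, (g y - κ * (s y - s (y - d))) := by
    rw [h1, intervalIntegral.integral_sub (intervalIntegrable_of_abs_le hg hgb u v)
      (((hsi u v).sub hsd).const_mul κ), intervalIntegral.integral_const_mul]
    ring
  have hvu : 0 < v - u := sub_pos.2 huv
  have h3 := intervalIntegral.norm_integral_le_of_norm_le_const (a := u) (b := v) (C := E)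
    (f := fun y => g y - κ * (s y - s (y - d))) fun y _ => h y
  rw [Real.norm_eq_abs, abs_of_pos hvu] at h3
  rw [h2, abs_mul, abs_of_pos (inv_pos.2 hvu), inv_mul_le_iff₀ hvu]
  linarith

namespace QueryResponse

variable (Q : QueryResponse n ℓ b r Ω)

lemma meanStep_eq {a c : ℝ} (ha : 0 < a) (hac : a < c) (hm : 0 < m) (hb : 0 < b) (t : Fin r)
    (x : AttackSpace n ℓ b r Ω) :
    Q.meanStep m a c t x = ((c + a) * sigma m b)⁻¹ *
      ∫ y in (a * sigma m b)..((c + 2 * a) * sigma m b), avg fun θ : Fin n → Bool =>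
        Q.stepSign t (resample t θ y x) *
          avgAdjusted x.2.1 x.2.2.1.1 (signed θ (x.2.2.1.2 t)) := by
  have := isProbabilityMeasure_stepLaw ha hac hm hb
  rw [← integral_stepLaw ha hac hm hb]
  simp only [meanStep, stepValue_resample, avg, smul_eq_mul]
  rw [integral_const_mul, integral_finsetSum]
  intro θ _
  refine Integrable.mul_const ?_ _
  refine Integrable.of_bound (((Q.measurable_stepSign t).comp
    (measurable_resample t θ)).comp measurable_prodMk_left).aestronglyMeasurable 1
    (Filter.Eventually.of_forall fun y => ?_)
  exact (Q.abs_stepSign t _).le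

lemma abs_signGap_le (m : ℕ) (a c : ℝ) (t : Fin r) (x : AttackSpace n ℓ b r Ω) :
    |Q.signGap m a c t x| ≤ 2 := by
  have h : ∀ u : ℝ, |∫ y in (u - 4)..u, Q.meanSign t x y| ≤ 4 := by
    intro u
    have := intervalIntegral.norm_integral_le_of_norm_le_const (a := u - 4) (b := u) (C := 1)
      (f := Q.meanSign t x) fun y _ => Q.abs_meanSign_le t x y
    rw [Real.norm_eq_abs] at this
    simpa using this
  have h1 := abs_le.1 (h ((c + 2 * a) * sigma m b))
  have h2 := abs_le.1 (h (a * sigma m b))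
  rw [signGap, abs_le]
  constructor <;> linarith [h1.1, h1.2, h2.1, h2.2]

lemma sigma_sq (m b : ℕ) : sigma m b ^ 2 = m / b := Real.sq_sqrt (by positivity)

/-- The conditional mean of the contribution of a step is proportional to the sign gap, up to
the deviation of the type counts. -/
lemma abs_meanStep_sub_le {a c : ℝ} (ha : 0 < a) (hac : a < c) (hℓ : 0 < ℓ) (hb : 0 < b)
    (hm : 4 * numTypes ℓ b ≤ m) (t : Fin r) (x : AttackSpace n ℓ b r Ω)
    (hx : IsTail m (x.2.2.1.2 t)) :
    |Q.meanStep m a c t x - sigma m b / (ℓ * (c + a)) * Q.signGap m a c t x|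
      ≤ (8 * numTypes ℓ b * (5 + 8 * ℓ) + 2 * numTypes ℓ b * (1 + 2 / (c + a))) *
        (1 + typeDev m x.2.1 (x.2.2.1.2 t) / √m) := by
  have hK := one_le_numTypes (ℓ := ℓ) hb
  set K := numTypes ℓ b with hKdef
  have hm0 : (0 : ℝ) < m := by linarith
  have hm' : 0 < m := by exact_mod_cast hm0
  have hσ := sigma_pos hm' hb
  have hσ2 := sigma_sq m b
  have hℓ' : (0 : ℝ) < ℓ := by exact_mod_cast hℓ
  have hb' : (0 : ℝ) < b := by exact_mod_cast hb
  have hca : 0 < c + a := by linarith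
  set σ := sigma m b with hσdef
  set ρ := x.2.1
  set h := x.2.2.1.1
  set z := x.2.2.1.2 t
  set D := typeDev m ρ z with hD
  have hD0 : 0 ≤ D := typeDev_nonneg ρ z
  have hDm : 0 ≤ D / √m := by positivity
  obtain ⟨φ, hφ1, hφ⟩ := Q.exists_stepSign_resample_eq t x
  set g : ℝ → ℝ := fun y => avg fun θ : Fin n → Bool =>
    Q.stepSign t (resample t θ y x) * avgAdjusted ρ h (signed θ z) with hg
  have hgm : Measurable g := by
    simp only [hg, avg, smul_eq_mul]
    exact (Finset.measurable_sum _ fun θ _ => (((Q.measurable_stepSign t).comp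
      (measurable_resample t θ)).comp measurable_prodMk_left).mul_const _).const_mul _
  have hgb : ∀ y, |g y| ≤ √m := by
    intro y
    refine (abs_avg_le _).trans (le_trans (avg_mono fun θ => ?_)
      (avg_abs_avgAdjusted_le hℓ ρ h hx))
    rw [abs_mul, abs_stepSign, one_mul]
  rw [Q.meanStep_eq ha hac hm' hb t x]
  have hL : (c + a) * σ = (c + 2 * a) * σ - a * σ := by ring
  have huv : a * σ < (c + 2 * a) * σ := by nlinarith
  have hgap := Q.abs_signGap_le m a c t x
  by_cases hgood : ∀ τ, m / K / 2 ≤ typeCount z (keyType ρ) τ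
  · have main := abs_integral_sub_le (d := 4) (κ := m / (4 * b * ℓ)) hgm
      (Q.measurable_meanSign t x) hgb (Q.abs_meanSign_le t x) huv
      (E := 8 * K * (5 + 8 * ℓ) * (1 + D / √m)) fun y => by
        simp only [hg, meanSign, hφ]
        exact abs_avg_mul_avgAdjusted_sub_le hℓ hb ρ h hx hm hgood φ hφ1 y
    -- Here `m = σ ^ 2 * b`, and the length of the range cancels one `σ`. The factor `1 / 4` turns
    -- the integrals over the windows into averages, which form `signGap`.
    have e : m / (4 * b * ℓ) * ((c + 2 * a) * σ - a * σ)⁻¹ *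
        ((∫ y in ((c + 2 * a) * σ - 4)..((c + 2 * a) * σ), Q.meanSign t x y)
          - ∫ y in (a * σ - 4)..(a * σ), Q.meanSign t x y)
        = σ / (ℓ * (c + a)) * Q.signGap m a c t x := by
      rw [← hL, signGap, ← hσdef]
      have : (m : ℝ) = σ ^ 2 * b := by rw [hσ2]; field_simp
      rw [this]
      field_simp
    rw [e, ← hL] at main
    refine main.trans ?_
    have : 0 ≤ 2 * K * (1 + 2 / (c + a)) * (1 + D / √m) := by positivity
    nlinarith
  -- If some type is rare, the deviation is at least half of the mean count, so `√m` itself is at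
  -- most `2 * K * (D / √m)`. Crude bounds of order `√m` for both quantities then suffice.
  · push Not at hgood
    obtain ⟨τ, hτ⟩ := hgood
    have hDK : m / K / 2 ≤ D := by
      have h1 : |(typeCount z (keyType ρ) τ : ℝ) - m / K| ≤ D :=
        Finset.single_le_sum (f := fun τ => |(typeCount z (keyType ρ) τ : ℝ) - m / K|)
          (fun _ _ => abs_nonneg _) (Finset.mem_univ τ)
      have := neg_abs_le ((typeCount z (keyType ρ) τ : ℝ) - m / K)
      linarith
    have hsm : √(m : ℝ) * √m = m := Real.mul_self_sqrt hm0.le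
    have hsm0 : 0 < √(m : ℝ) := Real.sqrt_pos.2 hm0
    have hDs : √m ≤ 2 * K * (D / √m) := by
      rw [div_div, div_le_iff₀ (by positivity)] at hDK
      rw [← mul_div_assoc, le_div_iff₀ hsm0, hsm]
      linarith
    have h1 : |((c + a) * σ)⁻¹ * ∫ y in (a * σ)..((c + 2 * a) * σ), g y| ≤ √m := by
      have := intervalIntegral.norm_integral_le_of_norm_le_const (a := a * σ)
        (b := (c + 2 * a) * σ) (C := √m) (f := g) fun y _ => hgb y
      have hcσ := mul_pos hca hσ
      rw [Real.norm_eq_abs, ← hL, abs_of_pos hcσ] at this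
      rw [abs_mul, abs_of_pos (inv_pos.2 hcσ), inv_mul_le_iff₀ hcσ]
      linarith
    have hσm : σ ≤ √m := by
      refine Real.sqrt_le_sqrt (div_le_self hm0.le ?_)
      exact_mod_cast hb
    have h2 : |σ / (ℓ * (c + a)) * Q.signGap m a c t x| ≤ √m * (2 / (c + a)) := by
      rw [abs_mul, abs_of_pos (by positivity)]
      have h3 : σ / (ℓ * (c + a)) ≤ √m / (c + a) := by
        have : (1 : ℝ) ≤ ℓ := by exact_mod_cast hℓ
        gcongr
        nlinarith
      calc σ / (ℓ * (c + a)) * |Q.signGap m a c t x| ≤ √m / (c + a) * 2 := by gcongr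
        _ = _ := by ring
    refine (abs_sub _ _).trans ?_
    have h4 : √m * (1 + 2 / (c + a)) ≤ 2 * K * (D / √m) * (1 + 2 / (c + a)) := by gcongr
    have h5 : 0 ≤ 8 * K * (5 + 8 * ℓ) * (1 + D / √m) := by positivity
    have h6 : 0 ≤ 2 * K * (1 + 2 / (c + a)) := by positivity
    nlinarith

end QueryResponse

end

section

variable {n ℓ b m r : ℕ} {Ω : Type*} [MeasurableSpace Ω]

/-! ### Moments of the interaction -/

lemma ae_isTail {a c : ℝ} (hn : r * m + 1 ≤ n) (hb : 0 < b)
    [IsProbabilityMeasure (stepLaw b m a c)] (P : Measure Ω) [IsProbabilityMeasure P] :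
    ∀ᵐ x ∂(attackLaw n ℓ b m r a c P), ∀ t, IsTail m (x.2.2.1.2 t) := by
  have := isProbabilityMeasure_tailLaw hn
  have := isProbabilityMeasure_randomnessLaw (n := n) (ℓ := ℓ) hb
  rw [attackLaw_eq]
  have h : MeasurePreserving (fun x : AttackSpace n ℓ b r Ω => x.2.2.1)
      (P.prod ((randomnessLaw n ℓ b).prod ((tailLaw n m r).prod
      (Measure.pi fun _ => stepLaw b m a c)))) (tailLaw n m r) :=
    measurePreserving_fst.comp (measurePreserving_snd.comp measurePreserving_snd)
  filter_upwards [h.quasiMeasurePreserving.ae ae_mem_tailOutcomes] with x hx t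
  exact isTail_of_mem hx t

/-- The quadratic error term of step `t`. -/
def devSq (m : ℕ) (t : Fin r) (x : AttackSpace n ℓ b r Ω) : ℝ :=
  1 + typeDev m x.2.1 (x.2.2.1.2 t) ^ 2 / m

lemma typeCount_eq_sum {𝒯 : Type*} [DecidableEq 𝒯] (z : Fin n → ℝ) (ty : Fin n → 𝒯) (τ : 𝒯) :
    (typeCount z ty τ : ℝ) = ∑ i, (if z i = 0 then 0 else 1) * (if ty i = τ then 1 else 0) := by
  rw [typeCount_eq, Finset.filter_filter, Finset.card_filter]
  push_cast
  refine Finset.sum_congr rfl fun i _ => ?_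
  by_cases h1 : z i = 0 <;> by_cases h2 : ty i = τ <;> simp [h1, h2]

lemma measurable_typeDev (t : Fin r) : Measurable fun x : Randomness n ℓ b ×
    (Fin n × (Fin r → Fin n → ℝ)) => typeDev m x.1 (x.2.2 t) := by
  simp only [typeDev, typeCount_eq_sum]
  refine Finset.measurable_sum _ fun τ _ => Measurable.abs (Measurable.sub_const
    (Finset.measurable_sum _ fun i _ => Measurable.mul ?_ ?_) _)
  · exact Measurable.ite (measurableSet_eq_fun (by fun_prop) measurable_const)
      measurable_const measurable_const
  · exact (measurable_of_finite fun ρ : Randomness n ℓ b =>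
      if keyType ρ i = τ then (1 : ℝ) else 0).comp measurable_fst

lemma typeDev_le (ρ : Randomness n ℓ b) (z : Fin n → ℝ) :
    typeDev m ρ z ≤ numTypes ℓ b * (n + m / numTypes ℓ b) := by
  have h : ∀ τ ∈ Finset.univ, |(typeCount z (keyType ρ) τ : ℝ) - m / numTypes ℓ b|
      ≤ n + m / numTypes ℓ b := by
    intro τ _
    have h1 : typeCount z (keyType ρ) τ ≤ n := by
      rw [typeCount_eq]
      exact (Finset.card_le_univ _).trans (by simp)
    have h1' : (typeCount z (keyType ρ) τ : ℝ) ≤ n := by exact_mod_cast h1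
    have h2 : 0 ≤ (m : ℝ) / numTypes ℓ b := by unfold numTypes; positivity
    have h3 : (0 : ℝ) ≤ typeCount z (keyType ρ) τ := Nat.cast_nonneg _
    rw [abs_le]; constructor <;> linarith
  refine (Finset.sum_le_sum h).trans (le_of_eq ?_)
  rw [Finset.sum_const, nsmul_eq_mul, Finset.card_univ]
  rfl

/-- The randomness of the sketch as a family of types. -/
def typeEquiv (n ℓ b : ℕ) : Randomness n ℓ b ≃ (Fin n → Fin ℓ → Fin b × Bool) where
  toFun := keyType
  invFun f := (fun j i => (f i j).1, fun j i => (f i j).2)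
  left_inv _ := rfl
  right_inv _ := rfl

/-- Fully random hash and sign functions are the same as independent uniform types for the keys. -/
lemma integral_typeDev_sq_le (hb : 0 < b) {z : Fin n → ℝ} (hz : IsTail m z) :
    ∫ ρ, typeDev m ρ z ^ 2 ∂(randomnessLaw n ℓ b) ≤ numTypes ℓ b ^ 2 * m := by
  have : Nonempty (Fin b) := ⟨⟨0, hb⟩⟩
  refine le_trans (le_of_eq ?_) (avg_typeCount_dev_sq_le (𝒯 := Fin ℓ → Fin b × Bool) hz)
  rw [randomnessLaw, integral_uniformOn_univ, Fintype.card_congr (typeEquiv n ℓ b), avg,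
    ← (typeEquiv n ℓ b).sum_comp, smul_eq_mul, Fintype.card_fun (α := Fin n)]
  push_cast
  rfl

lemma integrable_of_abs_le {α : Type*} [MeasurableSpace α] {μ : Measure α} [IsFiniteMeasure μ]
    {f : α → ℝ} (hf : Measurable f) {C : ℝ} (h : ∀ x, |f x| ≤ C) : Integrable f μ :=
  Integrable.of_bound hf.aestronglyMeasurable C (Filter.Eventually.of_forall h)

lemma integral_devSq_le {a c : ℝ} (hn : r * m + 1 ≤ n) (hb : 0 < b) (hm : 0 < m)
    [IsProbabilityMeasure (stepLaw b m a c)] (P : Measure Ω) [IsProbabilityMeasure P]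
    (t : Fin r) :
    Integrable (devSq (n := n) (ℓ := ℓ) (b := b) (Ω := Ω) m t) (attackLaw n ℓ b m r a c P) ∧
    ∫ x, devSq m t x ∂(attackLaw n ℓ b m r a c P) ≤ 1 + numTypes ℓ b ^ 2 := by
  have := isProbabilityMeasure_tailLaw hn
  have := isProbabilityMeasure_randomnessLaw (n := n) (ℓ := ℓ) hb
  have := isProbabilityMeasure_attackLaw (n := n) (ℓ := ℓ) (a := a) (c := c) hn hb P
  have hm' : (0 : ℝ) < m := by exact_mod_cast hm
  set f : Randomness n ℓ b × (Fin n × (Fin r → Fin n → ℝ)) → ℝ :=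
    fun x => typeDev m x.1 (x.2.2 t) ^ 2 with hf
  have hfm : Measurable f := (measurable_typeDev t).pow_const 2
  have hfi : Integrable f ((randomnessLaw n ℓ b).prod (tailLaw n m r)) := by
    refine integrable_of_abs_le hfm (C := (numTypes ℓ b * (n + m / numTypes ℓ b)) ^ 2)
      fun x => ?_
    rw [abs_of_nonneg (sq_nonneg _)]
    exact pow_le_pow_left₀ (typeDev_nonneg _ _) (typeDev_le _ _) 2
  have hmp : MeasurePreserving (fun x : AttackSpace n ℓ b r Ω => (x.2.1, x.2.2.1))
      (attackLaw n ℓ b m r a c P) ((randomnessLaw n ℓ b).prod (tailLaw n m r)) := by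
    rw [attackLaw_eq]
    exact ((MeasurePreserving.id _).prod measurePreserving_fst).comp measurePreserving_snd
  have hfi' : Integrable (fun x : AttackSpace n ℓ b r Ω => f (x.2.1, x.2.2.1))
      (attackLaw n ℓ b m r a c P) := hmp.integrable_comp_of_integrable hfi
  have hle : ∫ p, f p ∂((randomnessLaw n ℓ b).prod (tailLaw n m r)) ≤ numTypes ℓ b ^ 2 * m := by
    -- The sketch randomness is integrated first, with the tails fixed.
    rw [integral_prod_symm _ hfi]
    have h1 : ∫ τ, ∫ ρ, f (ρ, τ) ∂(randomnessLaw n ℓ b) ∂(tailLaw n m r)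
        ≤ ∫ _τ, numTypes ℓ b ^ 2 * (m : ℝ) ∂(tailLaw n m r) := by
      refine integral_mono_ae hfi.integral_prod_right (integrable_const _) ?_
      filter_upwards [ae_mem_tailOutcomes] with τ hτ
      have h := integral_typeDev_sq_le (ℓ := ℓ) (z := τ.2 t) hb (isTail_of_mem hτ t)
      simpa only [hf] using h
    simpa using h1
  have heq : ∫ x : AttackSpace n ℓ b r Ω, f (x.2.1, x.2.2.1) ∂(attackLaw n ℓ b m r a c P)
      = ∫ p, f p ∂((randomnessLaw n ℓ b).prod (tailLaw n m r)) := by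
    have h := integral_map (μ := attackLaw n ℓ b m r a c P) (f := f)
      hmp.measurable.aemeasurable hfm.aestronglyMeasurable
    rw [hmp.map_eq] at h
    exact h.symm
  have e : devSq (n := n) (ℓ := ℓ) (b := b) (Ω := Ω) m t
      = fun x => 1 + f (x.2.1, x.2.2.1) / m := rfl
  rw [e]
  refine ⟨(integrable_const _).add (hfi'.div_const _), ?_⟩
  rw [integral_add (integrable_const _) (hfi'.div_const _), integral_div, heq]
  simp only [integral_const, probReal_univ, one_smul]
  gcongr
  rwa [div_le_iff₀ hm']

namespace QueryResponse

variable (Q : QueryResponse n ℓ b r Ω)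

/-- The signs of the tail are symmetric, so averaging over `θ` does not change the expectation. What
remains is the interaction with the `t`-th value replaced by `y`. -/
lemma integral_meanSign {a c : ℝ} (hn : r * m + 1 ≤ n) (hb : 0 < b)
    [IsProbabilityMeasure (stepLaw b m a c)] (P : Measure Ω) [IsProbabilityMeasure P]
    (t : Fin r) (y : ℝ) :
    ∫ x, Q.meanSign t x y ∂(attackLaw n ℓ b m r a c P) = 2 * Q.reportProb m a c P t y - 1 := by
  have := isProbabilityMeasure_attackLaw (n := n) (ℓ := ℓ) (a := a) (c := c) hn hb P
  set μ := attackLaw n ℓ b m r a c P with hμ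
  let F : AttackSpace n ℓ b r Ω → AttackSpace n ℓ b r Ω := fun x =>
    (x.1, x.2.1, x.2.2.1, Function.update x.2.2.2 t y)
  have hF : Measurable F := by
    have h2 : Measurable fun x : AttackSpace n ℓ b r Ω => Function.update x.2.2.2 t y := by
      refine measurable_pi_iff.2 fun i => ?_
      by_cases hi : i = t
      · subst hi; simp
      · simp only [Function.update_of_ne hi]; fun_prop
    exact (by fun_prop : Measurable fun p : AttackSpace n ℓ b r Ω => p.1).prodMk
      ((by fun_prop : Measurable fun p : AttackSpace n ℓ b r Ω => p.2.1).prodMk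
      ((by fun_prop : Measurable fun p : AttackSpace n ℓ b r Ω => p.2.2.1).prodMk h2))
  have hgm : Measurable fun x => Q.stepSign t (F x) := (Q.measurable_stepSign t).comp hF
  have hθ : ∀ θ : Fin n → Bool, ∫ x, Q.stepSign t (resample t θ y x) ∂μ
      = ∫ x, Q.stepSign t (F x) ∂μ := by
    intro θ
    have hmp := measurePreserving_signs (n := n) (ℓ := ℓ) (a := a) (c := c) hn hb P t θ
    have h := integral_map (μ := μ) (f := fun x => Q.stepSign t (F x))
      hmp.measurable.aemeasurable hgm.aestronglyMeasurable
    rw [hmp.map_eq] at h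
    exact h.symm
  have hi : ∀ θ : Fin n → Bool, Integrable (fun x => Q.stepSign t (resample t θ y x)) μ :=
    fun θ => integrable_of_abs_le ((Q.measurable_stepSign t).comp
      ((measurable_resample t θ).comp measurable_prodMk_right)) fun x => (Q.abs_stepSign t _).le
  have h1 : ∫ x, Q.meanSign t x y ∂μ = ∫ x, Q.stepSign t (F x) ∂μ := by
    simp only [meanSign, avg, smul_eq_mul]
    rw [integral_const_mul, integral_finsetSum _ fun θ _ => hi θ]
    simp only [hθ]
    exact avg_const (ι := Fin n) (α := Bool) _
  set S : Set (AttackSpace n ℓ b r Ω) := {x | x.2.2.1.1 ∈ Q.response x.1 x.2.1 x.2.2.1.1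
      (query x.2.2.1.1 x.2.2.1.2 (Function.update x.2.2.2 t y)) t} with hS
  have hSm : MeasurableSet S := hF (Q.measurableSet_reported t)
  have h2 : (fun x => Q.stepSign t (F x)) = fun x => 2 * S.indicator 1 x - 1 := by
    ext x
    classical
    have : Q.stepSign t (F x) = if x ∈ S then 1 else -1 := by
      rw [stepSign_eq]; rfl
    rw [this, Set.indicator_apply]
    split_ifs <;> norm_num
  have hind : Integrable (S.indicator (1 : AttackSpace n ℓ b r Ω → ℝ)) μ :=
    (integrable_const (1 : ℝ)).indicator hSm
  rw [h1, h2, integral_sub (hind.const_mul 2) (integrable_const _), integral_const_mul, integral_indicator_one hSm]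
  simp [reportProb, hS, hμ]

lemma integral_integral_meanSign {a c : ℝ} (hn : r * m + 1 ≤ n) (hb : 0 < b)
    [IsProbabilityMeasure (stepLaw b m a c)] (P : Measure Ω) [IsProbabilityMeasure P]
    (t : Fin r) {u v : ℝ} (huv : u ≤ v) :
    Integrable (fun x => ∫ y in u..v, Q.meanSign t x y) (attackLaw n ℓ b m r a c P) ∧
    IntervalIntegrable (fun y => 2 * Q.reportProb m a c P t y - 1) volume u v ∧
    ∫ x, (∫ y in u..v, Q.meanSign t x y) ∂(attackLaw n ℓ b m r a c P)
      = ∫ y in u..v, (2 * Q.reportProb m a c P t y - 1) := by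
  have := isProbabilityMeasure_attackLaw (n := n) (ℓ := ℓ) (a := a) (c := c) hn hb P
  have hi : Integrable (fun p : AttackSpace n ℓ b r Ω × ℝ => Q.meanSign t p.1 p.2)
      ((attackLaw n ℓ b m r a c P).prod (volume.restrict (Set.Ioc u v))) :=
    integrable_of_abs_le (Q.measurable_meanSign_prod t) fun p => Q.abs_meanSign_le t _ _
  simp only [← Q.integral_meanSign hn hb P]
  simp only [intervalIntegral.integral_of_le huv]
  refine ⟨hi.integral_prod_left, ?_, integral_integral_swap hi⟩
  rw [intervalIntegrable_iff_integrableOn_Ioc_of_le huv]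
  exact hi.integral_prod_right

/-- Since `a * sigma m b ≥ 2`, the upper window lies above `c * sigma m b` and the lower one within
`[-a * sigma m b, a * sigma m b]`. Correctness makes the expected signs at least `1 - 2 * δ` and at
most `2 * δ - 1` there. -/
lemma integral_two_sub_signGap_le {a c δ : ℝ} (hn : r * m + 1 ≤ n) (hb : 0 < b)
    [IsProbabilityMeasure (stepLaw b m a c)] (P : Measure Ω) [IsProbabilityMeasure P]
    (hσ : 2 ≤ a * sigma m b) (hQ : Q.IsCorrect m a c δ P) (t : Fin r) :
    Integrable (Q.signGap m a c t) (attackLaw n ℓ b m r a c P) ∧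
    2 - 4 * δ ≤ ∫ x, Q.signGap m a c t x ∂(attackLaw n ℓ b m r a c P) := by
  set A := a * sigma m b with hA
  have hB : (c + 2 * a) * sigma m b = c * sigma m b + 2 * A := by rw [hA]; ring
  set B := (c + 2 * a) * sigma m b with hB'
  obtain ⟨i1, j1, e1⟩ := Q.integral_integral_meanSign (a := a) (c := c) hn hb P t
    (show B - 4 ≤ B by linarith)
  obtain ⟨i2, j2, e2⟩ := Q.integral_integral_meanSign (a := a) (c := c) hn hb P t
    (show A - 4 ≤ A by linarith)
  refine ⟨(i1.sub i2).const_mul _, ?_⟩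
  simp only [signGap]
  rw [integral_const_mul, integral_sub i1 i2, e1, e2]
  have h1 : ∫ _y in (B - 4)..B, (1 - 2 * δ) ≤ ∫ y in (B - 4)..B,
      (2 * Q.reportProb m a c P t y - 1) := by
    refine intervalIntegral.integral_mono_on (by linarith) (by simp) j1 fun y hy => ?_
    have := (hQ t y).1 (by linarith [hy.1])
    linarith
  have h2 : ∫ y in (A - 4)..A, (2 * Q.reportProb m a c P t y - 1)
      ≤ ∫ _y in (A - 4)..A, (2 * δ - 1) := by
    refine intervalIntegral.integral_mono_on (by linarith) j2 (by simp) fun y hy => ?_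
    have := (hQ t y).2 (abs_le.2 ⟨by linarith [hy.1], hy.2⟩)
    linarith
  simp only [intervalIntegral.integral_const, smul_eq_mul] at h1 h2
  linarith

end QueryResponse

end

/-! ### Mean, second moment and correlation with the past for one step -/

section

variable {n ℓ b m r : ℕ} {Ω : Type*} [MeasurableSpace Ω]

lemma abs_avgAdjusted_le (hℓ : 0 < ℓ) (ρ : Randomness n ℓ b) (h : Fin n) {z : Fin n → ℝ}
    (hz : IsTail m z) : |avgAdjusted ρ h z| ≤ n := by
  have hℓ' : (0 : ℝ) < ℓ := by exact_mod_cast hℓ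
  have h1 : |∑ i, z i * relSum (keyType ρ i) (keyType ρ h)| ≤ ∑ _i : Fin n, (ℓ : ℝ) := by
    refine (Finset.abs_sum_le_sum_abs _ _).trans (Finset.sum_le_sum fun i _ => ?_)
    rw [abs_mul]
    have hzi : |z i| ≤ 1 := by rcases hz.1 i with h | h | h <;> simp [h]
    exact (mul_le_of_le_one_left (abs_nonneg _) hzi).trans (abs_relSum_le _ _)
  rw [avgAdjusted_eq, abs_mul, abs_of_pos (by positivity), one_div, inv_mul_le_iff₀ hℓ']
  simpa [mul_comm] using h1

/-- The constant in the error bound for the conditional mean of a step. -/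
def errConst (ℓ b : ℕ) (a c : ℝ) : ℝ :=
  8 * numTypes ℓ b * (5 + 8 * ℓ) + 2 * numTypes ℓ b * (1 + 2 / (c + a))

/-- A bound for the expectation of the quadratic error term. -/
def devConst (ℓ b : ℕ) : ℝ := 1 + numTypes ℓ b ^ 2

lemma errConst_nonneg (ℓ b : ℕ) {a c : ℝ} (ha : 0 < a) (hac : a < c) : 0 ≤ errConst ℓ b a c := by
  have : 0 < c + a := by linarith
  unfold errConst numTypes
  positivity

omit [MeasurableSpace Ω] in
lemma one_le_devSq (t : Fin r) (x : AttackSpace n ℓ b r Ω) : 1 ≤ devSq m t x :=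
  le_add_of_nonneg_right (by positivity)

omit [MeasurableSpace Ω] in
lemma one_add_div_sq_le (t : Fin r) (x : AttackSpace n ℓ b r Ω) :
    (1 + typeDev m x.2.1 (x.2.2.1.2 t) / √m) ^ 2 ≤ 2 * devSq m t x := by
  have h : (typeDev m x.2.1 (x.2.2.1.2 t) / √m) ^ 2 = typeDev m x.2.1 (x.2.2.1.2 t) ^ 2 / m := by
    rw [div_pow, Real.sq_sqrt (Nat.cast_nonneg _)]
  rw [devSq, ← h]
  nlinarith [sq_nonneg (typeDev m x.2.1 (x.2.2.1.2 t) / √m - 1)]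

omit [MeasurableSpace Ω] in
lemma one_add_div_le (t : Fin r) (x : AttackSpace n ℓ b r Ω) :
    1 + typeDev m x.2.1 (x.2.2.1.2 t) / √m ≤ 2 * devSq m t x := by
  have h1 := one_add_div_sq_le (m := m) t x
  have h2 := one_le_devSq (m := m) t x
  have h3 : 0 ≤ typeDev m x.2.1 (x.2.2.1.2 t) / √m :=
    div_nonneg (typeDev_nonneg _ _) (Real.sqrt_nonneg _)
  nlinarith

omit [MeasurableSpace Ω] in
lemma typeDev_le_mul_devSq (hm : 0 < m) (t : Fin r) (x : AttackSpace n ℓ b r Ω) :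
    typeDev m x.2.1 (x.2.2.1.2 t) ≤ √m * devSq m t x := by
  have hm' : (0 : ℝ) < m := by exact_mod_cast hm
  have hs : 0 < √(m : ℝ) := Real.sqrt_pos.2 hm'
  have h : (typeDev m x.2.1 (x.2.2.1.2 t) / √m) ^ 2 = typeDev m x.2.1 (x.2.2.1.2 t) ^ 2 / m := by
    rw [div_pow, Real.sq_sqrt (Nat.cast_nonneg _)]
  rw [mul_comm, ← div_le_iff₀ hs, devSq, ← h]
  nlinarith [sq_nonneg (typeDev m x.2.1 (x.2.2.1.2 t) / √m - 1)]

namespace QueryResponse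

variable (Q : QueryResponse n ℓ b r Ω)

/-- The contribution of step `t` to the bias. -/
def stepTerm (t : Fin r) (x : AttackSpace n ℓ b r Ω) : ℝ := Q.stepSign t x * stepValue t x

lemma measurable_stepTerm (t : Fin r) : Measurable (Q.stepTerm t) :=
  (Q.measurable_stepSign t).mul (measurable_stepValue t)

lemma abs_stepTerm (t : Fin r) (x : AttackSpace n ℓ b r Ω) :
    |Q.stepTerm t x| = |stepValue t x| := by
  rw [stepTerm, abs_mul, abs_stepSign, one_mul]

lemma stepTerm_sq (t : Fin r) (x : AttackSpace n ℓ b r Ω) :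
    Q.stepTerm t x ^ 2 = stepValue t x ^ 2 := by
  rw [stepTerm, mul_pow, stepSign_sq, one_mul]

lemma stepTerm_resample_of_lt {s t : Fin r} (hst : s < t) (θ : Fin n → Bool) (y : ℝ)
    (x : AttackSpace n ℓ b r Ω) : Q.stepTerm s (resample t θ y x) = Q.stepTerm s x := by
  rw [stepTerm, Q.stepSign_resample_of_lt hst, stepValue_resample_of_ne hst.ne, stepTerm]

variable {a c δ : ℝ} (P : Measure Ω) [IsProbabilityMeasure P]

lemma memLp_stepTerm (hn : r * m + 1 ≤ n) (hℓ : 0 < ℓ) (hb : 0 < b)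
    [IsProbabilityMeasure (stepLaw b m a c)] (t : Fin r) (p : ENNReal) :
    MemLp (Q.stepTerm t) p (attackLaw n ℓ b m r a c P) := by
  have := isProbabilityMeasure_attackLaw (n := n) (ℓ := ℓ) (a := a) (c := c) hn hb P
  refine MemLp.of_bound (Q.measurable_stepTerm t).aestronglyMeasurable n ?_
  filter_upwards [ae_isTail hn hb P] with x hx
  rw [Real.norm_eq_abs, abs_stepTerm]
  exact abs_avgAdjusted_le hℓ _ _ (hx t)

lemma integrable_stepTerm_resample [IsProbabilityMeasure (stepLaw b m a c)] (t : Fin r)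
    (θ : Fin n → Bool) (x : AttackSpace n ℓ b r Ω) :
    Integrable (fun y => Q.stepTerm t (resample t θ y x)) (stepLaw b m a c) := by
  refine integrable_of_abs_le ((Q.measurable_stepTerm t).comp
    ((measurable_resample t θ).comp measurable_prodMk_left))
    (C := |avgAdjusted x.2.1 x.2.2.1.1 (signed θ (x.2.2.1.2 t))|) fun y => ?_
  rw [abs_stepTerm, stepValue_resample]

lemma avg_integral_mul_sub [IsProbabilityMeasure (stepLaw b m a c)] (t : Fin r)
    (x : AttackSpace n ℓ b r Ω) (g κ : ℝ) :
    (avg fun θ : Fin n → Bool => ∫ y, g * (Q.stepTerm t (resample t θ y x) - κ)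
      ∂(stepLaw b m a c)) = g * (Q.meanStep m a c t x - κ) := by
  have h : ∀ θ : Fin n → Bool, ∫ y, g * (Q.stepTerm t (resample t θ y x) - κ) ∂(stepLaw b m a c)
      = g * (∫ y, Q.stepTerm t (resample t θ y x) ∂(stepLaw b m a c)) - g * κ := by
    intro θ
    rw [integral_const_mul, integral_sub (Q.integrable_stepTerm_resample t θ x)
      (integrable_const _)]
    simp [mul_sub]
  simp only [h]
  rw [avg_sub, avg_mul_left, avg_const, mul_sub]
  rfl

/-- The mean contribution of a step that is asymptotically attained. -/
def stepMean (ℓ b m : ℕ) (a c : ℝ) : ℝ := sigma m b / (ℓ * (c + a))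

/-- Correctness bounds the sign gap only in expectation. Because the gap never exceeds 2, its
distance to 2 is `2 - signGap` without absolute value, and this can be integrated. -/
lemma abs_meanStep_sub_two_mul_le (ha : 0 < a) (hac : a < c) (hℓ : 0 < ℓ) (hb : 0 < b)
    (hm : 4 * numTypes ℓ b ≤ m) (t : Fin r) (x : AttackSpace n ℓ b r Ω)
    (hx : IsTail m (x.2.2.1.2 t)) :
    |Q.meanStep m a c t x - 2 * stepMean ℓ b m a c|
        ≤ errConst ℓ b a c * (1 + typeDev m x.2.1 (x.2.2.1.2 t) / √m)
          + stepMean ℓ b m a c * (2 - Q.signGap m a c t x) := by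
  have h1 := Q.abs_meanStep_sub_le ha hac hℓ hb hm t x hx
  have h2 := abs_le.1 (Q.abs_signGap_le m a c t x)
  have h3 : 0 ≤ stepMean ℓ b m a c :=
    div_nonneg (Real.sqrt_nonneg _) (mul_nonneg (Nat.cast_nonneg _) (by linarith))
  have e : Q.meanStep m a c t x - 2 * stepMean ℓ b m a c
      = (Q.meanStep m a c t x - stepMean ℓ b m a c * Q.signGap m a c t x)
        + -(stepMean ℓ b m a c * (2 - Q.signGap m a c t x)) := by ring
  rw [e]
  refine (abs_add_le _ _).trans (add_le_add h1 ?_)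
  rw [abs_neg, abs_of_nonneg (mul_nonneg h3 (by linarith [h2.2]))]

/-- A weighted bound for the correlation of a step with functions of the past. -/
lemma abs_integral_mul_stepTerm_sub_le (ha : 0 < a) (hac : a < c) (hn : r * m + 1 ≤ n)
    (hℓ : 0 < ℓ) (hb : 0 < b) (hm : 4 * numTypes ℓ b ≤ m) (hσ : 2 ≤ a * sigma m b)
    (hQ : Q.IsCorrect m a c δ P) (t : Fin r) {g : AttackSpace n ℓ b r Ω → ℝ}
    (hg : MemLp g 2 (attackLaw n ℓ b m r a c P)) (hgt : ∀ θ y x, g (resample t θ y x) = g x)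
    {lam : ℝ} (hlam : 0 < lam) :
    |∫ x, g x * (Q.stepTerm t x - 2 * stepMean ℓ b m a c) ∂(attackLaw n ℓ b m r a c P)|
      ≤ lam / 2 * (∫ x, g x ^ 2 ∂(attackLaw n ℓ b m r a c P))
        + (2 * lam)⁻¹ * (4 * errConst ℓ b a c ^ 2 * devConst ℓ b
          + 32 * stepMean ℓ b m a c ^ 2 * δ) := by
  have hm0 : (0 : ℝ) < m := by linarith [one_le_numTypes (ℓ := ℓ) hb]
  have hm' : 0 < m := by exact_mod_cast hm0
  have := isProbabilityMeasure_stepLaw ha hac hm' hb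
  have := isProbabilityMeasure_attackLaw (n := n) (ℓ := ℓ) (a := a) (c := c) hn hb P
  set μ := attackLaw n ℓ b m r a c P with hμ
  set K := errConst ℓ b a c with hK
  have hK0 : 0 ≤ K := errConst_nonneg ℓ b ha hac
  set s := stepMean ℓ b m a c with hs
  have hs0 : 0 ≤ s :=
    div_nonneg (Real.sqrt_nonneg _) (mul_nonneg (Nat.cast_nonneg _) (by linarith))
  obtain ⟨hd1, hd2⟩ := integral_devSq_le (n := n) (ℓ := ℓ) (a := a) (c := c) hn hb hm' P t
  obtain ⟨hg1, hg2⟩ := Q.integral_two_sub_signGap_le hn hb P hσ hQ t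
  have hf : Integrable (fun x => g x * (Q.stepTerm t x - 2 * s)) μ := by
    have h2 : MemLp (fun x => Q.stepTerm t x - 2 * s) 2 μ :=
      (Q.memLp_stepTerm P hn hℓ hb t 2).sub (memLp_const _)
    exact hg.integrable_mul h2
  have hgi : Integrable (fun x => g x ^ 2) μ := hg.integrable_sq
  obtain ⟨-, hr⟩ := integral_resample hn hb P t hf
  rw [hr]
  simp only [hgt]
  simp only [Q.avg_integral_mul_sub]
  have hB : Integrable (fun x => lam / 2 * g x ^ 2 + (2 * lam)⁻¹ *
      (4 * K ^ 2 * devSq m t x + 8 * s ^ 2 * (2 - Q.signGap m a c t x))) μ :=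
    (hgi.const_mul _).add ((((hd1.const_mul _)).add
      (((integrable_const _).sub hg1).const_mul _)).const_mul _)
  refine (norm_integral_le_of_norm_le (f := fun x => g x * (Q.meanStep m a c t x - 2 * s))
    hB ?_).trans ?_
  · filter_upwards [ae_isTail hn hb P] with x hx
    have h1 := Q.abs_meanStep_sub_two_mul_le ha hac hℓ hb hm t x (hx t)
    rw [← hK, ← hs] at h1
    have h2 := one_add_div_sq_le (m := m) t x
    have h3 := abs_le.1 (Q.abs_signGap_le m a c t x)
    set E := 1 + typeDev m x.2.1 (x.2.2.1.2 t) / √m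
    set d := 2 - Q.signGap m a c t x with hd
    have hd0 : 0 ≤ d := by rw [hd]; linarith [h3.2]
    have hd4 : d ≤ 4 := by rw [hd]; linarith [h3.1]
    set A := Q.meanStep m a c t x - 2 * s with hA
    -- As `0 ≤ d ≤ 4`, the square of `d` is at most `4 * d`, so the first moment of the gap also
    -- controls the second.
    have hA2 : A ^ 2 ≤ 4 * K ^ 2 * devSq m t x + 8 * s ^ 2 * d := by
      calc A ^ 2 = |A| ^ 2 := (sq_abs A).symm
        _ ≤ (K * E + s * d) ^ 2 := pow_le_pow_left₀ (abs_nonneg _) h1 2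
        _ ≤ 2 * (K * E) ^ 2 + 2 * (s * d) ^ 2 := by nlinarith [sq_nonneg (K * E - s * d)]
        _ = 2 * K ^ 2 * E ^ 2 + 2 * s ^ 2 * (d * d) := by ring
        _ ≤ 2 * K ^ 2 * (2 * devSq m t x) + 2 * s ^ 2 * (4 * d) := by gcongr
        _ = _ := by ring
    -- Young's inequality with a free weight, which the variance induction fixes later.
    have hAM : |g x| * |A| ≤ lam / 2 * g x ^ 2 + (2 * lam)⁻¹ * A ^ 2 := by
      have : 0 ≤ (lam * |g x| - |A|) ^ 2 := sq_nonneg _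
      have e : lam / 2 * g x ^ 2 + (2 * lam)⁻¹ * A ^ 2 - |g x| * |A|
          = (2 * lam)⁻¹ * (lam * |g x| - |A|) ^ 2 := by
        rw [← sq_abs (g x), ← sq_abs A]
        field_simp
        ring
      have h5 : 0 ≤ (2 * lam)⁻¹ * (lam * |g x| - |A|) ^ 2 := by positivity
      linarith
    rw [Real.norm_eq_abs, abs_mul]
    refine hAM.trans ?_
    gcongr
  · have i1 : Integrable (fun x => 2 - Q.signGap m a c t x) μ := (integrable_const _).sub hg1
    have i2 : Integrable (fun x => 4 * K ^ 2 * devSq m t x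
        + 8 * s ^ 2 * (2 - Q.signGap m a c t x)) μ := (hd1.const_mul _).add (i1.const_mul _)
    rw [integral_add (hgi.const_mul _) (i2.const_mul _), integral_const_mul,
      integral_const_mul, integral_add (hd1.const_mul _) (i1.const_mul _), integral_const_mul,
      integral_const_mul, integral_sub (integrable_const _) hg1]
    simp only [integral_const, probReal_univ, one_smul]
    have h6 : 8 * s ^ 2 * (2 - ∫ x, Q.signGap m a c t x ∂μ) ≤ 8 * s ^ 2 * (4 * δ) := by
      gcongr
      linarith
    have h7 : 4 * K ^ 2 * (∫ x, devSq m t x ∂μ) ≤ 4 * K ^ 2 * devConst ℓ b := by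
      gcongr
      exact hd2
    have h8 := mul_le_mul_of_nonneg_left (add_le_add h7 h6) (inv_nonneg.2 (by positivity) :
      0 ≤ (2 * lam)⁻¹)
    linarith

/-- The mean contribution of a step. -/
lemma abs_integral_stepTerm_sub_le (ha : 0 < a) (hac : a < c) (hn : r * m + 1 ≤ n)
    (hℓ : 0 < ℓ) (hb : 0 < b) (hm : 4 * numTypes ℓ b ≤ m) (hσ : 2 ≤ a * sigma m b)
    (hQ : Q.IsCorrect m a c δ P) (t : Fin r) :
    |(∫ x, Q.stepTerm t x ∂(attackLaw n ℓ b m r a c P)) - 2 * stepMean ℓ b m a c|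
      ≤ 2 * errConst ℓ b a c * devConst ℓ b + stepMean ℓ b m a c * (4 * δ) := by
  have hm0 : (0 : ℝ) < m := by linarith [one_le_numTypes (ℓ := ℓ) hb]
  have hm' : 0 < m := by exact_mod_cast hm0
  have := isProbabilityMeasure_stepLaw ha hac hm' hb
  have := isProbabilityMeasure_attackLaw (n := n) (ℓ := ℓ) (a := a) (c := c) hn hb P
  set μ := attackLaw n ℓ b m r a c P with hμ
  set K := errConst ℓ b a c with hK
  have hK0 : 0 ≤ K := errConst_nonneg ℓ b ha hac
  set s := stepMean ℓ b m a c with hs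
  have hs0 : 0 ≤ s :=
    div_nonneg (Real.sqrt_nonneg _) (mul_nonneg (Nat.cast_nonneg _) (by linarith))
  obtain ⟨hd1, hd2⟩ := integral_devSq_le (n := n) (ℓ := ℓ) (a := a) (c := c) hn hb hm' P t
  obtain ⟨hg1, hg2⟩ := Q.integral_two_sub_signGap_le hn hb P hσ hQ t
  have hY : Integrable (Q.stepTerm t) μ := memLp_one_iff_integrable.1
    (Q.memLp_stepTerm P hn hℓ hb t 1)
  have hf : Integrable (fun x => 1 * (Q.stepTerm t x - 2 * s)) μ :=
    (hY.sub (integrable_const _)).const_mul _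
  have e : (∫ x, Q.stepTerm t x ∂μ) - 2 * s = ∫ x, 1 * (Q.stepTerm t x - 2 * s) ∂μ := by
    simp only [one_mul]
    rw [integral_sub hY (integrable_const _)]
    simp
  obtain ⟨-, hr⟩ := integral_resample hn hb P t hf
  rw [e, hr]
  simp only [Q.avg_integral_mul_sub]
  have hB : Integrable (fun x => 2 * K * devSq m t x + s * (2 - Q.signGap m a c t x)) μ :=
    (hd1.const_mul _).add (((integrable_const _).sub hg1).const_mul _)
  refine (norm_integral_le_of_norm_le (f := fun x => 1 * (Q.meanStep m a c t x - 2 * s))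
    hB ?_).trans ?_
  · filter_upwards [ae_isTail hn hb P] with x hx
    have h1 := Q.abs_meanStep_sub_two_mul_le ha hac hℓ hb hm t x (hx t)
    rw [← hK, ← hs] at h1
    have h2 := one_add_div_le (m := m) t x
    rw [one_mul, Real.norm_eq_abs]
    refine h1.trans ?_
    have := mul_le_mul_of_nonneg_left h2 hK0
    linarith
  · have i1 : Integrable (fun x => 2 - Q.signGap m a c t x) μ := (integrable_const _).sub hg1
    rw [integral_add (hd1.const_mul _) (i1.const_mul _), integral_const_mul, integral_const_mul,
      integral_sub (integrable_const _) hg1]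
    simp only [integral_const, probReal_univ, one_smul]
    have h6 : s * (2 - ∫ x, Q.signGap m a c t x ∂μ) ≤ s * (4 * δ) := by
      gcongr
      linarith
    have h7 : 2 * K * (∫ x, devSq m t x ∂μ) ≤ 2 * K * devConst ℓ b := by
      gcongr
      exact hd2
    linarith

/-- The second moment of the contribution of a step. -/
lemma abs_integral_stepTerm_sq_sub_le (ha : 0 < a) (hac : a < c) (hn : r * m + 1 ≤ n)
    (hℓ : 0 < ℓ) (hb : 0 < b) (hm : 0 < m) (t : Fin r) :
    |(∫ x, Q.stepTerm t x ^ 2 ∂(attackLaw n ℓ b m r a c P)) - m / (b * ℓ)|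
      ≤ √m * devConst ℓ b := by
  have := isProbabilityMeasure_stepLaw ha hac hm hb
  have := isProbabilityMeasure_attackLaw (n := n) (ℓ := ℓ) (a := a) (c := c) hn hb P
  set μ := attackLaw n ℓ b m r a c P with hμ
  obtain ⟨hd1, hd2⟩ := integral_devSq_le (n := n) (ℓ := ℓ) (a := a) (c := c) hn hb hm P t
  have hY : Integrable (fun x => Q.stepTerm t x ^ 2) μ :=
    (Q.memLp_stepTerm P hn hℓ hb t 2).integrable_sq
  have hf : Integrable (fun x => Q.stepTerm t x ^ 2 - m / (b * ℓ)) μ :=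
    hY.sub (integrable_const _)
  have e : (∫ x, Q.stepTerm t x ^ 2 ∂μ) - m / (b * ℓ)
      = ∫ x, (Q.stepTerm t x ^ 2 - m / (b * ℓ)) ∂μ := by
    rw [integral_sub hY (integrable_const _)]
    simp
  obtain ⟨-, hr⟩ := integral_resample hn hb P t hf
  -- Squaring removes the report, so neither the algorithm nor `y` matters any more.
  have hx : ∀ x : AttackSpace n ℓ b r Ω, (avg fun θ : Fin n → Bool =>
      ∫ y, (Q.stepTerm t (resample t θ y x) ^ 2 - m / (b * ℓ)) ∂(stepLaw b m a c))
      = avg (fun θ : Fin n → Bool =>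
        avgAdjusted x.2.1 x.2.2.1.1 (signed θ (x.2.2.1.2 t)) ^ 2) - m / (b * ℓ) := by
    intro x
    have h : ∀ θ : Fin n → Bool,
        ∫ y, (Q.stepTerm t (resample t θ y x) ^ 2 - m / (b * ℓ)) ∂(stepLaw b m a c)
          = avgAdjusted x.2.1 x.2.2.1.1 (signed θ (x.2.2.1.2 t)) ^ 2 - m / (b * ℓ) := by
      intro θ
      simp only [stepTerm_sq, stepValue_resample, integral_const, probReal_univ, one_smul]
    simp only [h]
    rw [avg_sub, avg_const]
  rw [e, hr]
  simp only [hx]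
  have hD : ∫ x, √(m : ℝ) * devSq m t x ∂μ ≤ √m * devConst ℓ b := by
    rw [integral_const_mul]
    exact mul_le_mul_of_nonneg_left hd2 (Real.sqrt_nonneg _)
  refine le_trans (norm_integral_le_of_norm_le (f := fun x : AttackSpace n ℓ b r Ω =>
    avg (fun θ : Fin n → Bool =>
        avgAdjusted x.2.1 x.2.2.1.1 (signed θ (x.2.2.1.2 t)) ^ 2) - m / (b * ℓ))
    (hd1.const_mul √m) ?_) hD
  filter_upwards [ae_isTail hn hb P] with x hx
  rw [Real.norm_eq_abs]
  exact (avg_avgAdjusted_sq hℓ hb _ _ (hx t)).trans (typeDev_le_mul_devSq hm t x)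

end QueryResponse

end

/-! ### Accumulation over the steps -/

section

variable {n ℓ b m r : ℕ} {Ω : Type*} [MeasurableSpace Ω]

/-- Adding a variable to a sum changes the variance by its variance and a correlation. -/
lemma variance_add_eq {α : Type*} [MeasurableSpace α] {μ : Measure α} [IsProbabilityMeasure μ]
    {S Y : α → ℝ} (hS : MemLp S 2 μ) (hY : MemLp Y 2 μ) (κ : ℝ) :
    variance (fun x => S x + Y x) μ = variance S μ
      + 2 * (∫ x, (S x - ∫ x, S x ∂μ) * (Y x - κ) ∂μ)
      + ((∫ x, Y x ^ 2 ∂μ) - (∫ x, Y x ∂μ) ^ 2) := by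
  have h0 := variance_add hS hY
  have h1 : variance (fun x => S x + Y x) μ = variance (S + Y) μ := rfl
  have hSi : Integrable (fun x => S x - ∫ x, S x ∂μ) μ :=
    (hS.integrable one_le_two).sub (integrable_const _)
  have hS2 : MemLp (fun x => S x - ∫ x, S x ∂μ) 2 μ := hS.sub (memLp_const _)
  have hYκ : ∀ κ : ℝ, MemLp (fun x => Y x - κ) 2 μ := fun κ => hY.sub (memLp_const _)
  have hz : ∫ x, (S x - ∫ x, S x ∂μ) ∂μ = 0 := by
    rw [integral_sub (hS.integrable one_le_two) (integrable_const _)]; simp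
  -- Since `S` is centred, any constant may replace the mean of `Y`. The asymptotic mean of a step
  -- is the convenient choice.
  have h2 : covariance S Y μ = ∫ x, (S x - ∫ x, S x ∂μ) * (Y x - κ) ∂μ := by
    have e : ∀ x, (S x - ∫ x, S x ∂μ) * (Y x - ∫ x, Y x ∂μ)
        = (S x - ∫ x, S x ∂μ) * (Y x - κ) + (κ - ∫ x, Y x ∂μ) * (S x - ∫ x, S x ∂μ) := by
      intro x; ring
    have i1 : Integrable (fun x => (S x - ∫ x, S x ∂μ) * (Y x - κ)) μ :=
      hS2.integrable_mul (hYκ κ)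
    rw [covariance]
    simp only [e]
    rw [integral_add i1 (hSi.const_mul _), integral_const_mul, hz, mul_zero, add_zero]
  have h3 : variance Y μ = (∫ x, Y x ^ 2 ∂μ) - (∫ x, Y x ∂μ) ^ 2 := variance_eq_sub hY
  rw [h1, h0, h2, h3]

namespace QueryResponse

variable (Q : QueryResponse n ℓ b r Ω)

/-- The contribution of the first `k` steps to the bias. -/
def partialBias (k : ℕ) (x : AttackSpace n ℓ b r Ω) : ℝ :=
  ∑ t : Fin r with t.val < k, Q.stepTerm t x

lemma partialBias_zero : Q.partialBias 0 = fun _ => 0 := by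
  ext x; simp [partialBias]

lemma partialBias_succ {k : ℕ} (hk : k < r) :
    Q.partialBias (k + 1) = fun x => Q.partialBias k x + Q.stepTerm ⟨k, hk⟩ x := by
  ext x
  have h : (Finset.univ.filter fun t : Fin r => t.val < k + 1)
      = insert ⟨k, hk⟩ (Finset.univ.filter fun t : Fin r => t.val < k) := by
    ext t
    simp only [Finset.mem_filter, Finset.mem_univ, true_and, Finset.mem_insert, Fin.ext_iff]
    omega
  rw [partialBias, h, Finset.sum_insert (by simp), add_comm]
  rfl

lemma partialBias_eq : Q.partialBias r = Q.attackBias := by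
  ext x
  rw [attackBias_eq, partialBias, Finset.filter_true_of_mem fun t _ => t.isLt]
  rfl

lemma partialBias_resample {k : ℕ} (hk : k < r) (θ : Fin n → Bool) (y : ℝ)
    (x : AttackSpace n ℓ b r Ω) :
    Q.partialBias k (resample ⟨k, hk⟩ θ y x) = Q.partialBias k x :=
  Finset.sum_congr rfl fun _ ht =>
    Q.stepTerm_resample_of_lt (Finset.mem_filter.1 ht).2 θ y x

variable {a c δ : ℝ} (P : Measure Ω) [IsProbabilityMeasure P]

lemma memLp_partialBias (hn : r * m + 1 ≤ n) (hℓ : 0 < ℓ) (hb : 0 < b)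
    [IsProbabilityMeasure (stepLaw b m a c)] (k : ℕ) (p : ENNReal) :
    MemLp (Q.partialBias k) p (attackLaw n ℓ b m r a c P) :=
  memLp_finsetSum _ fun t _ => Q.memLp_stepTerm P hn hℓ hb t p

/-- The mean of the bias. -/
lemma abs_integral_attackBias_sub_le (ha : 0 < a) (hac : a < c) (hn : r * m + 1 ≤ n)
    (hℓ : 0 < ℓ) (hb : 0 < b) (hm : 4 * numTypes ℓ b ≤ m) (hσ : 2 ≤ a * sigma m b)
    (hQ : Q.IsCorrect m a c δ P) [IsProbabilityMeasure (stepLaw b m a c)] {η : ℝ}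
    (hη : 2 * errConst ℓ b a c * devConst ℓ b + stepMean ℓ b m a c * (4 * δ) ≤ η) :
    |(∫ x, Q.attackBias x ∂attackLaw n ℓ b m r a c P) - r * (2 * stepMean ℓ b m a c)|
      ≤ r * η := by
  have hE := fun t => (Q.abs_integral_stepTerm_sub_le P ha hac hn hℓ hb hm hσ hQ t).trans hη
  have hY := fun t => memLp_one_iff_integrable.1
    (Q.memLp_stepTerm (a := a) (c := c) P hn hℓ hb t 1)
  set s := stepMean ℓ b m a c
  set μ := attackLaw n ℓ b m r a c P
  have hsum : Q.attackBias = fun x => ∑ t, Q.stepTerm t x := funext fun x => attackBias_eq Q x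
  rw [hsum, integral_finsetSum _ fun t _ => hY t]
  have e : (r : ℝ) * (2 * s) = ∑ _t : Fin r, 2 * s := by simp
  rw [e, ← Finset.sum_sub_distrib]
  refine (Finset.abs_sum_le_sum_abs _ _).trans ?_
  refine (Finset.sum_le_sum fun t _ => hE t).trans ?_
  simp

/-- The variance of the contribution of the first `k` steps. -/
lemma abs_variance_partialBias_sub_le (ha : 0 < a) (hac : a < c) (hn : r * m + 1 ≤ n)
    (hℓ : 0 < ℓ) (hb : 0 < b) (hm : 4 * numTypes ℓ b ≤ m) (hσ : 2 ≤ a * sigma m b)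
    (hQ : Q.IsCorrect m a c δ P) {e : ℝ} (he : 0 < e) (he1 : e ≤ 1) {v : ℝ}
    (hv : v = m / (b * ℓ))
    (h1 : 2 * errConst ℓ b a c * devConst ℓ b + stepMean ℓ b m a c * (4 * δ)
      ≤ 2 * stepMean ℓ b m a c)
    (h2 : √m * devConst ℓ b ≤ e / 4 * v)
    (h3 : 16 * stepMean ℓ b m a c ^ 2 ≤ e / 4 * v)
    (h4 : 32 * r * (4 * errConst ℓ b a c ^ 2 * devConst ℓ b
          + 32 * stepMean ℓ b m a c ^ 2 * δ) ≤ e ^ 2 * v) {k : ℕ} (hk : k ≤ r) :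
    |variance (Q.partialBias k) (attackLaw n ℓ b m r a c P) - k * v| ≤ k * (e * v) := by
  have hm0 : (0 : ℝ) < m := by linarith [one_le_numTypes (ℓ := ℓ) hb]
  have hm' : 0 < m := by exact_mod_cast hm0
  have := isProbabilityMeasure_stepLaw ha hac hm' hb
  have := isProbabilityMeasure_attackLaw (n := n) (ℓ := ℓ) (a := a) (c := c) hn hb P
  have hv0 : 0 ≤ v := by rw [hv]; positivity
  set μ := attackLaw n ℓ b m r a c P with hμ
  set s := stepMean ℓ b m a c with hs
  set G := 4 * errConst ℓ b a c ^ 2 * devConst ℓ b + 32 * s ^ 2 * δ with hG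
  induction k with
  | zero =>
    have h0 : variance (fun _ : AttackSpace n ℓ b r Ω => (0 : ℝ)) μ = 0 := variance_zero μ
    rw [partialBias_zero, h0]
    simp
  | succ k ih =>
    have hkr : k < r := hk
    have ih := abs_le.1 (ih hkr.le)
    have hr : (0 : ℝ) < r := by exact_mod_cast (Nat.zero_le k).trans_lt hkr
    have hkr' : (k : ℝ) ≤ r := by exact_mod_cast hkr.le
    set t : Fin r := ⟨k, hkr⟩ with ht
    have hS := Q.memLp_partialBias (a := a) (c := c) P hn hℓ hb k 2
    have hY := Q.memLp_stepTerm (a := a) (c := c) P hn hℓ hb t 2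
    rw [Q.partialBias_succ hkr, variance_add_eq hS hY (2 * s)]
    set S := Q.partialBias k with hSdef
    have hvar : variance S μ = ∫ x, (S x - ∫ x, S x ∂μ) ^ 2 ∂μ :=
      variance_eq_integral hS.1.aemeasurable
    -- The inductive variance is at most `2 * r * v`, so `lam = e / (8 * r)` makes the first term at
    -- most `e / 8 * v`; `h4` is exactly what the second term then needs.
    have hcov := Q.abs_integral_mul_stepTerm_sub_le P ha hac hn hℓ hb hm hσ hQ t
      (g := fun x => S x - ∫ x, S x ∂μ) (hS.sub (memLp_const _))
      (fun θ y x => by rw [hSdef, ht, Q.partialBias_resample hkr])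
      (lam := e / (8 * r)) (by positivity)
    rw [← hμ, ← hs, ← hG, ← hvar] at hcov
    have hEY := Q.abs_integral_stepTerm_sub_le P ha hac hn hℓ hb hm hσ hQ t
    rw [← hμ, ← hs] at hEY
    have hEY2 := Q.abs_integral_stepTerm_sq_sub_le P ha hac hn hℓ hb hm' t
    rw [← hμ, ← hv] at hEY2
    set C := ∫ x, (S x - ∫ x, S x ∂μ) * (Q.stepTerm t x - 2 * s) ∂μ
    set M := ∫ x, Q.stepTerm t x ∂μ
    set M2 := ∫ x, Q.stepTerm t x ^ 2 ∂μ
    -- By `h1` the mean lies between 0 and `4 * s`.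
    have hM : M ^ 2 ≤ e / 4 * v := by
      have := abs_le.1 (hEY.trans h1)
      refine le_trans ?_ h3
      nlinarith [this.1, this.2]
    have hM2 := abs_le.1 (hEY2.trans h2)
    have hCle : |C| ≤ e / 4 * v := by
      refine hcov.trans ?_
      have e1 : e / (8 * r) / 2 * variance S μ ≤ e / 8 * v := by
        have : variance S μ ≤ 2 * r * v := by
          have h5 : (k : ℝ) * v ≤ r * v := by gcongr
          have h6 : (k : ℝ) * (e * v) ≤ r * v := by
            have : e * v ≤ v := mul_le_of_le_one_left hv0 he1
            gcongr
          linarith [ih.2]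
        calc e / (8 * r) / 2 * variance S μ ≤ e / (8 * r) / 2 * (2 * r * v) := by gcongr
          _ = e / 8 * v := by field_simp
      have e2 : (2 * (e / (8 * r)))⁻¹ * G ≤ e / 8 * v := by
        have : (2 * (e / (8 * r)))⁻¹ * G = (32 * r * G) / (8 * e) := by
          field_simp; ring
        rw [this, div_le_iff₀ (by positivity)]
        calc 32 * r * G ≤ e ^ 2 * v := h4
          _ = e / 8 * v * (8 * e) := by ring
      linarith
    have hC := abs_le.1 hCle
    have hM0 := sq_nonneg M
    -- Twice the covariance costs `e / 2 * v`; the second moment and the squared mean cost `e / 4 *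
    -- v` each.
    push_cast
    rw [abs_le]
    constructor <;> linarith [ih.1, ih.2, hM2.1, hM2.2, hC.1, hC.2]

end QueryResponse

lemma tendsto_sigma (hb : 0 < b) :
    Filter.Tendsto (fun m : ℕ => sigma m b) Filter.atTop Filter.atTop := by
  have hb' : (0 : ℝ) < b := by exact_mod_cast hb
  exact Real.tendsto_sqrt_atTop.comp (tendsto_natCast_atTop_atTop.atTop_div_const hb')

/-- `errConst` and `devConst` do not depend on `m`, whereas `sigma m b` and `stepMean` grow like
`√m` and the variance of a step like `m`. -/
lemma exists_large (hℓ : 0 < ℓ) (hb : 0 < b) (r : ℕ) {a c e : ℝ} (ha : 0 < a) (hac : a < c)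
    (he : 0 < e) : ∃ m₀ : ℕ, ∀ m : ℕ, m₀ ≤ m → 4 * numTypes ℓ b ≤ m ∧ 2 ≤ a * sigma m b ∧
      2 * errConst ℓ b a c * devConst ℓ b ≤ e * QueryResponse.stepMean ℓ b m a c ∧
      √m * devConst ℓ b ≤ e / 4 * (m / (b * ℓ)) ∧
      256 * r * errConst ℓ b a c ^ 2 * devConst ℓ b ≤ e ^ 2 * (m / (b * ℓ)) := by
  have hb' : (0 : ℝ) < b := by exact_mod_cast hb
  have hℓ' : (0 : ℝ) < ℓ := by exact_mod_cast hℓ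
  have hca : 0 < c + a := by linarith
  have hcast : Filter.Tendsto (fun m : ℕ => (m : ℝ)) Filter.atTop Filter.atTop :=
    tendsto_natCast_atTop_atTop
  have hsqrt : Filter.Tendsto (fun m : ℕ => √(m : ℝ)) Filter.atTop Filter.atTop :=
    Real.tendsto_sqrt_atTop.comp hcast
  have hσ := tendsto_sigma hb
  refine Filter.eventually_atTop.1 ?_
  filter_upwards [hcast.eventually_ge_atTop (4 * numTypes ℓ b), hσ.eventually_ge_atTop (2 / a),
    hσ.eventually_ge_atTop (2 * errConst ℓ b a c * devConst ℓ b * (ℓ * (c + a)) / e),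
    hsqrt.eventually_ge_atTop (4 * (devConst ℓ b * (b * ℓ)) / e),
    hcast.eventually_ge_atTop (256 * r * errConst ℓ b a c ^ 2 * devConst ℓ b * (b * ℓ) / e ^ 2)]
    with m h1 h2 h3 h4 h5
  refine ⟨h1, ?_, ?_, ?_, ?_⟩
  · rw [div_le_iff₀ ha] at h2; linarith
  · rw [div_le_iff₀ he] at h3
    rw [QueryResponse.stepMean, ← mul_div_assoc, le_div_iff₀ (by positivity)]
    linarith
  · rw [div_le_iff₀ he] at h4
    have hm : (m : ℝ) = √m * √m := (Real.mul_self_sqrt (Nat.cast_nonneg _)).symm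
    rw [← mul_div_assoc, le_div_iff₀ (by positivity)]
    nth_rewrite 2 [hm]
    have := mul_le_mul_of_nonneg_left h4 (Real.sqrt_nonneg (m : ℝ))
    linarith
  · rw [div_le_iff₀ (by positivity)] at h5
    rw [← mul_div_assoc, le_div_iff₀ (by positivity)]
    linarith

end

end CountSketch

end

/-! ### The theorem: choice of the constants -/

theorem mainTheorem2 :
    ∀ ε : ℝ, 0 < ε → ∃ κ : ℝ, 0 < κ ∧
      ∀ (ℓ b r : ℕ) (a c δ : ℝ), 0 < ℓ → 0 < b → 0 < a → a < c → 0 ≤ δ → δ ≤ κ →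
      ∃ m₀ : ℕ, ∀ m : ℕ, m₀ ≤ m → ∀ n : ℕ, r * m + 1 ≤ n →
      ∀ (Ω : Type*) [MeasurableSpace Ω] (P : Measure Ω) [IsProbabilityMeasure P]
        (Q : CountSketch.QueryResponse n ℓ b r Ω),
      Q.IsCorrect m a c δ P →
        MemLp Q.attackBias 2 (CountSketch.attackLaw n ℓ b m r a c P) ∧
        |(∫ x, Q.attackBias x ∂(CountSketch.attackLaw n ℓ b m r a c P))
            - (r : ℝ) / ℓ * (2 * CountSketch.sigma m b / (c + a))|
          ≤ ε * ((r : ℝ) / ℓ * (2 * CountSketch.sigma m b / (c + a))) ∧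
        (1 + r * δ ≤ κ * ℓ * (c + a) ^ 2 →
          |variance Q.attackBias (CountSketch.attackLaw n ℓ b m r a c P)
              - (r : ℝ) / ℓ * CountSketch.sigma m b ^ 2|
            ≤ ε * ((r : ℝ) / ℓ * CountSketch.sigma m b ^ 2)) := by
  intro ε hε
  -- The variance induction needs `e ≤ 1`, and so does `e ^ 2 ≤ e`.
  set e : ℝ := min ε 1 with he
  have he0 : 0 < e := lt_min hε one_pos
  have he1 : e ≤ 1 := min_le_right _ _
  have heε : e ≤ ε := min_le_left _ _
  -- The correlation bound requires `32 * r * 32 * s ^ 2 * δ` to be at most half of `e ^ 2 * v`;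
  -- with `v = s ^ 2 * q` this is `2048 * r * δ ≤ e ^ 2 * q`. The other half is left to the term
  -- with `errConst`. The bounds `4 * δ ≤ e` and `64 ≤ e * q` hold with room to spare.
  refine ⟨e ^ 2 / 2048, by positivity, ?_⟩
  intro ℓ b r a c δ hℓ hb ha hac hδ0 hδ
  obtain ⟨m₀, hm₀⟩ := CountSketch.exists_large hℓ hb r ha hac he0
  refine ⟨m₀, fun m hm n hn Ω _ P _ Q hQ => ?_⟩
  obtain ⟨h1, h2, h3, h4, h5⟩ := hm₀ m hm
  have hb' : (0 : ℝ) < b := by exact_mod_cast hb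
  have hℓ' : (0 : ℝ) < ℓ := by exact_mod_cast hℓ
  have hca : 0 < c + a := by linarith
  have hm0 : (0 : ℝ) < m := by linarith [CountSketch.one_le_numTypes (ℓ := ℓ) hb]
  have hm' : 0 < m := by exact_mod_cast hm0
  have hσ0 := CountSketch.sigma_pos hm' hb
  have hσ2 := CountSketch.QueryResponse.sigma_sq m b
  have := CountSketch.isProbabilityMeasure_stepLaw ha hac hm' hb
  have hδ1 : 4 * δ ≤ e := by nlinarith
  set s := CountSketch.QueryResponse.stepMean ℓ b m a c with hs
  have hsdef : s = CountSketch.sigma m b / (ℓ * (c + a)) := rfl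
  have hs0 : 0 < s := by rw [hsdef]; positivity
  have hmean : 2 * CountSketch.errConst ℓ b a c * CountSketch.devConst ℓ b + s * (4 * δ)
      ≤ e * (2 * s) := by nlinarith
  refine ⟨?_, ?_, fun hκ => ?_⟩
  · rw [← Q.partialBias_eq]
    exact Q.memLp_partialBias P hn hℓ hb r 2
  · have e1 : (r : ℝ) / ℓ * (2 * CountSketch.sigma m b / (c + a)) = r * (2 * s) := by
      rw [hsdef]; field_simp
    rw [e1]
    refine (Q.abs_integral_attackBias_sub_le P ha hac hn hℓ hb h1 h2 hQ hmean).trans ?_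
    calc (r : ℝ) * (e * (2 * s)) = e * (r * (2 * s)) := by ring
      _ ≤ ε * (r * (2 * s)) := by gcongr
  · set v : ℝ := m / (b * ℓ) with hv
    have hvσ : v = CountSketch.sigma m b ^ 2 / ℓ := by rw [hσ2, hv]; field_simp
    have hv0 : 0 < v := by rw [hv]; positivity
    set q : ℝ := ℓ * (c + a) ^ 2 with hq
    have hq0 : 0 < q := by rw [hq]; positivity
    have hsq : s ^ 2 * q = v := by rw [hsdef, hvσ, hq]; field_simp
    have hrδ : 0 ≤ r * δ := by positivity
    have hκ1 : 2048 * (1 + r * δ) ≤ e ^ 2 * q := by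
      have : e ^ 2 / 2048 * ℓ * (c + a) ^ 2 = e ^ 2 * q / 2048 := by rw [hq]; ring
      rw [this] at hκ
      linarith
    have hee : e ^ 2 ≤ e := pow_le_of_le_one he0.le he1 two_ne_zero
    have h6 : 16 * s ^ 2 ≤ e / 4 * v := by
      have h8 : 2048 ≤ e * q := by linarith [mul_le_mul_of_nonneg_right hee hq0.le]
      have h9 := mul_le_mul_of_nonneg_right h8 (sq_nonneg s)
      have h10 := sq_nonneg s
      rw [← hsq]
      linarith only [h9, h10]
    have h7 : 32 * r * (4 * CountSketch.errConst ℓ b a c ^ 2 * CountSketch.devConst ℓ b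
          + 32 * s ^ 2 * δ) ≤ e ^ 2 * v := by
      have h8 : 2048 * (r * δ) * s ^ 2 ≤ e ^ 2 * v := by
        rw [← hsq]
        have : 2048 * (r * δ) ≤ e ^ 2 * q := by linarith
        have := mul_le_mul_of_nonneg_right this (sq_nonneg s)
        linarith only [this]
      linarith only [h5, h8]
    have main := Q.abs_variance_partialBias_sub_le P ha hac hn hℓ hb h1 h2 hQ he0 he1 hv
      (by linarith [mul_le_of_le_one_left (by positivity : 0 ≤ 2 * s) he1]) h4 h6 h7 le_rfl
    rw [Q.partialBias_eq] at main
    have e1 : (r : ℝ) / ℓ * CountSketch.sigma m b ^ 2 = r * v := by rw [hvσ]; ring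
    rw [e1]
    refine main.trans ?_
    calc (r : ℝ) * (e * v) = e * (r * v) := by ring
      _ ≤ ε * (r * v) := by gcongr
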